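/- Let $D_1$ and $D_2$ be connected oriented link diagrams such that $D_1$ is reduced, i.e. has no nugatory crossing (no crossing whose removal disconnects the diagram). If $D_1$ and $D_2$ are related by a sequence of flypes, then their Seifert graphs $G_S(D_1)$ and $G_S(D_2)$ are flip-equivalent, that is, related (up to isomorphism of multigraphs) by a sequence of Whitney flips of Types A, B or C. Here the Seifert graph $G_S(D)$ is the multigraph whose vertices are the Seifert circles of $D$ (the circles left after smoothing all crossings according to the orientation) and in which each crossing is an edge joining the two Seifert circles that meet there. A flype moves a crossing from one side of a tangle $T$ of the diagram to the other, while turning $T$ by $180^\circ$ about the horizontal axis. Let $G$ be a multigraph. A block of $G$ is a maximal induced connected subgraph without cut vertices. A 2-cut is a pair $\{v_1,v_2\}$ of distinct vertices of a common block $B$ such that deleting $v_1,v_2$ from $B$ leaves a disconnected graph. For an induced connected subgraph $H$ of $G$, let $\partial_G H$ be the set of vertices of $H$ incident with an edge of $G$ that is not in $H$. $H$ is $\{v\}$-dependent in $G$ if $v$ is a cut vertex of $G$ and $\partial_G H=\{v\}$; it is $\{v_1,v_2\}$-dependent in $G$ if $\{v_1,v_2\}$ is a 2-cut of $G$ and $\partial_G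 H=\{v_1,v_2\}$. - Type A flip: $v_1,v_2$ are joined by an edge and $H$ is $\{v_1,v_2\}$-dependent; $H$ is detached and reattached with $v_1$ and $v_2$ exchanged. - Type B flip: $v_1,v_2$ are joined by an edge, $H$ is $\{v_1\}$-dependent and $v_2\notin H$; $H$ is detached from $v_1$ and reattached at $v_2$, all other edges staying in place. - Type C flip: $v_0,v_1,v_2$ are distinct vertices, $e$ is the only edge between $v_0$ and $v_2$, and $H$ is an induced connected subgraph of $G$ that is $\{v_1\}$-dependent in $G-e$, with $v_0\in H$ and $v_2\notin H$; $H$ is reattached with its vertex $v_0$ identified with $v_2$, its vertex $v_1$ becomes a new vertex (now called $v_0$) no longer identified with the old $v_1$, and $e$ is moved to join $v_1$ and the new $v_0$. -/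

import Mathlib

/-! ### Combinatorial maps

A link diagram on the oriented sphere is encoded by its plane map. Nodes are crossings
(four darts) and subdivision points (two darts); a dart is an end of an arc at a node. -/

/-- The darts at the crossings `X` and at the points `P`. The darts `cr c 0`, `cr c 1`, `cr c 2`,
`cr c 3` leave the crossing `c` in counterclockwise order, so `cr c i` and `cr c (i + 2)` are
opposite and belong to the same strand. The darts `pt p false` and `pt p true` are the two
directions at a point `p` in the interior of an arc. -/
inductive Dart (X P : Type) : Type
  | cr (c : X) (i : Fin 4) : Dart X P
  | pt (p : P) (b : Bool) : Dart X P

namespace Dart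

/-- The next dart at the same node, in counterclockwise order. -/
def rot {X P : Type} : Dart X P → Dart X P
  | cr c i => cr c (i + 1)
  | pt p b => pt p (!b)

end Dart

/-- Planarity of the map with edge involution `edge`. The dart `x` also names the corner between
`x` and `rot x`, which is to the left of `x` when one leaves the node. A face is a cycle of corners
under `x ↦ edge (rot x)`. The map is planar if every mod 2 cycle `Z` in its graph is the boundary
of a union of faces (the colour `f = 1`), that is, if every component of the closed surface that is
obtained by gluing a disc into each face has `H₁(·; ℤ/2) = 0`, i.e. is a sphere. -/
def IsPlanarMap {X P : Type} (edge : Dart X P → Dart X P) : Prop :=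
  ∀ Z : Dart X P → ZMod 2,
    (∀ x, Z (edge x) = Z x) →
    (∀ c, Z (.cr c 0) + Z (.cr c 1) + Z (.cr c 2) + Z (.cr c 3) = 0) →
    (∀ p, Z (.pt p false) + Z (.pt p true) = 0) →
    ∃ f : Dart X P → ZMod 2,
      (∀ x, f (edge x.rot) = f x) ∧ (∀ x, f x.rot = f x + Z x.rot)

/-- The map is connected: a nonempty set of darts that is closed under `edge` and `rot`
is everything. -/
def IsConnectedMap {X P : Type} (edge : Dart X P → Dart X P) : Prop :=
  ∀ A : Set (Dart X P), A.Nonempty → (∀ x ∈ A, edge x ∈ A) → (∀ x ∈ A, x.rot ∈ A) → A = Set.univ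

/-! ### Link diagrams -/

/-- The raw data of an oriented link diagram: crossings, points, which darts are joined by an edge,
which darts at a crossing belong to the over-strand, and which darts point out of their node with
respect to the orientation of the link. -/
structure DiagramData : Type 1 where
  X : Type
  P : Type
  edge : Dart X P → Dart X P
  isOver : X → Fin 4 → Bool
  out : Dart X P → Bool

/-- A connected oriented link diagram. Arcs may carry finitely many subdivision points, so that
closed components without crossings are covered as well. -/
structure LinkDiagram : Type 1 extends DiagramData where
  finite_X : Finite X
  finite_P : Finite P
  edge_edge : ∀ x, edge (edge x) = x
  edge_ne : ∀ x, edge x ≠ x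
  planar : IsPlanarMap edge
  connected : IsConnectedMap edge
  isOver_succ : ∀ c i, isOver c (i + 1) = !isOver c i
  out_edge : ∀ x, out (edge x) = !out x
  out_cr : ∀ c i, out (.cr c (i + 2)) = !out (.cr c i)
  out_pt : ∀ p b, out (.pt p (!b)) = !out (.pt p b)

/-- An isomorphism of diagram data: an orientation preserving isomorphism of the maps which
respects the crossing information and the orientations of the strands. -/
structure DiagramData.Iso (D E : DiagramData) where
  crossings : D.X ≃ E.X
  darts : Dart D.X D.P ≃ Dart E.X E.P
  darts_cr : ∀ c i, ∃ j, darts (.cr c i) = .cr (crossings c) j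
  darts_rot : ∀ x, darts x.rot = (darts x).rot
  darts_edge : ∀ x, darts (D.edge x) = E.edge (darts x)
  darts_out : ∀ x, E.out (darts x) = D.out x
  darts_over : ∀ c i j, darts (.cr c i) = .cr (crossings c) j → E.isOver (crossings c) j = D.isOver c i

open Classical in
/-- Put one new point, `none`, on the edge between the darts `x` and `D.edge x`. -/
noncomputable def DiagramData.subdivide (D : DiagramData) (x : Dart D.X D.P) : DiagramData :=
  let old : Dart D.X D.P → Dart D.X (Option D.P) := fun y => match y with
    | .cr c i => .cr c i
    | .pt p b => .pt (some p) b
  let oldEdge : Dart D.X D.P → Dart D.X (Option D.P) := fun y =>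
    if y = x then .pt none false else if y = D.edge x then .pt none true else old (D.edge y)
  { X := D.X
    P := Option D.P
    edge := fun y => match y with
      | .cr c i => oldEdge (.cr c i)
      | .pt (some p) b => oldEdge (.pt p b)
      | .pt none false => old x
      | .pt none true => old (D.edge x)
    isOver := D.isOver
    out := fun y => match y with
      | .cr c i => D.out (.cr c i)
      | .pt (some p) b => D.out (.pt p b)
      | .pt none false => !D.out x
      | .pt none true => D.out x }

/-- `E` is `D`, up to isomorphism, possibly with one more subdivision point. -/
def LinkDiagram.Refines (D E : LinkDiagram) : Prop :=
  Nonempty (D.toDiagramData.Iso E.toDiagramData) ∨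
    ∃ x, Nonempty ((D.toDiagramData.subdivide x).Iso E.toDiagramData)

/-- A crossing is nugatory if the (connected) diagram falls apart when the crossing is removed. -/
def LinkDiagram.IsNugatory (D : LinkDiagram) (c : D.X) : Prop :=
  ∃ A : Set (Dart D.X D.P), A.Nonempty ∧ A ≠ Set.univ ∧ (∀ x ∈ A, D.edge x ∈ A) ∧
    (∀ d i, d ≠ c → .cr d i ∈ A → .cr d (i + 1) ∈ A) ∧ (∀ p b, .pt p b ∈ A → .pt p (!b) ∈ A)

/-- A diagram is reduced if it has no nugatory crossing. -/
def LinkDiagram.IsReduced (D : LinkDiagram) : Prop :=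
  ∀ c, ¬ D.IsNugatory c

/-! ### The Seifert graph -/

/-- Darts that are joined by an edge, by passing through a point, or by the smoothing of a crossing,
which joins each incoming end to the neighbouring outgoing end. -/
inductive LinkDiagram.SeifertStep (D : LinkDiagram) : Dart D.X D.P → Dart D.X D.P → Prop
  | edge (x : Dart D.X D.P) : SeifertStep D x (D.edge x)
  | point (p : D.P) : SeifertStep D (.pt p false) (.pt p true)
  | smooth (c : D.X) (i : Fin 4) (h : D.out (.cr c i) ≠ D.out (.cr c (i + 1))) :
      SeifertStep D (.cr c i) (.cr c (i + 1))

/-- The Seifert circles: the circles that remain after all crossings have been smoothed. -/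
def LinkDiagram.SeifertCircle (D : LinkDiagram) : Type :=
  Quot D.SeifertStep

/-- The Seifert circle that passes through a dart. -/
def LinkDiagram.circle (D : LinkDiagram) (x : Dart D.X D.P) : D.SeifertCircle :=
  Quot.mk _ x

/-- At a crossing `i` is joined by the smoothing to one of its two neighbours. -/
theorem LinkDiagram.circle_or (D : LinkDiagram) (c : D.X) (i : Fin 4) :
    D.circle (.cr c i) = D.circle (.cr c (i + 1)) ∧
        D.circle (.cr c (i + 2)) = D.circle (.cr c (i + 3)) ∨
      D.circle (.cr c (i + 1)) = D.circle (.cr c (i + 2)) ∧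
        D.circle (.cr c (i + 3)) = D.circle (.cr c i) := by
  have e2 : i + 1 + 1 = i + 2 := by grind
  have e3 : i + 2 + 1 = i + 3 := by grind
  have e4 : i + 3 + 1 = i := by grind
  have e5 : i + 1 + 2 = i + 3 := by grind
  have h1 := D.out_cr c i
  have h2 := D.out_cr c (i + 1)
  rw [e5] at h2
  by_cases h : D.out (.cr c i) = D.out (.cr c (i + 1))
  · right
    constructor
    · have := SeifertStep.smooth (D := D) c (i + 1) (by rw [e2, h1, h]; simp)
      rw [e2] at this
      exact Quot.sound this
    · have := SeifertStep.smooth (D := D) c (i + 3) (by rw [e4, h2, h]; simp)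
      rw [e4] at this
      exact Quot.sound this
  · left
    constructor
    · exact Quot.sound (SeifertStep.smooth (D := D) c i h)
    · have := SeifertStep.smooth (D := D) c (i + 2) (by
        rw [e3, h1, h2]; intro h'; exact h (by simpa using h'))
      rw [e3] at this
      exact Quot.sound this

/-- The Seifert graph: the vertices are the Seifert circles, and every crossing is an edge between
the two Seifert circles that touch it (opposite darts at a crossing lie on the two different arcs of
the smoothed crossing). -/
def LinkDiagram.seifertGraph (D : LinkDiagram) : Graph D.SeifertCircle D.X where
  vertexSet := Set.univ
  IsLink c u v := ∃ i : Fin 4, u = D.circle (.cr c i) ∧ v = D.circle (.cr c (i + 2))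
  isLink_symm := by
    intro c _
    constructor
    rintro u v ⟨i, rfl, rfl⟩
    refine ⟨i + 2, rfl, ?_⟩
    have : i + 2 + 2 = i := by grind
    rw [this]
  eq_or_eq_of_isLink_of_isLink := by
    rintro c u v u' v' ⟨i, rfl, rfl⟩ ⟨j, rfl, rfl⟩
    have hj : j = i ∨ j = i + 1 ∨ j = i + 2 ∨ j = i + 3 := by
      revert i j; decide
    have e1 : i + 1 + 2 = i + 3 := by grind
    have e2 : i + 2 + 2 = i := by grind
    have e3 : i + 3 + 2 = i + 1 := by grind
    rcases hj with rfl | rfl | rfl | rfl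
    · exact Or.inl rfl
    · rw [e1]
      rcases D.circle_or c i with h | h
      · exact Or.inl h.1
      · exact Or.inr h.2.symm
    · rw [e2]
      exact Or.inr rfl
    · rw [e3]
      rcases D.circle_or c i with h | h
      · exact Or.inr h.1
      · exact Or.inl h.2.symm
  left_mem_of_isLink := fun _ _ _ _ => Set.mem_univ _

/-! ### Tangles and flypes

The four ends of a disc are numbered counterclockwise around the disc: `0 = NW`, `1 = SW`, `2 = SE`,
`3 = NE`. -/

/-- The raw data of a tangle with crossings `Y`. The side of the boundary circle that does not
contain the tangle is collapsed to an additional vertex `none` with four darts, in counterclockwise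
order around that vertex. -/
structure TangleData : Type 1 where
  Y : Type
  P : Type
  edge : Dart (Option Y) P → Dart (Option Y) P
  isOver : Y → Fin 4 → Bool
  out : Dart (Option Y) P → Bool

/-- The data describe an oriented tangle diagram with four ends in a disc. -/
structure TangleData.IsTangle (T : TangleData) : Prop where
  finite_Y : Finite T.Y
  finite_P : Finite T.P
  edge_edge : ∀ x, T.edge (T.edge x) = x
  edge_ne : ∀ x, T.edge x ≠ x
  planar : IsPlanarMap T.edge
  isOver_succ : ∀ c i, T.isOver c (i + 1) = !T.isOver c i
  out_edge : ∀ x, T.out (T.edge x) = !T.out x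
  out_cr : ∀ c i, T.out (.cr (some c) (i + 2)) = !T.out (.cr (some c) i)
  out_pt : ∀ p b, T.out (.pt p (!b)) = !T.out (.pt p b)

/-- The relabelling of the darts under the half turn around the horizontal axis. The cyclic order at
each crossing is reversed; for a tangle whose dart `cr none (-k)` is the end at position `k`, the
ends `NW`, `SW` are exchanged, and so are `NE`, `SE`. -/
def halfTurn {Y P : Type} : Dart (Option Y) P → Dart (Option Y) P
  | .cr (some c) i => .cr (some c) (-i)
  | .cr none i => .cr none (-1 - i)
  | .pt p b => .pt p b

/-- The tangle turned by 180 degrees around the horizontal axis of the projection plane: the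
projection is reflected and over-strands become under-strands. -/
def TangleData.turn (T : TangleData) : TangleData where
  Y := T.Y
  P := T.P
  edge x := halfTurn (T.edge (halfTurn x))
  isOver c i := !T.isOver c (-i)
  out x := T.out (halfTurn x)

/-- The crossings of a diagram composed of a tangle, of the rest, and of one further crossing. -/
inductive GlueCrossing (A B : Type) : Type
  | tangle (a : A) : GlueCrossing A B
  | rest (b : B) : GlueCrossing A B
  | pivot : GlueCrossing A B

/-- The points of such a diagram; `tangleEnd k` and `restEnd k` are points on the boundary circles
of the disc of the tangle and of the disc that contains the tangle and the further crossing. -/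
inductive GluePoint (A B : Type) : Type
  | tangle (a : A) : GluePoint A B
  | rest (b : B) : GluePoint A B
  | tangleEnd (k : Fin 4) : GluePoint A B
  | restEnd (k : Fin 4) : GluePoint A B

/-- The twelve ends that have to be joined: those of the tangle and those of the rest by their
position, and the four darts of the further crossing, also by position. -/
inductive Socket : Type
  | tangle (k : Fin 4) : Socket
  | rest (k : Fin 4) : Socket
  | pivot (k : Fin 4) : Socket

/-- A dart of the tangle as a dart of the composed diagram. The additional vertex is seen from
outside of the disc, so its dart `-k` is the end of the tangle at position `k`. -/
def tangleDart {A P B Q : Type} : Dart (Option A) P → Dart (GlueCrossing A B) (GluePoint P Q)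
  | .cr (some a) i => .cr (.tangle a) i
  | .cr none i => .pt (.tangleEnd (-i)) false
  | .pt p b => .pt (.tangle p) b

/-- A dart of the rest as a dart of the composed diagram. The additional vertex of the rest sits in
the disc of the tangle and the further crossing, so its dart `k` is the end at position `k`. -/
def restDart {A P B Q : Type} : Dart (Option B) Q → Dart (GlueCrossing A B) (GluePoint P Q)
  | .cr (some a) i => .cr (.rest a) i
  | .cr none i => .pt (.restEnd i) false
  | .pt p b => .pt (.rest p) b

/-- An end as a dart of the composed diagram. -/
def socketDart {A P B Q : Type} : Socket → Dart (GlueCrossing A B) (GluePoint P Q)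
  | .tangle k => .pt (.tangleEnd k) true
  | .rest k => .pt (.restEnd k) true
  | .pivot k => .cr .pivot k

/-- The diagram composed of the tangle `T`, of the rest `R` and of one further crossing (with
over-strand given by `o`), whose ends are joined as prescribed by `wire`. -/
def glue (T R : TangleData) (o : Fin 4 → Bool) (wire : Socket → Socket) : DiagramData where
  X := GlueCrossing T.Y R.Y
  P := GluePoint T.P R.P
  edge x := match x with
    | .cr (.tangle a) i => tangleDart (T.edge (.cr (some a) i))
    | .cr (.rest a) i => restDart (R.edge (.cr (some a) i))
    | .cr .pivot k => socketDart (wire (.pivot k))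
    | .pt (.tangle p) b => tangleDart (T.edge (.pt p b))
    | .pt (.rest p) b => restDart (R.edge (.pt p b))
    | .pt (.tangleEnd k) false => tangleDart (T.edge (.cr none (-k)))
    | .pt (.restEnd k) false => restDart (R.edge (.cr none k))
    | .pt (.tangleEnd k) true => socketDart (wire (.tangle k))
    | .pt (.restEnd k) true => socketDart (wire (.rest k))
  isOver c i := match c with
    | .tangle a => T.isOver a i
    | .rest a => R.isOver a i
    | .pivot => o i
  out x := match x with
    | .cr (.tangle a) i => T.out (.cr (some a) i)
    | .cr (.rest a) i => R.out (.cr (some a) i)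
    | .cr .pivot k => match wire (.pivot k) with
      | .tangle l => T.out (.cr none (-l))
      | .rest l => R.out (.cr none l)
      | .pivot _ => false
    | .pt (.tangle p) b => T.out (.pt p b)
    | .pt (.rest p) b => R.out (.pt p b)
    | .pt (.tangleEnd k) false => T.out (.cr none (-k))
    | .pt (.restEnd k) false => R.out (.cr none k)
    | .pt (.tangleEnd k) true => !T.out (.cr none (-k))
    | .pt (.restEnd k) true => !R.out (.cr none k)

/-- The further crossing is to the right of the tangle: its `NW` and `SW` ends are joined to the
`NE` and `SE` ends of the tangle. -/
def wireRight : Socket → Socket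
  | .tangle 0 => .rest 0
  | .tangle 1 => .rest 1
  | .tangle 2 => .pivot 1
  | .tangle 3 => .pivot 0
  | .rest 0 => .tangle 0
  | .rest 1 => .tangle 1
  | .rest 2 => .pivot 2
  | .rest 3 => .pivot 3
  | .pivot 0 => .tangle 3
  | .pivot 1 => .tangle 2
  | .pivot 2 => .rest 2
  | .pivot 3 => .rest 3

/-- The further crossing is to the left of the tangle: its `NE` and `SE` ends are joined to the
`NW` and `SW` ends of the tangle. -/
def wireLeft : Socket → Socket
  | .tangle 0 => .pivot 3
  | .tangle 1 => .pivot 2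
  | .tangle 2 => .rest 2
  | .tangle 3 => .rest 3
  | .rest 0 => .pivot 0
  | .rest 1 => .pivot 1
  | .rest 2 => .tangle 2
  | .rest 3 => .tangle 3
  | .pivot 0 => .rest 0
  | .pivot 1 => .rest 1
  | .pivot 2 => .tangle 1
  | .pivot 3 => .tangle 0

/-- A flype: the crossing moves from the right side of the tangle `T` to its left side, while `T` is
turned by 180 degrees around the horizontal axis and the rest `R` stays fixed. -/
def LinkDiagram.Flype (D E : LinkDiagram) : Prop :=
  ∃ (T R : TangleData) (o : Fin 4 → Bool), T.IsTangle ∧ R.IsTangle ∧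
    Nonempty (D.toDiagramData.Iso (glue T R o wireRight)) ∧
    Nonempty (E.toDiagramData.Iso (glue T.turn R o wireLeft))

/-- `D` and `E` are related by a sequence of flypes, where diagrams are considered up to isomorphism
and up to subdivision points. -/
def LinkDiagram.FlypeRelated : LinkDiagram → LinkDiagram → Prop :=
  Relation.ReflTransGen fun D E => D.Flype E ∨ D.Refines E ∨ E.Refines D

/-! ### Whitney flips of multigraphs -/

namespace Graph

/-- Any two vertices are joined by a path. -/
def AllJoined {α β : Type*} (G : Graph α β) : Prop :=
  ∀ x ∈ G.vertexSet, ∀ y ∈ G.vertexSet, Relation.ReflTransGen G.Adj x y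

/-- A connected (nonempty) graph. -/
def IsConn {α β : Type*} (G : Graph α β) : Prop :=
  G.vertexSet.Nonempty ∧ G.AllJoined

/-- A cut vertex: deleting it separates two vertices that were joined by a path. -/
def IsCutVertex {α β : Type*} (G : Graph α β) (v : α) : Prop :=
  v ∈ G.vertexSet ∧ ∃ x ∈ G.vertexSet, ∃ y ∈ G.vertexSet, x ≠ v ∧ y ≠ v ∧
    Relation.ReflTransGen G.Adj x y ∧ ¬ Relation.ReflTransGen (G.deleteVerts {v}).Adj x y

/-- Induced, connected and without cut vertices. -/
def IsBlockLike {α β : Type*} (G B : Graph α β) : Prop :=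
  B.IsInducedSubgraph G ∧ B.IsConn ∧ ∀ v, ¬ B.IsCutVertex v

/-- A block: a maximal induced connected subgraph without cut vertices. -/
def IsBlock {α β : Type*} (G B : Graph α β) : Prop :=
  G.IsBlockLike B ∧ ∀ B' : Graph α β, G.IsBlockLike B' → B ≤ B' → B = B'

/-- A 2-cut: two vertices of a common block whose deletion disconnects that block. -/
def IsTwoCut {α β : Type*} (G : Graph α β) (v₁ v₂ : α) : Prop :=
  v₁ ≠ v₂ ∧ ∃ B : Graph α β, G.IsBlock B ∧ v₁ ∈ B.vertexSet ∧ v₂ ∈ B.vertexSet ∧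
    ¬ (B.deleteVerts {v₁, v₂}).AllJoined

/-- The vertices that `H` shares with the rest of `G`. -/
def attachments {α β : Type*} (G H : Graph α β) : Set α :=
  {v | v ∈ H.vertexSet ∧ ∃ e, e ∉ H.edgeSet ∧ G.Inc e v}

/-- The induced connected subgraph `H` of `G` is `{v}`-dependent. -/
def IsOneDependent {α β : Type*} (G H : Graph α β) (v : α) : Prop :=
  H.IsInducedSubgraph G ∧ H.IsConn ∧ G.IsCutVertex v ∧ G.attachments H = {v}

/-- The induced connected subgraph `H` of `G` is `{v₁, v₂}`-dependent. -/
def IsTwoDependent {α β : Type*} (G H : Graph α β) (v₁ v₂ : α) : Prop :=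
  H.IsInducedSubgraph G ∧ H.IsConn ∧ G.IsTwoCut v₁ v₂ ∧ G.attachments H = {v₁, v₂}

/-- `G'` has the same vertices and edges as `G`, but every end `x` of an edge `e` is moved to
`σ e x`. -/
def IsRewiring {α β : Type*} (G G' : Graph α β) (σ : β → α → α) : Prop :=
  G'.vertexSet = G.vertexSet ∧
    ∀ e x y, G'.IsLink e x y ↔ ∃ a b, G.IsLink e a b ∧ x = σ e a ∧ y = σ e b

open Classical in
/-- Type A flip: `v₁` and `v₂` are joined by an edge, and `H` is reattached with `v₁` and `v₂`
exchanged. -/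
def FlipA {α β : Type*} (G G' : Graph α β) : Prop :=
  ∃ (H : Graph α β) (v₁ v₂ : α), G.IsTwoDependent H v₁ v₂ ∧ G.Adj v₁ v₂ ∧
    G.IsRewiring G' fun f x =>
      if f ∈ H.edgeSet then (if x = v₁ then v₂ else if x = v₂ then v₁ else x) else x

open Classical in
/-- Type B flip: `v₁` and `v₂` are joined by an edge, which stays in place, and `H` is moved
from `v₁` to `v₂`. -/
def FlipB {α β : Type*} (G G' : Graph α β) : Prop :=
  ∃ (H : Graph α β) (v₁ v₂ : α), v₁ ≠ v₂ ∧ G.Adj v₁ v₂ ∧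
    G.IsOneDependent H v₁ ∧ v₂ ∉ H.vertexSet ∧
    G.IsRewiring G' fun f x =>
      if f ∈ H.edgeSet then (if x = v₁ then v₂ else x) else x

open Classical in
/-- Type C flip: `e` is the only edge between `v₀` and `v₂`, and `H` contains `v₀` and depends on
`v₁` in `G - e`. The end `v₀` of `H` is attached to `v₂`, the end `v₁` of `H` becomes a vertex of its
own, which is named `v₀`, and `e` is moved to join `v₀` and `v₁`. -/
def FlipC {α β : Type*} (G G' : Graph α β) : Prop :=
  ∃ (H : Graph α β) (e : β) (v₀ v₁ v₂ : α), v₀ ≠ v₁ ∧ v₀ ≠ v₂ ∧ v₁ ≠ v₂ ∧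
    (∀ f, G.IsLink f v₀ v₂ ↔ f = e) ∧
    H.IsInducedSubgraph G ∧ (G.deleteEdges {e}).IsOneDependent H v₁ ∧
    v₀ ∈ H.vertexSet ∧ v₂ ∉ H.vertexSet ∧
    G.IsRewiring G' fun f x =>
      if f ∈ H.edgeSet then (if x = v₀ then v₂ else if x = v₁ then v₀ else x)
      else if f = e then (if x = v₂ then v₁ else x)
      else x

/-- A Whitney flip of Type A, B or C. -/
def WhitneyFlip {α β : Type*} (G G' : Graph α β) : Prop :=
  G.FlipA G' ∨ G.FlipB G' ∨ G.FlipC G'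

/-- Isomorphism of multigraphs. -/
def Isomorphic {α β α' β' : Type*} (G : Graph α β) (G' : Graph α' β') : Prop :=
  ∃ (f : G.vertexSet ≃ G'.vertexSet) (g : G.edgeSet ≃ G'.edgeSet),
    ∀ (e : G.edgeSet) (x y : G.vertexSet), G.IsLink e x y ↔ G'.IsLink (g e) (f x) (f y)

/-- Flip equivalence: a sequence of Whitney flips of Types A, B or C turns `G` into a graph
isomorphic to `G'`. -/
def FlipEquivalent {α β α' β' : Type*} (G : Graph α β) (G' : Graph α' β') : Prop :=
  ∃ G₁ : Graph α β, Relation.ReflTransGen WhitneyFlip G G₁ ∧ G₁.Isomorphic G'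

end Graph

/-! # Flypes and Whitney flips

One flype at a time is considered; a composed diagram consists of the tangle `T`, the rest `R` and
one further crossing, the pivot. Smoothing all crossings inside of `T` leaves closed circles and
two disjoint arcs between the four ends of `T`. By planarity, and since as many strands enter `T`
as leave it, these arcs are either both horizontal or both vertical, and the orientations at the
ends may force which of the two (`TangleData.IsTangle.arcs`). The same holds for `R`. Hence the
Seifert graph is obtained from a graph for `T` and a graph for `R`, which depend on the tangles
only, by identifying the vertices at the ends in a way that is prescribed by the wiring, and by
adding the edge of the pivot. This is expressed by the universal property `IsPushout`; the gluing
before and after the flype is described by `RightCompat` and `LeftCompat`. A half turn of `T` only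
renumbers its ends (`turnArc`).

A comparison of the two gluings (`exists_flips`) leaves these cases.

* The pivot is smoothed horizontally. Then the arcs of `T` and `R` are horizontal as well, the two
  graphs share the two circles through the ends, which are joined by the pivot, and the flype
  exchanges these two vertices in the graph of `T`.
* The pivot is smoothed vertically and the arcs of `T` or those of `R` are horizontal. Then the
  flype moves one of the graphs from one end of the pivot to the other. This is again an exchange
  of the two ends of the pivot in one of the graphs.
* All arcs are vertical. Then the graph of `T` is attached to the graph of `R` at one vertex,
  another vertex of it is an end of the pivot, and the flype exchanges the roles of these
  vertices. This is a Type C flip (`Graph.flipC_of_not_bridge`). It needs that the pivot is not a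
  bridge of the Seifert graph, that is, that the pivot is not nugatory.

The exchange of the ends `U`, `W` of an edge in a part attached at `U` and `W` is a sequence of
flips (`Graph.flips_swapOn`): the components of the part that are attached only at `U`, or only at
`W`, are moved by Type B flips, and the others together by one Type A flip. The latter requires
`U` and `W` to be a 2-cut, which holds if the complementary part also connects `U` and `W`
(`Graph.isTwoCut_of_reaches`); otherwise one exchanges the complementary part instead, with the
same result up to renaming `U` and `W`. That Seifert graphs have no loops
(`DiagramData.IsDiagram.cl_ne_cl`) is used throughout.

Flypes do not create nugatory crossings (`DiagramData.IsReduced.of_flype`): a nugatory crossing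
gives a two-colouring of the rest of the diagram, and a parity argument shows how to reassemble
the colourings of `T` and `R`. Hence all diagrams in a sequence of flypes starting at a reduced
one are reduced, and the steps can be composed.
-/

/-! ### Multigraphs given by the ends of their edges -/

namespace Graph

/-- The multigraph on all of `V` in which `e` joins the two members of `ends e`. -/
def ofEnds {V E : Type*} (ends : E → Sym2 V) : Graph V E where
  vertexSet := Set.univ
  IsLink e x y := ends e = s(x, y)
  isLink_symm := by
    intro e _
    constructor
    intro x y h
    rw [h, Sym2.eq_swap]
  eq_or_eq_of_isLink_of_isLink := by
    intro e x y v w h h'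
    rw [h, Sym2.eq_iff] at h'
    tauto
  left_mem_of_isLink := fun _ _ _ _ => Set.mem_univ _

/-- `x` and `y` are joined by a path all of whose vertices lie in `W`. -/
def JoinedIn {V E : Type*} (G : Graph V E) (W : Set V) (x y : V) : Prop :=
  Relation.ReflTransGen (G.induce W).Adj x y

section Joined

variable {V E : Type*} {G : Graph V E} {W W' : Set V} {x y z r : V}

theorem induce_adj : (G.induce W).Adj x y ↔ G.Adj x y ∧ x ∈ W ∧ y ∈ W := by
  constructor
  · rintro ⟨e, h⟩
    exact ⟨⟨e, h.1⟩, h.2⟩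
  · rintro ⟨⟨e, h⟩, h'⟩
    exact ⟨e, h, h'⟩

theorem joined_symm (h : Relation.ReflTransGen G.Adj x y) : Relation.ReflTransGen G.Adj y x := by
  induction h with
  | refl => exact .refl
  | tail _ h ih => exact .head h.symm ih

theorem JoinedIn.symm (h : G.JoinedIn W x y) : G.JoinedIn W y x :=
  joined_symm h

theorem JoinedIn.trans (h : G.JoinedIn W x y) (h' : G.JoinedIn W y z) : G.JoinedIn W x z :=
  Relation.ReflTransGen.trans h h'

theorem JoinedIn.mono (h : G.JoinedIn W x y) (hW : W ⊆ W') : G.JoinedIn W' x y := by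
  refine Relation.ReflTransGen.mono (fun a b hab => ?_) _ _ h
  rw [induce_adj] at hab ⊢
  exact ⟨hab.1, hW hab.2.1, hW hab.2.2⟩

theorem JoinedIn.joined (h : G.JoinedIn W x y) : Relation.ReflTransGen G.Adj x y :=
  Relation.ReflTransGen.mono (fun _ _ hab => (induce_adj.1 hab).1) _ _ h

theorem joinedIn_of_adj (h : G.Adj x y) (hx : x ∈ W) (hy : y ∈ W) : G.JoinedIn W x y :=
  .single (induce_adj.2 ⟨h, hx, hy⟩)

/-- A set that is closed under adjacency inside `W` is closed under being joined inside `W`. -/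
theorem JoinedIn.mem_of_closed {S : Set V} (hS : ∀ a ∈ S, ∀ b ∈ W, G.Adj a b → b ∈ S)
    (h : G.JoinedIn W x y) (hx : x ∈ S) : y ∈ S := by
  induction h with
  | refl => exact hx
  | tail _ h ih =>
    rw [induce_adj] at h
    exact hS _ ih _ h.2.2 h.1

/-- If every vertex of `W` with a neighbour outside of `W` is joined to `r` inside `W`, then a path
from a vertex of `W` to `r` can be replaced by one inside `W`: follow it until it leaves `W`. -/
theorem joinedIn_of_boundary (h : ∀ a ∈ W, ∀ b ∉ W, G.Adj a b → G.JoinedIn W a r) (hx : x ∈ W)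
    (hxr : Relation.ReflTransGen G.Adj x r) : G.JoinedIn W x r := by
  induction hxr using Relation.ReflTransGen.head_induction_on with
  | refl => exact .refl
  | @head a b hab _ ih =>
    by_cases hb : b ∈ W
    · exact (joinedIn_of_adj hab hx hb).trans (ih hb)
    · exact h a hx b hb hab

theorem allJoined_induce (h : ∀ a ∈ W, G.JoinedIn W a r) : (G.induce W).AllJoined :=
  fun a ha b hb => (h a ha).trans (h b hb).symm

theorem isConn_induce (hr : r ∈ W) (h : ∀ a ∈ W, G.JoinedIn W a r) : (G.induce W).IsConn :=
  ⟨⟨r, hr⟩, allJoined_induce h⟩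

theorem isInducedSubgraph_induce (hW : W ⊆ G.vertexSet) : (G.induce W).IsInducedSubgraph G where
  le := induce_le hW
  isLink_of_mem_mem := fun _ _ _ h hx hy => ⟨h, hx, hy⟩

theorem deleteVerts_eq_induce (hG : G.vertexSet = Set.univ) (X : Set V) :
    G.deleteVerts X = G.induce Xᶜ := by
  rw [deleteVerts, hG, Set.compl_eq_univ_sdiff]

theorem joined_of_closed (hS : ∀ S : Set V, S.Nonempty →
    (∀ a ∈ S, ∀ b, G.Adj a b → b ∈ S) → S = Set.univ) (x y : V) :
    Relation.ReflTransGen G.Adj x y := by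
  have := hS {z | Relation.ReflTransGen G.Adj x z} ⟨x, .refl⟩ fun a ha b hab => .tail ha hab
  exact (Set.ext_iff.1 this y).2 (Set.mem_univ y)

end Joined

section Ends

open Classical

variable {V E : Type*} {ends ends' : E → Sym2 V} {K P F : Set V} {A C U L : V}

theorem isRewiring_ofEnds {σ : E → V → V} (h : ∀ e, ends' e = (ends e).map (σ e)) :
    (ofEnds ends).IsRewiring (ofEnds ends') σ := by
  refine ⟨rfl, fun e x y => ?_⟩
  change ends' e = s(x, y) ↔ ∃ a b, ends e = s(a, b) ∧ x = σ e a ∧ y = σ e b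
  rw [h]
  constructor
  · intro h'
    induction hab : ends e using Sym2.ind with
    | _ a b =>
      rw [hab, Sym2.map_mk, Sym2.eq_iff] at h'
      rcases h' with ⟨h1, h2⟩ | ⟨h1, h2⟩
      · exact ⟨a, b, rfl, h1.symm, h2.symm⟩
      · exact ⟨b, a, Sym2.eq_swap, h2.symm, h1.symm⟩
  · rintro ⟨a, b, hab, rfl, rfl⟩
    rw [hab, Sym2.map_mk]

/-- There are no loops. -/
def NoLoops (ends : E → Sym2 V) : Prop :=
  ∀ e x, ends e ≠ s(x, x)

/-- The edges with an end in `K`. -/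
def touch (ends : E → Sym2 V) (K : Set V) : Set E :=
  {e | ∃ x ∈ K, x ∈ ends e}

/-- Exchange the vertices `U` and `L` at the ends of all edges in `F`. -/
noncomputable def swapOn (F : Set E) (U L : V) (ends : E → Sym2 V) : E → Sym2 V :=
  fun e => if e ∈ F then (ends e).map (Equiv.swap U L) else ends e

theorem swapOn_of_mem {F : Set E} {e : E} (h : e ∈ F) :
    swapOn F U L ends e = (ends e).map (Equiv.swap U L) :=
  if_pos h

theorem swapOn_of_notMem {F : Set E} {e : E} (h : e ∉ F) : swapOn F U L ends e = ends e :=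
  if_neg h

theorem swapOn_empty : swapOn ∅ U L ends = ends :=
  funext fun _ => swapOn_of_notMem (Set.notMem_empty _)

theorem swapOn_comm (F : Set E) : swapOn F U L ends = swapOn F L U ends := by
  funext e
  unfold swapOn
  rw [Equiv.swap_comm]

theorem swapOn_swapOn {F F' : Set E} (h : Disjoint F F') :
    swapOn F' U L (swapOn F U L ends) = swapOn (F ∪ F') U L ends := by
  funext e
  by_cases h1 : e ∈ F
  · have h2 : e ∉ F' := Set.disjoint_left.1 h h1
    rw [swapOn_of_notMem h2, swapOn_of_mem h1, swapOn_of_mem (Set.mem_union_left F' h1)]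
  · by_cases h2 : e ∈ F'
    · rw [swapOn_of_mem h2, swapOn_of_notMem h1, swapOn_of_mem (Set.mem_union_right F h2)]
    · rw [swapOn_of_notMem h2, swapOn_of_notMem h1, swapOn_of_notMem (fun h => h.elim h1 h2)]

theorem exists_ends (ends : E → Sym2 V) (e : E) : ∃ x y, ends e = s(x, y) := by
  induction h : ends e using Sym2.ind with
  | _ x y => exact ⟨x, y, rfl⟩

theorem mem_edgeSet_ofEnds (ends : E → Sym2 V) (e : E) : e ∈ (ofEnds ends).edgeSet :=
  exists_ends ends e

theorem exists_ends_of_mem_touch {e : E} (h : e ∈ touch ends K) :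
    ∃ x y, ends e = s(x, y) ∧ x ∈ K := by
  obtain ⟨x, hx, y, hy⟩ := h
  exact ⟨x, y, hy, hx⟩

theorem mem_touch_left {e : E} {x y : V} (h : ends e = s(x, y)) (hx : x ∈ K) : e ∈ touch ends K :=
  ⟨x, hx, h ▸ Sym2.mem_mk_left x y⟩

theorem mem_touch_iff {e : E} {x y : V} (h : ends e = s(x, y)) :
    e ∈ touch ends K ↔ x ∈ K ∨ y ∈ K := by
  simp only [touch, Set.mem_ofPred_eq, h, Sym2.mem_iff]
  constructor
  · rintro ⟨z, hz, rfl | rfl⟩ <;> tauto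
  · rintro (h | h)
    · exact ⟨x, h, Or.inl rfl⟩
    · exact ⟨y, h, Or.inr rfl⟩

theorem touch_empty : touch ends ∅ = ∅ := by
  ext e
  simp [touch]

theorem touch_union : touch ends (K ∪ P) = touch ends K ∪ touch ends P := by
  ext e
  simp only [touch, Set.mem_union, Set.mem_ofPred_eq]
  constructor
  · rintro ⟨x, h | h, hx⟩
    · exact Or.inl ⟨x, h, hx⟩
    · exact Or.inr ⟨x, h, hx⟩
  · rintro (⟨x, h, hx⟩ | ⟨x, h, hx⟩)
    · exact ⟨x, Or.inl h, hx⟩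
    · exact ⟨x, Or.inr h, hx⟩

/-- Exchanging `U` and `L` does not change which edges touch a set that avoids both. -/
theorem touch_swapOn {F : Set E} (hU : U ∉ K) (hL : L ∉ K) :
    touch (swapOn F U L ends) K = touch ends K := by
  ext e
  by_cases he : e ∈ F
  · have key : ∀ z ∈ K, ∀ w, Equiv.swap U L w = z ↔ w = z := by
      intro z hz w
      have hzU : z ≠ U := fun h => hU (h ▸ hz)
      have hzL : z ≠ L := fun h => hL (h ▸ hz)
      rw [Equiv.swap_apply_eq_iff, Equiv.swap_apply_of_ne_of_ne hzU hzL]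
    simp only [touch, Set.mem_ofPred_eq, swapOn_of_mem he, Sym2.mem_map]
    constructor
    · rintro ⟨x, hx, a, ha, hax⟩
      exact ⟨x, hx, ((key x hx a).1 hax) ▸ ha⟩
    · rintro ⟨x, hx, ha⟩
      exact ⟨x, hx, x, ha, (key x hx x).2 rfl⟩
  · simp only [touch, Set.mem_ofPred_eq, swapOn_of_notMem he]

theorem NoLoops.of_swapOn (h : NoLoops ends) (F : Set E) : NoLoops (swapOn F U L ends) := by
  intro e x hx
  by_cases he : e ∈ F
  · rw [swapOn_of_mem he] at hx
    obtain ⟨a, b, hab⟩ := exists_ends ends e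
    rw [hab, Sym2.map_mk, Sym2.eq_iff] at hx
    have : a = b := (Equiv.swap U L).injective (by grind)
    exact h e a (by rw [hab, this])
  · rw [swapOn_of_notMem he] at hx
    exact h e x hx

/-! ### Type B flips -/

/-- The vertices in `K` form, together with `A`, a connected graph that is attached to the rest at
`A` only. -/
structure Pendant (ends : E → Sym2 V) (K : Set V) (A : V) : Prop where
  notMem : A ∉ K
  closed : ∀ e x y, ends e = s(x, y) → x ∈ K → y ∈ K ∨ y = A
  joined : ∀ x ∈ K, (ofEnds ends).JoinedIn (insert A K) x A

theorem mem_edgeSet_induce {W : Set V} {e : E} :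
    e ∈ ((ofEnds ends).induce W).edgeSet ↔ ∃ x y, ends e = s(x, y) ∧ x ∈ W ∧ y ∈ W :=
  Iff.rfl

theorem mem_edgeSet_induce_of_ends {W : Set V} {e : E} {x y : V} (h : ends e = s(x, y)) :
    e ∈ ((ofEnds ends).induce W).edgeSet ↔ x ∈ W ∧ y ∈ W := by
  rw [mem_edgeSet_induce]
  constructor
  · rintro ⟨a, b, hab, ha, hb⟩
    rw [h, Sym2.eq_iff] at hab
    grind
  · rintro ⟨hx, hy⟩
    exact ⟨x, y, h, hx, hy⟩

theorem Pendant.mem_edgeSet (hl : NoLoops ends) (h : Pendant ends K A) {e : E} :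
    e ∈ ((ofEnds ends).induce (insert A K)).edgeSet ↔ e ∈ touch ends K := by
  obtain ⟨x, y, hxy⟩ := exists_ends ends e
  have hyx : ends e = s(y, x) := hxy.trans Sym2.eq_swap
  rw [mem_edgeSet_induce_of_ends hxy, mem_touch_iff hxy]
  have h1 := h.closed e x y hxy
  have h2 := h.closed e y x hyx
  have h3 := hl e A
  have h4 : ¬ (x = A ∧ y = A) := by
    rintro ⟨rfl, rfl⟩
    exact h3 hxy
  simp only [Set.mem_insert_iff]
  tauto

/-- Moving a pendant part along an edge is a Type B flip. -/
theorem Pendant.flipB (hl : NoLoops ends) (h : Pendant ends K A) (hK : K.Nonempty) (hC : C ∉ K)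
    (hAC : A ≠ C) (hadj : (ofEnds ends).Adj A C) :
    (ofEnds ends).FlipB (ofEnds (swapOn (touch ends K) A C ends)) := by
  have hCW : C ∉ insert A K := by
    rintro (h' | h')
    · exact hAC h'.symm
    · exact hC h'
  refine ⟨(ofEnds ends).induce (insert A K), A, C, hAC, hadj, ⟨?_, ?_, ?_, ?_⟩, hCW, ?_⟩
  · exact isInducedSubgraph_induce (Set.subset_univ _)
  · refine isConn_induce (Set.mem_insert A K) fun a ha => ?_
    rcases ha with rfl | ha
    · exact .refl
    · exact h.joined a ha
  · obtain ⟨x, hx⟩ := hK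
    refine ⟨Set.mem_univ _, x, Set.mem_univ _, C, Set.mem_univ _, ?_, hAC.symm, ?_, ?_⟩
    · rintro rfl
      exact h.notMem hx
    · exact (h.joined x hx).joined.tail hadj
    · rw [deleteVerts_eq_induce rfl]
      intro h'
      refine hC (JoinedIn.mem_of_closed (S := K) ?_ h' hx)
      rintro a ha b hb ⟨e, he⟩
      exact (h.closed e a b he ha).resolve_right hb
  · ext v
    constructor
    · rintro ⟨hv, e, he, w, hw⟩
      rw [h.mem_edgeSet hl] at he
      rcases hv with hv | hv
      · exact hv
      · exact absurd (mem_touch_left hw hv) he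
    · rintro rfl
      obtain ⟨e, he⟩ := hadj
      refine ⟨Set.mem_insert _ _, e, ?_, C, he⟩
      rw [mem_edgeSet_induce_of_ends he]
      exact fun h' => hCW h'.2
  · refine isRewiring_ofEnds fun e => ?_
    by_cases he : e ∈ touch ends K
    · have he' := (h.mem_edgeSet hl).2 he
      rw [swapOn_of_mem he]
      simp only [if_pos he']
      obtain ⟨x, y, hxy, hx, hy⟩ := mem_edgeSet_induce.1 he'
      have hxC : x ≠ C := fun h' => hCW (h' ▸ hx)
      have hyC : y ≠ C := fun h' => hCW (h' ▸ hy)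
      rw [hxy, Sym2.map_mk, Sym2.map_mk]
      simp only [Equiv.swap_apply_def, if_neg hxC, if_neg hyC]
    · have he' := mt (h.mem_edgeSet hl).1 he
      rw [swapOn_of_notMem he]
      simp only [if_neg he']
      exact (Sym2.map_id' ▸ rfl : ends e = Sym2.map (fun x => x) (ends e))

/-- A part that is not touched by the exchanged edges stays pendant. -/
theorem Pendant.swapOn_of_disjoint {F : Set E} (h : Pendant ends K A) (hl : NoLoops ends)
    (hF : Disjoint F (touch ends K)) (hU : U ∉ K) (hL : L ∉ K) :
    Pendant (swapOn F U L ends) K A := by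
  have key : ∀ e ∈ touch ends K, swapOn F U L ends e = ends e := fun e he =>
    swapOn_of_notMem (Set.disjoint_right.1 hF he)
  refine ⟨h.notMem, fun e x y hxy hx => ?_, fun x hx => ?_⟩
  · have he : e ∈ touch ends K := by
      rw [← touch_swapOn (F := F) hU hL]
      exact mem_touch_left hxy hx
    rw [key e he] at hxy
    exact h.closed e x y hxy hx
  · refine Relation.ReflTransGen.mono ?_ _ _ (h.joined x hx)
    rintro a b ⟨e, he⟩
    refine ⟨e, ?_, he.2⟩
    have := (h.mem_edgeSet hl).1 ⟨a, b, he⟩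
    exact (key e this).trans he.1

end Ends

end Graph

/-! ### Blocks and Type A flips -/

namespace Graph

section Blocks

variable {V E : Type*} {G : Graph V E} {W : Set V} {U L : V}

/-- The subgraph induced on `W` is connected and has no cut vertex. -/
structure TwoConn (G : Graph V E) (W : Set V) : Prop where
  joined : ∀ a ∈ W, ∀ b ∈ W, G.JoinedIn W a b
  joined_diff : ∀ v, ∀ a ∈ W \ {v}, ∀ b ∈ W \ {v}, G.JoinedIn (W \ {v}) a b

theorem deleteVerts_induce (G : Graph V E) (W X : Set V) :
    (G.induce W).deleteVerts X = G.induce (W \ X) := by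
  ext e x y
  · rfl
  · simp only [deleteVerts_isLink, induce_isLink, Set.mem_sdiff]
    tauto

theorem isBlockLike_induce (hG : G.vertexSet = Set.univ) (hW : W.Nonempty) :
    G.IsBlockLike (G.induce W) ↔ G.TwoConn W := by
  constructor
  · rintro ⟨-, h, hc⟩
    refine ⟨h.2, fun v a ha b hb => ?_⟩
    by_cases hv : v ∈ W
    · by_contra hab
      refine hc v ⟨hv, a, ha.1, b, hb.1, ha.2, hb.2, h.2 a ha.1 b hb.1, ?_⟩
      rwa [deleteVerts_induce]
    · rw [Set.sdiff_singleton_eq_self hv] at *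
      exact h.2 a ha b hb
  · intro h
    refine ⟨isInducedSubgraph_induce (hG ▸ Set.subset_univ _), ⟨hW, h.joined⟩, ?_⟩
    rintro v ⟨-, x, hx, y, hy, hxv, hyv, -, hxy⟩
    rw [deleteVerts_induce] at hxy
    exact hxy (h.joined_diff v x ⟨hx, hxv⟩ y ⟨hy, hyv⟩)

theorem twoConn_pair (h : G.Adj U L) : G.TwoConn {U, L} := by
  have key : ∀ X : Set V, X ⊆ {U, L} → ∀ a ∈ X, ∀ b ∈ X, G.JoinedIn X a b := by
    intro X hX a ha b hb
    rcases hX ha with rfl | rfl <;> rcases hX hb with rfl | rfl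
    · exact .refl
    · exact joinedIn_of_adj h ha hb
    · exact joinedIn_of_adj h.symm ha hb
    · exact .refl
  exact ⟨key _ subset_rfl, fun v => key _ Set.sdiff_subset⟩

theorem joinedIn_segment {X : Set V} {p : ℕ → V} {n i j : ℕ}
    (hadj : ∀ k < n, G.Adj (p k) (p (k + 1))) (hij : i ≤ j) (hj : j ≤ n)
    (hX : ∀ k, i ≤ k → k ≤ j → p k ∈ X) : G.JoinedIn X (p i) (p j) := by
  induction j, hij using Nat.le_induction with
  | base => exact .refl
  | succ j hij ih =>
    refine (ih (by omega) fun k h1 h2 => hX k h1 (by omega)).trans ?_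
    exact joinedIn_of_adj (hadj j (by omega)) (hX j hij (by omega)) (hX _ (by omega) le_rfl)

/-- Adding an ear: a path between two vertices of `W` can be added to `W`. -/
theorem TwoConn.ear (h : G.TwoConn W) {p : ℕ → V} {n : ℕ} (h0 : p 0 ∈ W) (hn : p n ∈ W)
    (hinj : ∀ i ≤ n, ∀ j ≤ n, p i = p j → i = j) (hadj : ∀ k < n, G.Adj (p k) (p (k + 1))) :
    G.TwoConn (W ∪ p '' Set.Iic n) := by
  constructor
  · refine allJoined_induce (r := p 0) ?_
    rintro a (ha | ⟨i, hi, rfl⟩)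
    · exact (h.joined a ha _ h0).mono Set.subset_union_left
    · refine (joinedIn_segment hadj (Nat.zero_le i) hi fun k _ hk => Or.inr ⟨k, ?_, rfl⟩).symm
      exact hk.trans hi
  · intro v
    have key : ∀ a ∈ (W ∪ p '' Set.Iic n) \ {v}, ∃ b ∈ W \ {v},
        G.JoinedIn ((W ∪ p '' Set.Iic n) \ {v}) a b := by
      rintro a ⟨ha | ⟨i, hi, rfl⟩, hav⟩
      · exact ⟨a, ⟨ha, hav⟩, .refl⟩
      · -- One of the two ends of the path can be reached from `p i` without meeting `v`.
        have hi' : i ≤ n := hi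
        by_cases hv : ∃ j ≤ i, p j = v
        · obtain ⟨j, hj, rfl⟩ := hv
          have hij : j ≠ i := by
            rintro rfl
            exact hav rfl
          have hne : ∀ k, i ≤ k → k ≤ n → p k ≠ p j := fun k hk hkn h' => by
            have := hinj k hkn j (hj.trans hi) h'
            omega
          exact ⟨p n, ⟨hn, hne n hi le_rfl⟩, joinedIn_segment hadj hi le_rfl
            fun k hk hkn => ⟨Or.inr ⟨k, hkn, rfl⟩, hne k hk hkn⟩⟩
        · push Not at hv
          exact ⟨p 0, ⟨h0, hv 0 (Nat.zero_le i)⟩, JoinedIn.symm (joinedIn_segment hadj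
            (Nat.zero_le i) hi fun k _ hk => ⟨Or.inr ⟨k, hk.trans hi', rfl⟩, hv k hk⟩)⟩
    intro a ha b hb
    obtain ⟨a', ha', haa'⟩ := key a ha
    obtain ⟨b', hb', hbb'⟩ := key b hb
    refine haa'.trans (JoinedIn.trans ?_ hbb'.symm)
    exact (h.joined_diff v a' ha' b' hb').mono (Set.sdiff_subset_sdiff_left Set.subset_union_left)

/-- `T` has a neighbour that is joined to `x` inside of `S`. -/
def Reaches (G : Graph V E) (S : Set V) (x T : V) : Prop :=
  ∃ y, G.JoinedIn S x y ∧ G.Adj y T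

theorem Reaches.of_joinedIn {S : Set V} {x y T : V} (h : G.Reaches S x T)
    (hxy : G.JoinedIn S y x) : G.Reaches S y T := by
  obtain ⟨z, hz, hzT⟩ := h
  exact ⟨z, hxy.trans hz, hzT⟩

theorem JoinedIn.mem {S : Set V} {x y : V} (h : G.JoinedIn S x y) (hx : x ∈ S) : y ∈ S :=
  h.mem_of_closed (fun _ _ _ hb _ => hb) hx

/-- A path from `U` to `L` whose second vertex is in the component of `x` in `G - {U, L}`. -/
theorem exists_path_through (hUL : U ≠ L) {x : V} (hx : x ∈ ({U, L} : Set V)ᶜ)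
    (hxU : G.Reaches {U, L}ᶜ x U) (hxL : G.Reaches {U, L}ᶜ x L) :
    ∃ (n : ℕ) (p : ℕ → V), p 0 = U ∧ p n = L ∧ (∀ i ≤ n, ∀ j ≤ n, p i = p j → i = j) ∧
      (∀ k < n, G.Adj (p k) (p (k + 1))) ∧ 1 ≤ n ∧ G.JoinedIn {U, L}ᶜ x (p 1) := by
  let P : Set V := {y | G.JoinedIn {U, L}ᶜ x y}
  have hP : ∀ y ∈ P, y ∈ ({U, L} : Set V)ᶜ := fun y hy => JoinedIn.mem hy hx
  let Γ : SimpleGraph V :=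
    { Adj := fun a b => a ≠ b ∧ G.Adj a b ∧ (a ∈ P ∨ b ∈ P)
      symm := ⟨fun a b h => ⟨h.1.symm, h.2.1.symm, h.2.2.symm⟩⟩
      loopless := ⟨fun a h => h.1 rfl⟩ }
  have hreach : ∀ y, G.JoinedIn {U, L}ᶜ x y → Γ.Reachable x y := by
    intro y hy
    induction hy with
    | refl => exact SimpleGraph.Reachable.refl x
    | @tail a b hab h ih =>
      by_cases hne : a = b
      · exact hne ▸ ih
      · exact ih.trans (SimpleGraph.Adj.reachable ⟨hne, (induce_adj.1 h).1, Or.inl hab⟩)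
  have hend : ∀ T ∈ ({U, L} : Set V), G.Reaches {U, L}ᶜ x T → Γ.Reachable x T := by
    rintro T hT ⟨y, hy, hyT⟩
    refine (hreach y hy).trans (SimpleGraph.Adj.reachable ⟨?_, hyT, Or.inl hy⟩)
    rintro rfl
    exact hP _ hy hT
  have hr : Γ.Reachable U L :=
    (hend U (Set.mem_insert _ _) hxU).symm.trans (hend L (Or.inr rfl) hxL)
  obtain ⟨q, hq⟩ := hr.exists_isPath
  have hlen : 1 ≤ q.length := by
    rw [Nat.one_le_iff_ne_zero]
    intro h0
    exact hUL (SimpleGraph.Walk.eq_of_length_eq_zero h0)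
  refine ⟨q.length, q.getVert, q.getVert_zero, q.getVert_length, ?_, ?_, hlen, ?_⟩
  · intro i hi j hj hij
    exact hq.getVert_injOn hi hj hij
  · intro k hk
    exact (q.adj_getVert_succ hk).2.1
  · have h1 := (q.adj_getVert_succ (i := 0) hlen).2.2
    rw [q.getVert_zero] at h1
    exact h1.resolve_left fun h => hP U h (Set.mem_insert _ _)

/-- Two adjacent vertices form a 2-cut as soon as two components of the complement are attached to
both of them: the edge and a path through each component make up a subgraph without cut vertices,
which extends to a block. -/
theorem isTwoCut_of_reaches [Finite V] (hG : G.vertexSet = Set.univ) (hUL : U ≠ L)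
    (hadj : G.Adj U L) {x z : V} (hx : x ∈ ({U, L} : Set V)ᶜ) (hz : z ∈ ({U, L} : Set V)ᶜ)
    (hxU : G.Reaches {U, L}ᶜ x U) (hxL : G.Reaches {U, L}ᶜ x L)
    (hzU : G.Reaches {U, L}ᶜ z U) (hzL : G.Reaches {U, L}ᶜ z L)
    (hxz : ¬ G.JoinedIn {U, L}ᶜ x z) : G.IsTwoCut U L := by
  obtain ⟨n, p, p0, pn, pinj, padj, n1, hp⟩ := exists_path_through hUL hx hxU hxL
  obtain ⟨m, q, q0, qm, qinj, qadj, m1, hq⟩ := exists_path_through hUL hz hzU hzL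
  have t1 := (twoConn_pair hadj).ear (p := p) (n := n) (by simp [p0]) (by simp [pn]) pinj padj
  have t2 := t1.ear (p := q) (n := m) (by simp [q0]) (by simp [qm]) qinj qadj
  obtain ⟨W, hW, hmax⟩ := (Set.toFinite {W : Set V | G.TwoConn W}).exists_le_maximal t2
  have hU : U ∈ W := hW (Or.inl (Or.inl (Or.inl rfl)))
  have hL : L ∈ W := hW (Or.inl (Or.inl (Or.inr rfl)))
  refine ⟨hUL, G.induce W, ⟨(isBlockLike_induce hG ⟨U, hU⟩).2 hmax.prop, ?_⟩, hU, hL, ?_⟩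
  · intro B hB hle
    have hBW : G.induce B.vertexSet = B := by
      refine ((isInducedSubgraph_induce (hG ▸ Set.subset_univ _)).anti_right ?_ ?_).ext_of_vertexSet
        rfl
      · refine ⟨subset_rfl, fun e x y h => hB.1.isLink_of_mem_mem h.1 h.2.1 h.2.2⟩
      · exact hB.1.le
    have hWB : W ⊆ B.vertexSet := hle.vertexSet_mono
    rw [← hBW, isBlockLike_induce hG ⟨U, hWB hU⟩] at hB
    rw [← hBW]
    congr 1
    exact (hmax.eq_of_le hB hWB)
  · intro h
    rw [deleteVerts_induce] at h
    have hpx : p 1 ∈ W \ {U, L} := ⟨hW (Or.inl (Or.inr ⟨1, n1, rfl⟩)), hp.mem hx⟩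
    have hqz : q 1 ∈ W \ {U, L} := ⟨hW (Or.inr ⟨1, m1, rfl⟩), hq.mem hz⟩
    have : G.JoinedIn (W \ {U, L}) (p 1) (q 1) := h _ hpx _ hqz
    exact hxz ((hp.trans (this.mono fun a ha => ha.2)).trans hq.symm)

end Blocks

section FlipA

open Classical

variable {V E : Type*} {ends : E → Sym2 V} {K : Set V} {U L : V}

/-- Exchanging the ends of a part that is attached at the two ends of an edge is a Type A flip, if
the part and its complement both connect these ends. -/
theorem flipA_of_reaches [Finite V] (hl : NoLoops ends)
    (hconn : ∀ x y, Relation.ReflTransGen (ofEnds ends).Adj x y) (hUL : U ≠ L)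
    (hadj : (ofEnds ends).Adj U L) (hU : U ∉ K) (hL : L ∉ K)
    (hK : ∀ e x y, ends e = s(x, y) → x ∈ K → y ∈ K ∨ y = U ∨ y = L) {x z : V} (hx : x ∈ K)
    (hz : z ∉ K) (hzU : z ≠ U) (hzL : z ≠ L)
    (hxU : (ofEnds ends).Reaches {U, L}ᶜ x U) (hxL : (ofEnds ends).Reaches {U, L}ᶜ x L)
    (hzU' : (ofEnds ends).Reaches {U, L}ᶜ z U) (hzL' : (ofEnds ends).Reaches {U, L}ᶜ z L) :
    (ofEnds ends).FlipA (ofEnds (swapOn (touch ends K) U L ends)) := by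
  have hclosed : ∀ a ∈ K, ∀ b ∈ ({U, L} : Set V)ᶜ, (ofEnds ends).Adj a b → b ∈ K := by
    rintro a ha b hb ⟨e, he⟩
    exact (hK e a b he ha).resolve_right hb
  have hxc : x ∈ ({U, L} : Set V)ᶜ := by
    rintro (rfl | rfl)
    · exact hU hx
    · exact hL hx
  have hzc : z ∈ ({U, L} : Set V)ᶜ := by
    rintro (rfl | rfl)
    · exact hzU rfl
    · exact hzL rfl
  let W : Set V := K ∪ {U, L}
  have hUW : U ∈ W := Or.inr (Or.inl rfl)
  have hLW : L ∈ W := Or.inr (Or.inr rfl)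
  have hWK : ∀ a ∈ W, ∀ b ∉ W, (ofEnds ends).Adj a b → a = U ∨ a = L := by
    rintro a (ha | ha) b hb ⟨e, he⟩
    · exact absurd (hK e a b he ha) hb
    · exact ha
  have hout : ∀ T, T ∈ ({U, L} : Set V) → (ofEnds ends).Reaches {U, L}ᶜ z T →
      ∃ e, e ∉ ((ofEnds ends).induce W).edgeSet ∧ (ofEnds ends).Inc e T := by
    rintro T hT ⟨y, hy, e, he⟩
    refine ⟨e, ?_, y, he.symm⟩
    rw [mem_edgeSet_induce_of_ends he]
    rintro ⟨hyW | hyW, -⟩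
    · exact hz (hy.symm.mem_of_closed hclosed hyW)
    · exact hy.mem hzc hyW
  refine ⟨(ofEnds ends).induce W, U, L, ⟨?_, ?_, ?_, ?_⟩, hadj, ?_⟩
  · exact isInducedSubgraph_induce (Set.subset_univ _)
  · refine isConn_induce hUW fun a ha => joinedIn_of_boundary ?_ ha (hconn a U)
    intro a ha b hb hab
    rcases hWK a ha b hb hab with rfl | rfl
    · exact .refl
    · exact joinedIn_of_adj hadj.symm hLW hUW
  · exact isTwoCut_of_reaches rfl hUL hadj hxc hzc hxU hxL hzU' hzL'
      fun h => hz (h.mem_of_closed hclosed hx)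
  · ext v
    constructor
    · rintro ⟨hv, e, he, w, hw⟩
      refine hWK v hv w (fun hwW => he ?_) ⟨e, hw⟩
      exact ⟨v, w, hw, hv, hwW⟩
    · rintro (rfl | rfl)
      · exact ⟨hUW, hout v (Or.inl rfl) hzU'⟩
      · exact ⟨hLW, hout v (Or.inr rfl) hzL'⟩
  · refine isRewiring_ofEnds fun e => ?_
    obtain ⟨a, b, hab⟩ := exists_ends ends e
    have hba : ends e = s(b, a) := hab.trans Sym2.eq_swap
    have hW := mem_edgeSet_induce_of_ends (W := W) hab
    have hfun : (fun x => if x = U then L else if x = L then U else x) = ⇑(Equiv.swap U L) := rfl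
    by_cases he : e ∈ touch ends K
    · have he' : e ∈ ((ofEnds ends).induce W).edgeSet := by
        rw [hW]
        rcases (mem_touch_iff hab).1 he with h | h
        · exact ⟨Or.inl h, hK e a b hab h⟩
        · exact ⟨hK e b a hba h, Or.inl h⟩
      rw [swapOn_of_mem he]
      simp only [if_pos he']
      rw [← hfun]
    · rw [swapOn_of_notMem he]
      by_cases he' : e ∈ ((ofEnds ends).induce W).edgeSet
      · -- The remaining edges of the induced subgraph join `U` and `L`.
        simp only [if_pos he']
        rw [mem_touch_iff hab] at he
        obtain ⟨ha, hb⟩ := hW.1 he'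
        have ha' : a = U ∨ a = L := ha.resolve_left fun h => he (Or.inl h)
        have hb' : b = U ∨ b = L := hb.resolve_left fun h => he (Or.inr h)
        have := hl e a
        rw [hab, Sym2.map_mk]
        rw [hab] at this
        rcases ha' with rfl | rfl <;> rcases hb' with rfl | rfl
        · exact absurd rfl this
        · simp only [if_true, if_neg hUL.symm]
          exact Sym2.eq_swap
        · simp only [if_true, if_neg hUL.symm]
          exact Sym2.eq_swap
        · exact absurd rfl this
      · simp only [if_neg he']
        exact (Sym2.map_id' ▸ rfl : ends e = Sym2.map (fun x => x) (ends e))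

end FlipA

end Graph

/-! ### Exchanging the ends of one side of an edge -/

namespace Graph

section Swap

open Classical

variable {V E : Type*} {ends : E → Sym2 V} {K K' : Set V} {A U L : V}

theorem Pendant.flips (hl : NoLoops ends) (h : Pendant ends K A) {C : V} (hC : C ∉ K)
    (hAC : A ≠ C) (hadj : (ofEnds ends).Adj A C) :
    Relation.ReflTransGen WhitneyFlip (ofEnds ends)
      (ofEnds (swapOn (touch ends K) A C ends)) := by
  rcases K.eq_empty_or_nonempty with rfl | hK
  · rw [touch_empty, swapOn_empty]
  · exact .single (Or.inr (Or.inl (h.flipB hl hK hC hAC hadj)))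

theorem swapOn_adj {F : Set E} (h : (ofEnds ends).Adj U L) :
    (ofEnds (swapOn F U L ends)).Adj U L := by
  obtain ⟨e, he⟩ := h
  have he' : ends e = s(U, L) := he
  refine ⟨e, ?_⟩
  change swapOn F U L ends e = s(U, L)
  by_cases hF : e ∈ F
  · rw [swapOn_of_mem hF, he', Sym2.map_mk, Equiv.swap_apply_left, Equiv.swap_apply_right,
      Sym2.eq_swap]
  · rw [swapOn_of_notMem hF, he']

theorem disjoint_touch {P Q : Set V} (hPQ : Disjoint P Q)
    (h : ∀ e x y, ends e = s(x, y) → x ∈ P → y ∉ Q) :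
    Disjoint (touch ends P) (touch ends Q) := by
  refine Set.disjoint_left.2 fun e he he' => ?_
  obtain ⟨x, y, hxy, hx⟩ := exists_ends_of_mem_touch he
  rcases (mem_touch_iff hxy).1 he' with h' | h'
  · exact Set.disjoint_left.1 hPQ hx h'
  · exact h e x y hxy hx h'

/-- Let `K` be attached to the rest of a connected graph only at the ends of the edge `UL`. If `K`
connects `U` and `L`, assume that the rest does so too without using edges between `U` and `L`. Then
the ends `U` and `L` of `K` can be exchanged by flips: one of Type A for the components of `K` that
are attached to both `U` and `L`, and one of Type B each for those that are attached to `U` only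
and to `L` only. -/
theorem flips_swapOn_of_reaches [Finite V] (hl : NoLoops ends)
    (hconn : ∀ x y, Relation.ReflTransGen (ofEnds ends).Adj x y) (hUL : U ≠ L)
    (hadj : (ofEnds ends).Adj U L) (hU : U ∉ K) (hL : L ∉ K)
    (hK : ∀ e x y, ends e = s(x, y) → x ∈ K → y ∈ K ∨ y = U ∨ y = L)
    (h : ∀ x ∈ K, (ofEnds ends).Reaches {U, L}ᶜ x U → (ofEnds ends).Reaches {U, L}ᶜ x L →
      ∃ z ∉ K, z ≠ U ∧ z ≠ L ∧ (ofEnds ends).Reaches {U, L}ᶜ z U ∧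
        (ofEnds ends).Reaches {U, L}ᶜ z L) :
    Relation.ReflTransGen WhitneyFlip (ofEnds ends)
      (ofEnds (swapOn (touch ends K) U L ends)) := by
  set rU : V → Prop := fun x => (ofEnds ends).Reaches {U, L}ᶜ x U
  set rL : V → Prop := fun x => (ofEnds ends).Reaches {U, L}ᶜ x L
  let PU : Set V := {x | x ∈ K ∧ ¬ rL x}
  let PL : Set V := {x | x ∈ K ∧ rL x ∧ ¬ rU x}
  let PB : Set V := {x | x ∈ K ∧ rL x ∧ rU x}
  have hcompl : ∀ x ∈ K, x ∈ ({U, L} : Set V)ᶜ := by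
    rintro x hx (rfl | rfl)
    · exact hU hx
    · exact hL hx
  -- Neighbours in `K` are in the same component of the complement of `U` and `L`.
  have hinv : ∀ e x y, ends e = s(x, y) → x ∈ K → y ∈ K → (rL x → rL y) ∧ (rU x → rU y) := by
    intro e x y hxy hx hy
    have : (ofEnds ends).JoinedIn {U, L}ᶜ y x :=
      joinedIn_of_adj (Adj.symm ⟨e, hxy⟩) (hcompl y hy) (hcompl x hx)
    exact ⟨fun hr => hr.of_joinedIn this, fun hr => hr.of_joinedIn this⟩
  have hinv' : ∀ e x y, ends e = s(x, y) → x ∈ K → y ∈ K → (rL x ↔ rL y) ∧ (rU x ↔ rU y) := by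
    intro e x y hxy hx hy
    have h1 := hinv e x y hxy hx hy
    have h2 := hinv e y x (hxy.trans Sym2.eq_swap) hy hx
    tauto
  have hbdU : ∀ e x y, ends e = s(x, y) → y = U → rU x := fun e x y hxy hy =>
    ⟨x, .refl, e, hy ▸ hxy⟩
  have hbdL : ∀ e x y, ends e = s(x, y) → y = L → rL x := fun e x y hxy hy =>
    ⟨x, .refl, e, hy ▸ hxy⟩
  have hpU : Pendant ends PU U := by
    have hcl : ∀ e x y, ends e = s(x, y) → x ∈ PU → y ∈ PU ∨ y = U := by
      rintro e x y hxy ⟨hx, hxL⟩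
      rcases hK e x y hxy hx with hy | hy | hy
      · exact Or.inl ⟨hy, fun h' => hxL ((hinv' e x y hxy hx hy).1.2 h')⟩
      · exact Or.inr hy
      · exact absurd (hbdL e x y hxy hy) hxL
    refine ⟨fun h' => hU h'.1, hcl, fun x hx => ?_⟩
    refine joinedIn_of_boundary ?_ (Set.mem_insert_of_mem _ hx) (hconn x U)
    rintro a (rfl | ha) b hb ⟨e, he⟩
    · exact .refl
    · exact absurd ((hcl e a b he ha).symm) hb
  have hpL : Pendant ends PL L := by
    have hcl : ∀ e x y, ends e = s(x, y) → x ∈ PL → y ∈ PL ∨ y = L := by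
      rintro e x y hxy ⟨hx, hxL, hxU⟩
      rcases hK e x y hxy hx with hy | hy | hy
      · have := hinv' e x y hxy hx hy
        exact Or.inl ⟨hy, this.1.1 hxL, fun h' => hxU (this.2.2 h')⟩
      · exact absurd (hbdU e x y hxy hy) hxU
      · exact Or.inr hy
    refine ⟨fun h' => hL h'.1, hcl, fun x hx => ?_⟩
    refine joinedIn_of_boundary ?_ (Set.mem_insert_of_mem _ hx) (hconn x L)
    rintro a (rfl | ha) b hb ⟨e, he⟩
    · exact .refl
    · exact absurd ((hcl e a b he ha).symm) hb
  have d1 : Disjoint (touch ends PB) (touch ends PU) := by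
    refine disjoint_touch (Set.disjoint_left.2 fun x hx hx' => hx'.2 hx.2.1) ?_
    exact fun e x y hxy hx hy => hy.2 ((hinv' e x y hxy hx.1 hy.1).1.1 hx.2.1)
  have d2 : Disjoint (touch ends PB ∪ touch ends PU) (touch ends PL) := by
    refine Disjoint.union_left ?_ ?_
    · refine disjoint_touch (Set.disjoint_left.2 fun x hx hx' => hx'.2.2 hx.2.2) ?_
      exact fun e x y hxy hx hy => hy.2.2 ((hinv' e x y hxy hx.1 hy.1).2.1 hx.2.2)
    · refine disjoint_touch (Set.disjoint_left.2 fun x hx hx' => hx.2 hx'.2.1) ?_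
      exact fun e x y hxy hx hy => hx.2 ((hinv' e x y hxy hx.1 hy.1).1.2 hy.2.1)
  have hPK : PB ∪ PU ∪ PL = K := by
    ext x
    simp only [PB, PU, PL, Set.mem_union, Set.mem_ofPred_eq]
    tauto
  have s1 : Relation.ReflTransGen WhitneyFlip (ofEnds ends)
      (ofEnds (swapOn (touch ends PB) U L ends)) := by
    rcases PB.eq_empty_or_nonempty with hB | ⟨x, hx⟩
    · rw [hB, touch_empty, swapOn_empty]
    · obtain ⟨z, hzK, hzU, hzL, hzU', hzL'⟩ := h x hx.1 hx.2.2 hx.2.1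
      refine .single (Or.inl (flipA_of_reaches hl hconn hUL hadj (fun h' => hU h'.1)
        (fun h' => hL h'.1) ?_ hx (fun h' => hzK h'.1) hzU hzL hx.2.2 hx.2.1 hzU' hzL'))
      rintro e x y hxy ⟨hx, hxL, hxU⟩
      refine (hK e x y hxy hx).imp_left fun hy => ?_
      have := hinv' e x y hxy hx hy
      exact ⟨hy, this.1.1 hxL, this.2.1 hxU⟩
  have s2 := (hpU.swapOn_of_disjoint hl d1 (fun h' => hU h'.1) (fun h' => hL h'.1)).flips
    (hl.of_swapOn (U := U) (L := L) _) (fun h' => hL h'.1) hUL (swapOn_adj hadj)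
  rw [touch_swapOn (fun h' => hU h'.1) (fun h' => hL h'.1), swapOn_swapOn d1] at s2
  have s3 := (hpL.swapOn_of_disjoint hl d2 (fun h' => hU h'.1) (fun h' => hL h'.1)).flips
    (hl.of_swapOn (U := U) (L := L) _) (fun h' => hU h'.1) hUL.symm (swapOn_adj hadj).symm
  rw [touch_swapOn (fun h' => hU h'.1) (fun h' => hL h'.1), swapOn_comm (U := L),
    swapOn_swapOn d2, ← touch_union, ← touch_union, hPK] at s3
  rw [← touch_union] at s2
  exact (s1.trans s2).trans s3

/-- If the vertices other than the ends of an edge `UL` are split into two parts `K` and `K'`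
without edges between them, then the ends `U` and `L` of `K` can be exchanged by flips, up to
exchanging the names of `U` and `L`: if `K'` does not connect `U` and `L`, then its ends can be
exchanged instead. -/
theorem flips_swapOn [Finite V] (hl : NoLoops ends)
    (hconn : ∀ x y, Relation.ReflTransGen (ofEnds ends).Adj x y) (hUL : U ≠ L)
    (hadj : (ofEnds ends).Adj U L) (hU : U ∉ K) (hL : L ∉ K) (hU' : U ∉ K') (hL' : L ∉ K')
    (hK : ∀ e x y, ends e = s(x, y) → x ∈ K → y ∈ K ∨ y = U ∨ y = L)
    (hK' : ∀ e x y, ends e = s(x, y) → x ∈ K' → y ∈ K' ∨ y = U ∨ y = L)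
    (hcover : ∀ v, v ∈ K ∨ v ∈ K' ∨ v = U ∨ v = L) (hdisj : Disjoint K K') :
    ∃ ends', Relation.ReflTransGen WhitneyFlip (ofEnds ends) (ofEnds ends') ∧
      (ends' = swapOn (touch ends K) U L ends ∨
        ends' = fun e => (swapOn (touch ends K) U L ends e).map (Equiv.swap U L)) := by
  by_cases hz : ∃ z ∈ K', (ofEnds ends).Reaches {U, L}ᶜ z U ∧ (ofEnds ends).Reaches {U, L}ᶜ z L
  · obtain ⟨z, hz, hzU, hzL⟩ := hz
    refine ⟨_, flips_swapOn_of_reaches hl hconn hUL hadj hU hL hK fun _ _ _ _ => ⟨z, ?_, ?_, ?_,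
      hzU, hzL⟩, Or.inl rfl⟩
    · exact Set.disjoint_right.1 hdisj hz
    · rintro rfl
      exact hU' hz
    · rintro rfl
      exact hL' hz
  · refine ⟨_, flips_swapOn_of_reaches hl hconn hUL hadj hU' hL' hK' fun x hx h1 h2 =>
      absurd ⟨x, hx, h1, h2⟩ hz, Or.inr ?_⟩
    have hdt : Disjoint (touch ends K) (touch ends K') := by
      refine disjoint_touch hdisj fun e x y hxy hx hy => ?_
      rcases hK e x y hxy hx with h' | rfl | rfl
      · exact Set.disjoint_left.1 hdisj h' hy
      · exact hU' hy
      · exact hL' hy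
    funext e
    by_cases he : e ∈ touch ends K
    · rw [swapOn_of_notMem (Set.disjoint_left.1 hdt he), swapOn_of_mem he, Sym2.map_map]
      have : (⇑(Equiv.swap U L) ∘ ⇑(Equiv.swap U L)) = id := by
        funext x
        exact Equiv.swap_apply_self U L x
      rw [this, Sym2.map_id, id]
    · rw [swapOn_of_notMem he]
      by_cases he' : e ∈ touch ends K'
      · rw [swapOn_of_mem he']
      · rw [swapOn_of_notMem he']
        obtain ⟨x, y, hxy⟩ := exists_ends ends e
        rw [mem_touch_iff hxy] at he he'
        have hx := hcover x
        have hy := hcover y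
        have hne := hl e x
        rw [hxy] at hne
        have hx' : x = U ∨ x = L := by tauto
        have hy' : y = U ∨ y = L := by tauto
        rw [hxy, Sym2.map_mk]
        rcases hx' with rfl | rfl <;> rcases hy' with rfl | rfl
        · exact absurd rfl hne
        · rw [Equiv.swap_apply_left, Equiv.swap_apply_right, Sym2.eq_swap]
        · rw [Equiv.swap_apply_left, Equiv.swap_apply_right, Sym2.eq_swap]
        · exact absurd rfl hne

end Swap

/-! ### Type C flips -/

section FlipC

open Classical

variable {V E : Type*} {ends ends' : E → Sym2 V} {K : Set V} {A B C : V} {e₀ : E}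

/-- Let `e₀` be an edge between `B` and `C` that is not a bridge, and let all other edges at `B` and
at `K` stay inside of `K ∪ {A, B}`. Attach this part with its vertex `B` to `C`, detach it from `A`,
call its detached vertex `B` from now on, and let `e₀` join `B` and `A`: this is a Type C flip. -/
theorem flipC_of_not_bridge (hl : NoLoops ends)
    (hconn : ∀ x y, Relation.ReflTransGen ((ofEnds ends).deleteEdges {e₀}).Adj x y)
    (hAB : A ≠ B) (hAC : A ≠ C) (hBC : B ≠ C) (hA : A ∉ K) (hC : C ∉ K)
    (he₀ : ends e₀ = s(B, C))
    (hK : ∀ e x y, e ≠ e₀ → ends e = s(x, y) → x ∈ insert B K → y ∈ insert B K ∨ y = A)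
    (hin : ∀ e, e ≠ e₀ → e ∈ touch ends (insert B K) →
      ends' e = (ends e).map fun x => if x = B then C else if x = A then B else x)
    (hend : ends' e₀ = s(B, A))
    (hout : ∀ e, e ≠ e₀ → e ∉ touch ends (insert B K) → ends' e = ends e) :
    (ofEnds ends).FlipC (ofEnds ends') := by
  set W : Set V := insert A (insert B K) with hW
  have hAW : A ∈ W := Set.mem_insert _ _
  have hBW : B ∈ W := Set.mem_insert_of_mem _ (Set.mem_insert _ _)
  have hCW : C ∉ W := by
    rintro (h | h | h)
    · exact hAC h.symm
    · exact hBC h.symm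
    · exact hC h
  have hABK : A ∉ insert B K := by
    rintro (h | h)
    · exact hAB h
    · exact hA h
  have hadj : ∀ a b, ((ofEnds ends).deleteEdges {e₀}).Adj a b ↔ ∃ e ≠ e₀, ends e = s(a, b) := by
    intro a b
    constructor
    · rintro ⟨e, h1, h2⟩
      exact ⟨e, h2, h1⟩
    · rintro ⟨e, h1, h2⟩
      exact ⟨e, h2, h1⟩
  have hedge : ∀ e, e ∈ ((ofEnds ends).induce W).edgeSet ↔
      e ≠ e₀ ∧ e ∈ touch ends (insert B K) := by
    intro e
    by_cases he : e = e₀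
    · subst he
      rw [mem_edgeSet_induce_of_ends he₀]
      tauto
    · obtain ⟨x, y, hxy⟩ := exists_ends ends e
      rw [mem_edgeSet_induce_of_ends hxy, mem_touch_iff hxy]
      have h1 := hK e x y he hxy
      have h2 := hK e y x he (hxy.trans Sym2.eq_swap)
      have h4 : ¬ (x = A ∧ y = A) := by
        rintro ⟨rfl, rfl⟩
        exact hl e _ hxy
      have hmem : ∀ z, z ∈ W ↔ z = A ∨ z ∈ insert B K := fun z => Iff.rfl
      rw [hmem, hmem]
      tauto
  have he₀' : e₀ ∉ ((ofEnds ends).induce W).edgeSet := fun h => ((hedge _).1 h).1 rfl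
  refine ⟨(ofEnds ends).induce W, e₀, B, A, C, hAB.symm, hBC, hAC, fun f => ?_, ?_, ⟨?_, ?_, ?_,
    ?_⟩, hBW, hCW, ?_⟩
  · constructor
    · intro hf
      by_contra hne
      rcases hK f B C hne hf (Set.mem_insert _ _) with h | h
      · exact hCW (Set.mem_insert_of_mem _ h)
      · exact hAC h.symm
    · rintro rfl
      exact he₀
  · exact isInducedSubgraph_induce (Set.subset_univ _)
  · refine ⟨⟨Set.subset_univ _, ?_⟩, ?_⟩
    · intro e x y h
      refine ⟨h.1, ?_⟩
      rintro rfl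
      exact he₀' ⟨x, y, h⟩
    · intro e x y h hx hy
      exact ⟨h.1, hx, hy⟩
  · have hH : (ofEnds ends).induce W = ((ofEnds ends).deleteEdges {e₀}).induce W := by
      ext e x y
      · rfl
      · constructor
        · intro h
          refine ⟨⟨h.1, ?_⟩, h.2⟩
          rintro rfl
          exact he₀' ⟨x, y, h⟩
        · intro h
          exact ⟨h.1.1, h.2⟩
    rw [hH]
    refine isConn_induce hAW fun a ha => joinedIn_of_boundary ?_ ha (hconn a A)
    rintro a (rfl | ha) b hb hab
    · exact .refl
    · obtain ⟨e, he, hab⟩ := (hadj a b).1 hab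
      exact absurd (hK e a b he hab ha).symm hb
  · refine ⟨Set.mem_univ _, B, Set.mem_univ _, C, Set.mem_univ _, hAB.symm, hAC.symm, hconn B C, ?_⟩
    rw [deleteVerts_eq_induce rfl]
    intro h
    refine hCW (Set.mem_insert_of_mem _ (JoinedIn.mem_of_closed (S := insert B K) ?_ h
      (Set.mem_insert _ _)))
    intro a ha b hb hab
    obtain ⟨e, he, hab⟩ := (hadj a b).1 hab
    exact (hK e a b he hab ha).resolve_right hb
  · ext v
    constructor
    · rintro ⟨hv, e, he, w, hw⟩
      rcases hv with hv | hv
      · exact hv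
      · exact absurd ((hedge e).2 ⟨hw.2, mem_touch_left hw.1 hv⟩) he
    · rintro rfl
      refine ⟨hAW, ?_⟩
      by_contra hno
      push Not at hno
      -- Otherwise the part would be a union of components of the graph without `e₀`.
      refine hCW (JoinedIn.mem_of_closed (G := (ofEnds ends).deleteEdges {e₀}) (W := Set.univ)
        (S := W) (x := v) (y := C) ?_ ?_ hAW)
      · intro a ha b _ hab
        obtain ⟨e, he, hab⟩ := (hadj a b).1 hab
        rcases ha with rfl | ha
        · have : e ∈ ((ofEnds ends).induce W).edgeSet := by
            by_contra hne
            exact hno e hne ⟨b, hab, he⟩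
          exact ((mem_edgeSet_induce_of_ends hab).1 this).2
        · exact (hK e a b he hab ha).symm
      · refine Relation.ReflTransGen.mono ?_ _ _ (hconn v C)
        intro a b hab
        exact induce_adj.2 ⟨hab, trivial, trivial⟩
  · refine isRewiring_ofEnds fun e => ?_
    by_cases he : e = e₀
    · subst he
      simp only [if_neg he₀', if_true]
      rw [hend, he₀, Sym2.map_mk, if_neg hBC, if_pos rfl]
    · by_cases hm : e ∈ touch ends (insert B K)
      · simp only [if_pos ((hedge e).2 ⟨he, hm⟩)]
        exact hin e he hm
      · have : e ∉ ((ofEnds ends).induce W).edgeSet := fun h => hm ((hedge e).1 h).2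
        simp only [if_neg this, if_neg he]
        rw [hout e he hm]
        exact (Sym2.map_id' ▸ rfl : ends e = Sym2.map (fun x => x) (ends e))

end FlipC

end Graph

/-! ### Seifert circles of diagram data -/

theorem Dart.exists_rot {X P : Type} (y : Dart X P) : ∃ x : Dart X P, x.rot = y := by
  cases y with
  | cr c i => exact ⟨.cr c (i - 1), congrArg (Dart.cr c) (sub_add_cancel i 1)⟩
  | pt p b => exact ⟨.pt p !b, congrArg (Dart.pt p) (Bool.not_not b)⟩

/-- A colouring of the faces with boundary `Z` changes across an edge by the value of `Z` on that
edge. -/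
theorem planar_edge {X P : Type} {edge : Dart X P → Dart X P} {Z f : Dart X P → ZMod 2}
    (h1 : ∀ x, f (edge x.rot) = f x) (h2 : ∀ x : Dart X P, f x.rot = f x + Z x.rot)
    (y : Dart X P) : f (edge y) = f y + Z y := by
  obtain ⟨x, rfl⟩ := y.exists_rot
  rw [h1, h2, add_assoc, CharTwo.add_self_eq_zero, add_zero]

namespace DiagramData

/-- The steps along the Seifert circles; they depend on the data of the diagram only. -/
inductive Step (D : DiagramData) : Dart D.X D.P → Dart D.X D.P → Prop
  | edge (x : Dart D.X D.P) : Step D x (D.edge x)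
  | point (p : D.P) : Step D (.pt p false) (.pt p true)
  | smooth (c : D.X) (i : Fin 4) (h : D.out (.cr c i) ≠ D.out (.cr c (i + 1))) :
      Step D (.cr c i) (.cr c (i + 1))

/-- The Seifert circles. -/
def Circle (D : DiagramData) : Type :=
  Quot D.Step

/-- The Seifert circle through a dart. -/
def cl (D : DiagramData) (x : Dart D.X D.P) : D.Circle :=
  Quot.mk _ x

/-- The two Seifert circles that touch a crossing. -/
def circleEnds (D : DiagramData) (c : D.X) : Sym2 D.Circle :=
  s(D.cl (.cr c 0), D.cl (.cr c 2))

/-- The axioms of a connected oriented link diagram, apart from those on over- and under-strands,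
which have no influence on the Seifert graph. -/
structure IsDiagram (D : DiagramData) : Prop where
  finite_dart : Finite (Dart D.X D.P)
  edge_edge : ∀ x, D.edge (D.edge x) = x
  edge_ne : ∀ x, D.edge x ≠ x
  planar : IsPlanarMap D.edge
  connected : IsConnectedMap D.edge
  out_edge : ∀ x, D.out (D.edge x) = !D.out x
  out_cr : ∀ c i, D.out (.cr c (i + 2)) = !D.out (.cr c i)
  out_pt : ∀ p b, D.out (.pt p (!b)) = !D.out (.pt p b)

/-- The diagram falls apart when the crossing `c` is removed. -/
def IsNugatory (D : DiagramData) (c : D.X) : Prop :=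
  ∃ A : Set (Dart D.X D.P), A.Nonempty ∧ A ≠ Set.univ ∧ (∀ x ∈ A, D.edge x ∈ A) ∧
    (∀ d i, d ≠ c → .cr d i ∈ A → .cr d (i + 1) ∈ A) ∧ (∀ p b, .pt p b ∈ A → .pt p (!b) ∈ A)

/-- `ends` describes the Seifert graph of `D` up to isomorphism. -/
def Presents {V E : Type*} (ends : E → Sym2 V) (D : DiagramData) : Prop :=
  ∃ (f : V ≃ D.Circle) (g : E ≃ D.X), ∀ e, D.circleEnds (g e) = (ends e).map f

section Circle

variable {D : DiagramData}

theorem cl_edge (x : Dart D.X D.P) : D.cl (D.edge x) = D.cl x :=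
  (Quot.sound (Step.edge x)).symm

theorem cl_pt (p : D.P) (b : Bool) : D.cl (.pt p (!b)) = D.cl (.pt p b) := by
  cases b
  · exact (Quot.sound (Step.point p)).symm
  · exact Quot.sound (Step.point p)

theorem cl_smooth {c : D.X} {i : Fin 4} (h : D.out (.cr c i) ≠ D.out (.cr c (i + 1))) :
    D.cl (.cr c (i + 1)) = D.cl (.cr c i) :=
  (Quot.sound (Step.smooth c i h)).symm

theorem IsDiagram.cl_or (hD : D.IsDiagram) (c : D.X) (i : Fin 4) :
    D.cl (.cr c i) = D.cl (.cr c (i + 1)) ∧ D.cl (.cr c (i + 2)) = D.cl (.cr c (i + 3)) ∨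
      D.cl (.cr c (i + 1)) = D.cl (.cr c (i + 2)) ∧ D.cl (.cr c (i + 3)) = D.cl (.cr c i) := by
  have e2 : i + 1 + 1 = i + 2 := by grind
  have e3 : i + 2 + 1 = i + 3 := by grind
  have e4 : i + 3 + 1 = i := by grind
  have e5 : i + 1 + 2 = i + 3 := by grind
  have h1 := hD.out_cr c i
  have h2 := hD.out_cr c (i + 1)
  rw [e5] at h2
  by_cases h : D.out (.cr c i) = D.out (.cr c (i + 1))
  · right
    constructor
    · have := cl_smooth (D := D) (c := c) (i := i + 1) (by rw [e2, h1, h]; simp)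
      rw [e2] at this
      exact this.symm
    · have := cl_smooth (D := D) (c := c) (i := i + 3) (by rw [e4, h2, h]; simp)
      rw [e4] at this
      exact this.symm
  · left
    constructor
    · exact (cl_smooth h).symm
    · have := cl_smooth (D := D) (c := c) (i := i + 2) (by
        rw [e3, h1, h2]; intro h'; exact h (by simpa using h'))
      rw [e3] at this
      exact this.symm

theorem IsDiagram.circleEnds_eq (hD : D.IsDiagram) (c : D.X) (i : Fin 4) :
    D.circleEnds c = s(D.cl (.cr c i), D.cl (.cr c (i + 2))) := by
  have h := hD.cl_or c 0
  have hi : i = 0 ∨ i = 1 ∨ i = 2 ∨ i = 3 := by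
    revert i
    decide
  change _ = _ ∧ _ = _ ∨ _ = _ ∧ _ = _ at h
  unfold circleEnds
  rw [Sym2.eq_iff]
  rcases hi with rfl | rfl | rfl | rfl
  · exact Or.inl ⟨rfl, rfl⟩
  · rcases h with h | h
    · exact Or.inl ⟨h.1, h.2⟩
    · exact Or.inr ⟨h.2.symm, h.1.symm⟩
  · exact Or.inr ⟨rfl, rfl⟩
  · rcases h with h | h
    · exact Or.inr ⟨h.1, h.2⟩
    · exact Or.inl ⟨h.2.symm, h.1.symm⟩

/-- The circle through the next dart at a crossing is one of the ends of the crossing. -/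
theorem IsDiagram.cl_succ (hD : D.IsDiagram) (c : D.X) (i : Fin 4) :
    D.cl (.cr c (i + 1)) = D.cl (.cr c i) ∨ D.cl (.cr c (i + 1)) = D.cl (.cr c (i + 2)) := by
  rcases hD.cl_or c i with h | h
  · exact Or.inl h.1.symm
  · exact Or.inr h.1

open Classical in
/-- No Seifert circle touches itself at a crossing. A Seifert circle is the boundary of a union `f`
of faces, and in the direction of the orientation this union stays on the same side. At a crossing
where the circle touches itself the two outgoing darts are neighbours, so that `f` would be on the
left of one of them and on the right of the other. -/
theorem IsDiagram.cl_ne_cl (hD : D.IsDiagram) (c : D.X) :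
    D.cl (.cr c 0) ≠ D.cl (.cr c 2) := by
  intro hc
  set C := D.cl (.cr c 0) with hC
  have h01 : D.cl (.cr c 1) = C ∧ D.cl (.cr c 2) = C := by
    refine ⟨?_, hc.symm⟩
    rcases hD.cl_succ c 0 with h | h
    · exact h
    · exact h.trans hc.symm
  let Z : Dart D.X D.P → ZMod 2 := fun x => if D.cl x = C then 1 else 0
  have hZ : ∀ x y, D.cl x = D.cl y → Z x = Z y := by
    intro x y h
    simp only [Z, h]
  have hZ1 : ∀ x, D.cl x = C → Z x = 1 := fun x hx => if_pos hx
  obtain ⟨f, hf1, hf2⟩ := hD.planar Z (fun x => hZ _ _ (cl_edge x)) (fun d => by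
    rcases hD.cl_or d 0 with h | h
    · change D.cl (.cr d 0) = D.cl (.cr d 1) ∧ D.cl (.cr d 2) = D.cl (.cr d 3) at h
      rw [hZ _ _ h.1, hZ _ _ h.2, CharTwo.add_self_eq_zero, zero_add, CharTwo.add_self_eq_zero]
    · change D.cl (.cr d 1) = D.cl (.cr d 2) ∧ D.cl (.cr d 3) = D.cl (.cr d 0) at h
      rw [hZ _ _ h.1, hZ _ _ h.2, add_assoc (Z (.cr d 0)), CharTwo.add_self_eq_zero, add_zero,
        CharTwo.add_self_eq_zero]) (fun p => by
    rw [hZ (.pt p true) (.pt p false) (cl_pt p false), CharTwo.add_self_eq_zero])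
  let s : Bool → ZMod 2 := fun b => if b then 1 else 0
  have hs : ∀ b, s (!b) = s b + 1 := by decide
  let k : Dart D.X D.P → ZMod 2 := fun x => if D.cl x = C then f x + s (D.out x) else 0
  have hk : ∀ x y, D.Step x y → k x = k y := by
    intro x y h
    have hxy : D.cl x = D.cl y := Quot.sound h
    by_cases hx : D.cl x = C
    · have hy : D.cl y = C := hxy.symm.trans hx
      have key : f y = f x + 1 ∧ D.out y = !D.out x := by
        cases h with
        | edge =>
          refine ⟨?_, hD.out_edge x⟩
          rw [planar_edge hf1 hf2, hZ1 _ hx]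
        | point p => exact ⟨by rw [← hZ1 _ hy]; exact hf2 (.pt p false), hD.out_pt p false⟩
        | smooth d i h =>
          refine ⟨by rw [← hZ1 _ hy]; exact hf2 (.cr d i), ?_⟩
          revert h
          cases D.out (.cr d i) <;> cases D.out (.cr d (i + 1)) <;> simp
      simp only [k, if_pos hx, if_pos hy, key.1, key.2, hs]
      rw [add_add_add_comm, CharTwo.add_self_eq_zero, add_zero]
    · have hy : D.cl y ≠ C := fun h => hx (hxy.trans h)
      simp only [k, if_neg hx, if_neg hy]
  have hk' : ∀ x y, D.cl x = D.cl y → k x = k y := fun x y h =>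
    congrArg (Quot.lift k hk) h
  have h02 := hk' _ _ hc
  have f1 : f (.cr c 1) = f (.cr c 0) + 1 := by
    rw [← hZ1 _ h01.1]
    exact hf2 (.cr c 0)
  have f2 : f (.cr c 2) = f (.cr c 1) + 1 := by
    rw [← hZ1 _ h01.2]
    exact hf2 (.cr c 1)
  have o2 : D.out (.cr c 2) = !D.out (.cr c 0) := hD.out_cr c 0
  have hc0 : D.cl (.cr c 0) = C := rfl
  simp only [k, if_pos h01.2, if_pos hc0, f2, f1, o2, hs] at h02
  generalize f (.cr c 0) = a at h02
  generalize s (D.out (.cr c 0)) = b at h02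
  revert a b
  decide

/-- A bridge of the Seifert graph is a nugatory crossing. -/
theorem IsDiagram.eq_univ_of_not_isNugatory (hD : D.IsDiagram) {c₀ : D.X} (hc₀ : ¬ D.IsNugatory c₀)
    {S : Set D.Circle} (hS : S.Nonempty)
    (h : ∀ c u v, c ≠ c₀ → D.circleEnds c = s(u, v) → u ∈ S → v ∈ S) : S = Set.univ := by
  obtain ⟨⟨x⟩, hx⟩ := hS
  by_contra hne
  refine hc₀ ⟨{y | D.cl y ∈ S}, ⟨x, hx⟩, ?_, fun y hy => ?_, fun c i hc hy => ?_, fun p b hy => ?_⟩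
  · intro huniv
    refine hne (Set.eq_univ_of_forall ?_)
    rintro ⟨y⟩
    exact (Set.ext_iff.1 huniv y).2 trivial
  · change D.cl _ ∈ S
    rw [cl_edge]
    exact hy
  · change D.cl (.cr c (i + 1)) ∈ S
    rcases hD.cl_succ c i with h' | h' <;> rw [h']
    · exact hy
    · exact h c _ _ hc (hD.circleEnds_eq c i) hy
  · change D.cl (.pt p !b) ∈ S
    rw [cl_pt]
    exact hy

theorem IsDiagram.finite_circle (hD : D.IsDiagram) : Finite D.Circle := by
  have := hD.finite_dart
  exact Quot.finite _

end Circle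

section Presents

variable {V E : Type*} {ends : E → Sym2 V} {D : DiagramData}

theorem Presents.finite (h : Presents ends D) (hD : D.IsDiagram) : Finite V := by
  obtain ⟨f, g, h⟩ := h
  have := hD.finite_circle
  exact Finite.of_equiv _ f.symm

theorem Presents.noLoops (h : Presents ends D) (hD : D.IsDiagram) : Graph.NoLoops ends := by
  obtain ⟨f, g, h⟩ := h
  intro e x hx
  have := h e
  rw [hx, Sym2.map_mk, circleEnds, Sym2.eq_iff] at this
  exact hD.cl_ne_cl (g e) (by grind)

/-- A crossing that is not nugatory is not a bridge of the Seifert graph. -/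
theorem joined_deleteEdges {f : V ≃ D.Circle} {g : E ≃ D.X}
    (h : ∀ e, D.circleEnds (g e) = (ends e).map f) (hD : D.IsDiagram) {e₀ : E}
    (he₀ : ¬ D.IsNugatory (g e₀)) (x y : V) :
    Relation.ReflTransGen ((Graph.ofEnds ends).deleteEdges {e₀}).Adj x y := by
  refine Graph.joined_of_closed (fun S hS hcl => ?_) x y
  have := hD.eq_univ_of_not_isNugatory he₀ (S := f '' S) (hS.image f) ?_
  · rwa [← Set.image_univ_of_surjective f.surjective, f.injective.image_injective.eq_iff] at this
  · rintro c u v hc huv ⟨a, ha, rfl⟩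
    obtain ⟨e, rfl⟩ := g.surjective c
    obtain ⟨b, rfl⟩ := f.surjective v
    refine ⟨b, hcl a ha b ⟨e, ?_, fun he => hc (congrArg g he)⟩, rfl⟩
    rw [h, ← Sym2.map_mk] at huv
    exact Sym2.map.injective f.injective huv

end Presents

/-! ### Isomorphisms and subdivisions -/

section Iso

variable {M N : DiagramData}

theorem Iso.darts_pt (Φ : M.Iso N) (p : M.P) (b : Bool) : ∃ q b', Φ.darts (.pt p b) = .pt q b' := by
  cases h : Φ.darts (.pt p b) with
  | pt q b' => exact ⟨q, b', rfl⟩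
  | cr c' j =>
    -- Turning twice at a point is the identity, but not at a crossing.
    have h1 := Φ.darts_rot (.pt p b)
    have h2 := Φ.darts_rot (Dart.pt p b).rot
    have h3 : (Dart.pt p b : Dart M.X M.P).rot.rot = .pt p b :=
      congrArg (Dart.pt p) (Bool.not_not b)
    rw [h3, h1, h] at h2
    injection h2 with _ h4
    exact absurd h4 (by clear h h1; revert j; decide)

theorem Iso.symm_rot (Φ : M.Iso N) (y : Dart N.X N.P) :
    Φ.darts.symm y.rot = (Φ.darts.symm y).rot := by
  rw [Equiv.symm_apply_eq, Φ.darts_rot, Equiv.apply_symm_apply]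

/-- The inverse isomorphism. -/
def Iso.symm (Φ : M.Iso N) : N.Iso M where
  crossings := Φ.crossings.symm
  darts := Φ.darts.symm
  darts_cr := by
    intro c i
    cases h : Φ.darts.symm (.cr c i) with
    | cr d j =>
      obtain ⟨k, hk⟩ := Φ.darts_cr d j
      rw [Equiv.symm_apply_eq, hk] at h
      injection h with h1 _
      exact ⟨j, by rw [h1, Equiv.symm_apply_apply]⟩
    | pt p b =>
      obtain ⟨q, b', hq⟩ := Φ.darts_pt p b
      rw [Equiv.symm_apply_eq, hq] at h
      exact absurd h (by simp)
  darts_rot := Φ.symm_rot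
  darts_edge := by
    intro y
    rw [Equiv.symm_apply_eq, Φ.darts_edge, Equiv.apply_symm_apply]
  darts_out := by
    intro y
    rw [← Φ.darts_out, Equiv.apply_symm_apply]
  darts_over := by
    intro c i j h
    obtain ⟨d, rfl⟩ := Φ.crossings.surjective c
    rw [Equiv.symm_apply_apply, Equiv.symm_apply_eq] at h
    rw [Equiv.symm_apply_apply, Φ.darts_over d j i h.symm]

theorem Iso.darts_cr_add (Φ : M.Iso N) (c : M.X) : ∃ k : Fin 4, ∀ i,
    Φ.darts (.cr c i) = .cr (Φ.crossings c) (k + i) := by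
  obtain ⟨k, hk⟩ := Φ.darts_cr c 0
  have step : ∀ i, Φ.darts (.cr c i) = .cr (Φ.crossings c) (k + i) →
      Φ.darts (.cr c (i + 1)) = .cr (Φ.crossings c) (k + (i + 1)) := by
    intro i hi
    have := Φ.darts_rot (.cr c i)
    rw [hi] at this
    rw [← add_assoc]
    exact this
  have h0 : Φ.darts (.cr c 0) = .cr (Φ.crossings c) (k + 0) := by rw [hk, add_zero]
  have h1 := step 0 h0
  have h2 := step _ h1
  have h3 := step _ h2
  refine ⟨k, fun i => ?_⟩
  have hi : i = 0 ∨ i = 0 + 1 ∨ i = 0 + 1 + 1 ∨ i = 0 + 1 + 1 + 1 := by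
    revert i
    decide
  rcases hi with rfl | rfl | rfl | rfl <;> assumption

theorem Iso.isDiagram (Φ : M.Iso N) (hM : M.IsDiagram) : N.IsDiagram := by
  have hedge : ∀ x, N.edge (Φ.darts x) = Φ.darts (M.edge x) := fun x => (Φ.darts_edge x).symm
  have hout : ∀ x, N.out (Φ.darts x) = M.out x := Φ.darts_out
  refine ⟨?_, ?_, ?_, ?_, ?_, ?_, ?_, ?_⟩
  · have := hM.finite_dart
    exact Finite.of_equiv _ Φ.darts
  · intro y
    obtain ⟨x, rfl⟩ := Φ.darts.surjective y
    rw [hedge, hedge, hM.edge_edge]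
  · intro y h
    obtain ⟨x, rfl⟩ := Φ.darts.surjective y
    rw [hedge] at h
    exact hM.edge_ne x (Φ.darts.injective h)
  · intro Z h1 h2 h3
    have g1 : ∀ x, Z (Φ.darts (M.edge x)) = Z (Φ.darts x) := by
      intro x
      rw [← hedge, h1]
    have g2 : ∀ c, Z (Φ.darts (.cr c 0)) + Z (Φ.darts (.cr c 1)) + Z (Φ.darts (.cr c 2)) +
        Z (Φ.darts (.cr c 3)) = 0 := by
      intro c
      obtain ⟨k, hk⟩ := Φ.darts_cr_add c
      rw [hk, hk, hk, hk]
      have := h2 (Φ.crossings c)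
      have hk' : k = 0 ∨ k = 1 ∨ k = 2 ∨ k = 3 := by
        clear hk
        revert k
        decide
      rcases hk' with rfl | rfl | rfl | rfl
      · exact this
      · rw [← this]
        change Z (.cr _ 1) + Z (.cr _ 2) + Z (.cr _ 3) + Z (.cr _ 0) = _
        ring
      · rw [← this]
        change Z (.cr _ 2) + Z (.cr _ 3) + Z (.cr _ 0) + Z (.cr _ 1) = _
        ring
      · rw [← this]
        change Z (.cr _ 3) + Z (.cr _ 0) + Z (.cr _ 1) + Z (.cr _ 2) = _
        ring
    have g3 : ∀ p, Z (Φ.darts (.pt p false)) + Z (Φ.darts (.pt p true)) = 0 := by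
      intro p
      obtain ⟨q, b, hq⟩ := Φ.darts_pt p false
      have hq' : Φ.darts (.pt p true) = .pt q !b := by
        have := Φ.darts_rot (.pt p false)
        rw [hq] at this
        exact this
      rw [hq, hq', ← h3 q]
      cases b
      · rfl
      · exact add_comm _ _
    obtain ⟨f, hf1, hf2⟩ := hM.planar (fun x => Z (Φ.darts x)) g1 g2 g3
    refine ⟨fun y => f (Φ.darts.symm y), fun y => ?_, fun y => ?_⟩
    · obtain ⟨x, rfl⟩ := Φ.darts.surjective y
      simp only [← Φ.darts_rot, hedge, Equiv.symm_apply_apply, hf1]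
    · obtain ⟨x, rfl⟩ := Φ.darts.surjective y
      simp only [← Φ.darts_rot, Equiv.symm_apply_apply, hf2]
  · intro A hA h1 h2
    have := hM.connected (Φ.darts ⁻¹' A) ?_ ?_ ?_
    · refine Set.eq_univ_of_forall fun y => ?_
      obtain ⟨x, rfl⟩ := Φ.darts.surjective y
      exact (Set.ext_iff.1 this x).2 trivial
    · obtain ⟨y, hy⟩ := hA
      obtain ⟨x, rfl⟩ := Φ.darts.surjective y
      exact ⟨x, hy⟩
    · intro x hx
      change Φ.darts _ ∈ A
      rw [← hedge]
      exact h1 _ hx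
    · intro x hx
      change Φ.darts _ ∈ A
      rw [Φ.darts_rot]
      exact h2 _ hx
  · intro y
    obtain ⟨x, rfl⟩ := Φ.darts.surjective y
    rw [hedge, hout, hout, hM.out_edge]
  · intro c i
    obtain ⟨d, rfl⟩ := Φ.crossings.surjective c
    obtain ⟨k, hk⟩ := Φ.darts_cr_add d
    have h1 := hk (i - k)
    have h2 := hk (i - k + 2)
    rw [add_sub_cancel] at h1
    rw [← add_assoc, add_sub_cancel] at h2
    rw [← h1, ← h2, hout, hout, hM.out_cr]
  · intro p b
    obtain ⟨q, b', hq⟩ := Φ.symm.darts_pt p b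
    have hq1 : Φ.darts (.pt q b') = .pt p b := (Equiv.symm_apply_eq _).1 hq |>.symm
    have hq2 : Φ.darts (.pt q !b') = .pt p !b := by
      have := Φ.darts_rot (.pt q b')
      rw [hq1] at this
      exact this
    rw [← hq1, ← hq2, hout, hout, hM.out_pt]

theorem Iso.cl_eq (Φ : M.Iso N) {x y : Dart M.X M.P} (h : M.Step x y) :
    N.cl (Φ.darts x) = N.cl (Φ.darts y) := by
  cases h with
  | edge =>
    rw [Φ.darts_edge, cl_edge]
  | point p =>
    obtain ⟨q, b, hq⟩ := Φ.darts_pt p false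
    have hq' : Φ.darts (.pt p true) = .pt q !b := by
      have := Φ.darts_rot (.pt p false)
      rw [hq] at this
      exact this
    rw [hq, hq', cl_pt]
  | smooth c i h =>
    obtain ⟨k, hk⟩ := Φ.darts_cr_add c
    rw [← Φ.darts_out, ← Φ.darts_out (.cr c (i + 1)), hk, hk, ← add_assoc] at h
    rw [hk, hk, ← add_assoc, cl_smooth h]

/-- The bijection of Seifert circles that is induced by an isomorphism. -/
def Iso.circleEquiv (Φ : M.Iso N) : M.Circle ≃ N.Circle where
  toFun := Quot.lift (fun x => N.cl (Φ.darts x)) fun _ _ h => Φ.cl_eq h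
  invFun := Quot.lift (fun x => M.cl (Φ.symm.darts x)) fun _ _ h => Φ.symm.cl_eq h
  left_inv := by
    rintro ⟨x⟩
    exact congrArg M.cl (Φ.darts.symm_apply_apply x)
  right_inv := by
    rintro ⟨x⟩
    exact congrArg N.cl (Φ.darts.apply_symm_apply x)

theorem Presents.of_iso {V E : Type*} {ends : E → Sym2 V} (h : Presents ends M) (hM : M.IsDiagram)
    (Φ : M.Iso N) : Presents ends N := by
  obtain ⟨f, g, h⟩ := h
  refine ⟨f.trans Φ.circleEquiv, g.trans Φ.crossings, fun e => ?_⟩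
  obtain ⟨k, hk⟩ := Φ.darts_cr_add (g e)
  rw [Equiv.coe_trans, Function.comp_apply, (Φ.isDiagram hM).circleEnds_eq _ k, Equiv.coe_trans,
    ← Sym2.map_map, ← h, circleEnds, Sym2.map_mk]
  have h0 := hk 0
  rw [add_zero] at h0
  rw [← h0, ← hk 2]
  rfl

theorem Iso.isNugatory (Φ : M.Iso N) {c : M.X} (h : M.IsNugatory c) :
    N.IsNugatory (Φ.crossings c) := by
  obtain ⟨A, ⟨x, hx⟩, hne, h1, h2, h3⟩ := h
  refine ⟨Φ.darts.symm ⁻¹' A, ⟨Φ.darts x, ?_⟩, ?_, ?_, ?_, ?_⟩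
  · rwa [Set.mem_preimage, Equiv.symm_apply_apply]
  · intro h
    refine hne (Set.eq_univ_of_forall fun y => ?_)
    have : Φ.darts y ∈ Φ.darts.symm ⁻¹' A := h ▸ trivial
    rwa [Set.mem_preimage, Equiv.symm_apply_apply] at this
  · intro y hy
    rw [Set.mem_preimage] at hy ⊢
    exact (Φ.symm.darts_edge y) ▸ h1 _ hy
  · intro d i hd hi
    obtain ⟨j, hj⟩ := Φ.symm.darts_cr d i
    have hr : Φ.darts.symm (.cr d (i + 1)) = (Φ.darts.symm (.cr d i)).rot := Φ.symm_rot (.cr d i)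
    rw [Set.mem_preimage] at hi ⊢
    rw [hr]
    change Φ.darts.symm (.cr d i) = .cr (Φ.crossings.symm d) j at hj
    rw [hj] at hi ⊢
    refine h2 _ _ (fun h' => hd ?_) hi
    rw [← h', Equiv.apply_symm_apply]
  · intro p b hp
    obtain ⟨q, b', hq⟩ := Φ.symm.darts_pt p b
    have hr : Φ.darts.symm (.pt p !b) = (Φ.darts.symm (.pt p b)).rot := Φ.symm_rot (.pt p b)
    rw [Set.mem_preimage] at hp ⊢
    rw [hr]
    change Φ.darts.symm (.pt p b) = .pt q b' at hq
    rw [hq] at hp ⊢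
    exact h3 _ _ hp

/-- No crossing is nugatory. -/
def IsReduced (D : DiagramData) : Prop :=
  ∀ c, ¬ D.IsNugatory c

theorem IsReduced.of_iso (h : M.IsReduced) (Φ : M.Iso N) : N.IsReduced :=
  fun _ hc => h _ (Φ.symm.isNugatory hc)

end Iso

end DiagramData

namespace DiagramData

section Subdivide

variable {D : DiagramData} {x : Dart D.X D.P}

/-- A dart of a diagram as a dart of its subdivision. -/
def oldDart (x : Dart D.X D.P) : Dart D.X D.P → Dart (D.subdivide x).X (D.subdivide x).P
  | .cr c i => .cr c i
  | .pt p b => .pt (some p) b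

/-- The darts at the new point of a subdivision. -/
def newDart (x : Dart D.X D.P) (b : Bool) : Dart (D.subdivide x).X (D.subdivide x).P :=
  .pt none b

/-- The map that forgets the new point of a subdivision. -/
def forgetDart (x : Dart D.X D.P) : Dart (D.subdivide x).X (D.subdivide x).P → Dart D.X D.P
  | .cr c i => .cr c i
  | .pt (some p) b => .pt p b
  | .pt none _ => x

theorem forgetDart_oldDart (x y : Dart D.X D.P) : forgetDart x (oldDart x y) = y := by
  cases y <;> rfl

theorem oldDart_or_newDart (z : Dart (D.subdivide x).X (D.subdivide x).P) :
    (∃ y, z = oldDart x y) ∨ ∃ b, z = newDart x b := by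
  rcases z with ⟨c, i⟩ | ⟨_ | p, b⟩
  · exact Or.inl ⟨.cr c i, rfl⟩
  · exact Or.inr ⟨b, rfl⟩
  · exact Or.inl ⟨.pt p b, rfl⟩

theorem subdivide_edge_old (x y : Dart D.X D.P) :
    (y = x ∧ (D.subdivide x).edge (oldDart x y) = newDart x false) ∨
    (y = D.edge x ∧ (D.subdivide x).edge (oldDart x y) = newDart x true) ∨
    (D.subdivide x).edge (oldDart x y) = oldDart x (D.edge y) := by
  have key : ∀ z : Dart D.X D.P, oldDart x z = (match z with
    | .cr c i => .cr c i
    | .pt p b => .pt (some p) b : Dart D.X (Option D.P)) := fun z => by cases z <;> rfl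
  by_cases h1 : y = x
  · exact Or.inl ⟨h1, by cases y <;> exact if_pos h1⟩
  · by_cases h2 : y = D.edge x
    · exact Or.inr (Or.inl ⟨h2, by cases y <;> exact (if_neg h1).trans (if_pos h2)⟩)
    · refine Or.inr (Or.inr ((?_ : _ = _).trans (key _).symm))
      cases y <;> exact (if_neg h1).trans (if_neg h2)

theorem subdivide_edge_self (x : Dart D.X D.P) :
    (D.subdivide x).edge (oldDart x x) = newDart x false := by
  have h : ∀ y, y = x → (D.subdivide x).edge (oldDart x y) = newDart x false := by
    intro y h
    cases y <;> exact if_pos h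
  exact h x rfl

theorem subdivide_edge_new (x : Dart D.X D.P) :
    (D.subdivide x).edge (newDart x false) = oldDart x x ∧
      (D.subdivide x).edge (newDart x true) = oldDart x (D.edge x) := by
  have key : ∀ z : Dart D.X D.P, oldDart x z = (match z with
    | .cr c i => .cr c i
    | .pt p b => .pt (some p) b : Dart D.X (Option D.P)) := fun z => by cases z <;> rfl
  exact ⟨(key _).symm, (key _).symm⟩

theorem subdivide_cl_new (x : Dart D.X D.P) (b : Bool) :
    (D.subdivide x).cl (newDart x b) = (D.subdivide x).cl (oldDart x x) := by
  have h : (D.subdivide x).cl (newDart x false) = (D.subdivide x).cl (oldDart x x) := by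
    rw [← (subdivide_edge_new x).1, cl_edge]
  cases b
  · exact h
  · exact (cl_pt (D := D.subdivide x) none false).trans h

theorem subdivide_cl_edge (hD : ∀ y, D.edge (D.edge y) = y) (x y : Dart D.X D.P) :
    (D.subdivide x).cl (oldDart x (D.edge y)) = (D.subdivide x).cl (oldDart x y) := by
  have h0 : (D.subdivide x).cl (oldDart x (D.edge x)) = (D.subdivide x).cl (oldDart x x) := by
    rw [← (subdivide_edge_new x).2, cl_edge, subdivide_cl_new]
  rcases subdivide_edge_old x y with ⟨h1, -⟩ | ⟨h1, -⟩ | h1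
  · rw [h1, h0]
  · rw [h1, hD, h0]
  · rw [← h1, cl_edge]

theorem cl_forgetDart {z w : Dart (D.subdivide x).X (D.subdivide x).P}
    (h : (D.subdivide x).Step z w) : D.cl (forgetDart x z) = D.cl (forgetDart x w) := by
  cases h with
  | edge =>
    rcases oldDart_or_newDart z with ⟨y, rfl⟩ | ⟨b, rfl⟩
    · rw [forgetDart_oldDart]
      rcases subdivide_edge_old x y with ⟨h1, h2⟩ | ⟨h1, h2⟩ | h2 <;> rw [h2]
      · exact congrArg D.cl h1
      · exact (congrArg D.cl h1).trans (cl_edge x)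
      · rw [forgetDart_oldDart, cl_edge]
    · cases b
      · rw [(subdivide_edge_new x).1, forgetDart_oldDart]
        rfl
      · rw [(subdivide_edge_new x).2, forgetDart_oldDart, cl_edge]
        rfl
  | point p =>
    cases p with
    | none => rfl
    | some p => exact (cl_pt p false).symm
  | smooth c i h => exact (cl_smooth (D := D) (c := c) h).symm

/-- Subdividing an edge does not change the Seifert circles. -/
noncomputable def subdivideCircle (hD : ∀ y, D.edge (D.edge y) = y) (x : Dart D.X D.P) :
    D.Circle ≃ (D.subdivide x).Circle where
  toFun := Quot.lift (fun y => (D.subdivide x).cl (oldDart x y)) (by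
    rintro y z h
    cases h with
    | edge => exact (subdivide_cl_edge hD x y).symm
    | point p => exact (cl_pt (D := D.subdivide x) (some p) false).symm
    | smooth c i h => exact (cl_smooth (D := D.subdivide x) (c := c) h).symm)
  invFun := Quot.lift (fun z => D.cl (forgetDart x z)) fun _ _ h => cl_forgetDart h
  left_inv := by
    rintro ⟨y⟩
    exact congrArg D.cl (forgetDart_oldDart x y)
  right_inv := by
    rintro ⟨z⟩
    change (D.subdivide x).cl (oldDart x (forgetDart x z)) = (D.subdivide x).cl z
    rcases oldDart_or_newDart z with ⟨y, rfl⟩ | ⟨b, rfl⟩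
    · rw [forgetDart_oldDart]
    · rw [subdivide_cl_new]
      rfl

theorem presents_subdivide {V E : Type*} {ends : E → Sym2 V} (hD : ∀ y, D.edge (D.edge y) = y)
    (x : Dart D.X D.P) : Presents ends (D.subdivide x) ↔ Presents ends D := by
  have key : ∀ c : D.X, (D.subdivide x).circleEnds c =
      (D.circleEnds c).map (subdivideCircle hD x) := fun _ => rfl
  constructor
  · rintro ⟨f, g, h⟩
    refine ⟨f.trans (subdivideCircle hD x).symm, g, fun e => ?_⟩
    apply Sym2.map.injective (subdivideCircle hD x).injective
    refine (key _).symm.trans ((h e).trans ?_)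
    rw [Sym2.map_map]
    congr 1
    funext v
    simp
  · rintro ⟨f, g, h⟩
    refine ⟨f.trans (subdivideCircle hD x), g, fun e =>
      (key _).trans ((congrArg (Sym2.map (subdivideCircle hD x)) (h e)).trans ?_)⟩
    rw [Sym2.map_map]
    rfl

theorem isNugatory_subdivide (hD : ∀ y, D.edge (D.edge y) = y) (x : Dart D.X D.P) (c : D.X) :
    (D.subdivide x).IsNugatory c ↔ D.IsNugatory c := by
  have n1 := (subdivide_edge_new x).1
  have n2 := (subdivide_edge_new x).2
  constructor
  · rintro ⟨A, ⟨z, hz⟩, hne, h1, h2, h3⟩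
    have hnn : ∀ b b', newDart x b ∈ A → newDart x b' ∈ A := by
      intro b b' h
      have := h3 none b h
      cases b <;> cases b' <;> assumption
    have hnone : ∀ b, newDart x b ∈ A ↔ oldDart x x ∈ A := by
      intro b
      constructor
      · intro h
        exact n1 ▸ h1 _ (hnn b false h)
      · intro h
        exact hnn _ _ (subdivide_edge_self x ▸ h1 _ h)
    refine ⟨{y | oldDart x y ∈ A}, ?_, ?_, ?_, ?_, ?_⟩
    · rcases oldDart_or_newDart z with ⟨y, rfl⟩ | ⟨b, rfl⟩
      · exact ⟨y, hz⟩
      · exact ⟨x, (hnone b).1 hz⟩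
    · intro h
      have hall : ∀ y, oldDart x y ∈ A := fun y => (Set.ext_iff.1 h y).2 trivial
      refine hne (Set.eq_univ_of_forall fun z => ?_)
      rcases oldDart_or_newDart z with ⟨y, rfl⟩ | ⟨b, rfl⟩
      · exact hall y
      · exact (hnone b).2 (hall x)
    · intro y hy
      have hy' := h1 _ hy
      rcases subdivide_edge_old x y with ⟨e, h'⟩ | ⟨e, h'⟩ | h'
      · rw [e] at hy ⊢
        have := h1 _ ((hnone true).2 hy)
        rwa [n2] at this
      · change oldDart x (D.edge y) ∈ A
        rw [e, hD]
        exact (hnone true).1 (h' ▸ hy')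
      · rwa [h'] at hy'
    · exact fun d i hd hi => h2 d i hd hi
    · exact fun p b hp => h3 (some p) b hp
  · rintro ⟨A, ⟨y, hy⟩, hne, h1, h2, h3⟩
    have hB : ∀ y, oldDart x y ∈ forgetDart x ⁻¹' A ↔ y ∈ A := by
      intro y
      rw [Set.mem_preimage, forgetDart_oldDart]
    refine ⟨forgetDart x ⁻¹' A, ⟨oldDart x y, (hB y).2 hy⟩, ?_, ?_, ?_, ?_⟩
    · intro h
      refine hne (Set.eq_univ_of_forall fun y => ?_)
      exact (hB y).1 ((Set.ext_iff.1 h _).2 trivial)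
    · intro z hz
      rcases oldDart_or_newDart z with ⟨y, rfl⟩ | ⟨b, rfl⟩
      · rw [hB] at hz
        rcases subdivide_edge_old x y with ⟨e, h'⟩ | ⟨e, h'⟩ | h' <;> rw [h']
        · exact e ▸ hz
        · have := h1 _ hz
          rw [e, hD] at this
          exact this
        · exact (hB _).2 (h1 _ hz)
      · have hx : x ∈ A := hz
        cases b
        · rw [n1]
          exact (hB _).2 hx
        · rw [n2]
          exact (hB _).2 (h1 _ hx)
    · exact fun d i hd hi => h2 d i hd hi
    · intro p b hp
      cases p with
      | none => exact hp
      | some p => exact h3 p b hp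

end Subdivide

end DiagramData

namespace LinkDiagram

theorem isDiagram (D : LinkDiagram) : D.toDiagramData.IsDiagram where
  finite_dart := by
    have := D.finite_X
    have := D.finite_P
    refine Finite.of_injective (β := (D.X × Fin 4) ⊕ (D.P × Bool))
      (fun x => match x with
        | .cr c i => Sum.inl (c, i)
        | .pt p b => Sum.inr (p, b)) ?_
    rintro (⟨c, i⟩ | ⟨p, b⟩) (⟨d, j⟩ | ⟨q, b'⟩) h <;> simp_all
  edge_edge := D.edge_edge
  edge_ne := D.edge_ne
  planar := D.planar
  connected := D.connected
  out_edge := D.out_edge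
  out_cr := D.out_cr
  out_pt := D.out_pt

theorem Refines.presents_iff {D E : LinkDiagram} (h : D.Refines E) {V β : Type*}
    {ends : β → Sym2 V} :
    DiagramData.Presents ends D.toDiagramData ↔ DiagramData.Presents ends E.toDiagramData := by
  rcases h with ⟨⟨Φ⟩⟩ | ⟨x, ⟨Φ⟩⟩
  · exact ⟨fun h => h.of_iso D.isDiagram Φ, fun h => h.of_iso E.isDiagram Φ.symm⟩
  · rw [← DiagramData.presents_subdivide D.edge_edge x]
    exact ⟨fun h => h.of_iso (Φ.symm.isDiagram E.isDiagram) Φ,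
      fun h => h.of_iso E.isDiagram Φ.symm⟩

theorem Refines.isReduced_iff {D E : LinkDiagram} (h : D.Refines E) :
    D.toDiagramData.IsReduced ↔ E.toDiagramData.IsReduced := by
  rcases h with ⟨⟨Φ⟩⟩ | ⟨x, ⟨Φ⟩⟩
  · exact ⟨fun h => h.of_iso Φ, fun h => h.of_iso Φ.symm⟩
  · have : (D.toDiagramData.subdivide x).IsReduced ↔ D.toDiagramData.IsReduced :=
      forall_congr' fun c => not_congr (DiagramData.isNugatory_subdivide D.edge_edge x c)
    rw [← this]
    exact ⟨fun h => h.of_iso Φ, fun h => h.of_iso Φ.symm⟩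

theorem seifertGraph_isLink_iff (D : LinkDiagram) (c : D.X) (u v : D.SeifertCircle) :
    D.seifertGraph.IsLink c u v ↔ s(D.circle (.cr c 0), D.circle (.cr c 2)) = s(u, v) :=
  (show D.seifertGraph.IsLink c _ _ from ⟨0, rfl, rfl⟩).isLink_iff_sym2_eq

theorem seifertGraph_eq (D : LinkDiagram) : D.seifertGraph =
    Graph.ofEnds fun c => s(D.circle (.cr c 0), D.circle (.cr c 2)) :=
  Graph.ext rfl D.seifertGraph_isLink_iff

theorem seifertStep_iff (D : LinkDiagram) (x y : Dart D.X D.P) :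
    D.toDiagramData.Step x y ↔ D.SeifertStep x y := by
  constructor
  · rintro (_ | _ | ⟨c, i, h⟩)
    · exact .edge _
    · exact .point _
    · exact .smooth c i h
  · rintro (_ | _ | ⟨c, i, h⟩)
    · exact .edge _
    · exact .point _
    · exact .smooth c i h

/-- The Seifert circles of a diagram and of its data. -/
def circleEquiv (D : LinkDiagram) : D.SeifertCircle ≃ D.toDiagramData.Circle :=
  Quot.congr (Equiv.refl _) fun x y => (D.seifertStep_iff x y).symm

theorem presents (D : LinkDiagram) :
    DiagramData.Presents (fun c => s(D.circle (.cr c 0), D.circle (.cr c 2))) D.toDiagramData :=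
  ⟨D.circleEquiv, Equiv.refl _, fun _ => rfl⟩

theorem isomorphic_of_presents {D : LinkDiagram} {V β : Type*} {ends : β → Sym2 V}
    (h : DiagramData.Presents ends D.toDiagramData) :
    (Graph.ofEnds ends).Isomorphic D.seifertGraph := by
  obtain ⟨f, g, h⟩ := h
  rw [seifertGraph_eq]
  refine ⟨(Equiv.Set.univ V).trans ((f.trans D.circleEquiv.symm).trans (Equiv.Set.univ _).symm),
    (Equiv.subtypeUnivEquiv (Graph.mem_edgeSet_ofEnds _)).trans
      (g.trans (Equiv.subtypeUnivEquiv (Graph.mem_edgeSet_ofEnds _)).symm), ?_⟩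
  rintro ⟨e, -⟩ ⟨x, -⟩ ⟨y, -⟩
  change ends e = s(x, y) ↔ s(D.circle (.cr (g e) 0), D.circle (.cr (g e) 2)) =
    s(D.circleEquiv.symm (f x), D.circleEquiv.symm (f y))
  rw [← (Sym2.map.injective D.circleEquiv.injective).eq_iff,
    ← (Sym2.map.injective f.injective).eq_iff, ← h, Sym2.map_mk, Sym2.map_mk,
    Sym2.map_mk, Equiv.apply_symm_apply, Equiv.apply_symm_apply]
  rfl

end LinkDiagram

/-! ### Arcs of tangles -/

/-- Darts as pairs of a node and a direction. -/
def dartEquiv (X P : Type) : Dart X P ≃ (X × Fin 4) ⊕ (P × Bool) where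
  toFun x := match x with
    | .cr c i => Sum.inl (c, i)
    | .pt p b => Sum.inr (p, b)
  invFun x := match x with
    | Sum.inl (c, i) => .cr c i
    | Sum.inr (p, b) => .pt p b
  left_inv := by
    rintro (_ | _) <;> rfl
  right_inv := by
    rintro (_ | _) <;> rfl

namespace TangleData

/-- The steps along the Seifert arcs and Seifert circles of a tangle. -/
inductive Step (T : TangleData) : Dart (Option T.Y) T.P → Dart (Option T.Y) T.P → Prop
  | edge (x : Dart (Option T.Y) T.P) : Step T x (T.edge x)
  | point (p : T.P) : Step T (.pt p false) (.pt p true)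
  | smooth (c : T.Y) (i : Fin 4) (h : T.out (.cr (some c) i) ≠ T.out (.cr (some c) (i + 1))) :
      Step T (.cr (some c) i) (.cr (some c) (i + 1))

/-- The Seifert arcs and Seifert circles of a tangle, the components that remain after all crossings
have been smoothed. -/
def Arc (T : TangleData) : Type :=
  Quot T.Step

/-- The component through a dart. -/
def arc (T : TangleData) (x : Dart (Option T.Y) T.P) : T.Arc :=
  Quot.mk _ x

/-- The two components that touch a crossing. -/
def arcEnds (T : TangleData) (c : T.Y) : Sym2 T.Arc :=
  s(T.arc (.cr (some c) 0), T.arc (.cr (some c) 2))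

section

variable {T : TangleData}

theorem arc_edge (x : Dart (Option T.Y) T.P) : T.arc (T.edge x) = T.arc x :=
  (Quot.sound (Step.edge x)).symm

theorem arc_pt (p : T.P) : T.arc (.pt p true) = T.arc (.pt p false) :=
  (Quot.sound (Step.point p)).symm

theorem arc_smooth {c : T.Y} {i : Fin 4}
    (h : T.out (.cr (some c) i) ≠ T.out (.cr (some c) (i + 1))) :
    T.arc (.cr (some c) (i + 1)) = T.arc (.cr (some c) i) :=
  (Quot.sound (Step.smooth c i h)).symm

/-- If a weight on the darts cancels along each edge and at each node inside of the tangle, then it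
cancels at the boundary. -/
theorem IsTangle.sum_boundary (hT : T.IsTangle) {R : Type} [AddCommGroup R]
    (w : Dart (Option T.Y) T.P → R) (hedge : ∀ x, w x + w (T.edge x) = 0)
    (hcr : ∀ c, w (.cr (some c) 0) + w (.cr (some c) 1) + w (.cr (some c) 2) +
      w (.cr (some c) 3) = 0)
    (hpt : ∀ p, w (.pt p false) + w (.pt p true) = 0) :
    w (.cr none 0) + w (.cr none 1) + w (.cr none 2) + w (.cr none 3) = 0 := by
  have := hT.finite_Y
  have := hT.finite_P
  have := Fintype.ofFinite T.Y
  have := Fintype.ofFinite T.P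
  have : Fintype (Dart (Option T.Y) T.P) := Fintype.ofEquiv _ (dartEquiv _ _).symm
  have h1 : ∑ x, w x = 0 :=
    Finset.sum_involution (fun x _ => T.edge x) (fun x _ => hedge x) (fun x _ _ => hT.edge_ne x)
      (fun _ _ => Finset.mem_univ _) (fun x _ => hT.edge_edge x)
  have h2 : ∑ x, w x = ∑ y, w ((dartEquiv _ _).symm y) :=
    (Equiv.sum_comp (dartEquiv (Option T.Y) T.P).symm w).symm
  rw [h1, Fintype.sum_sum_type, Fintype.sum_prod_type, Fintype.sum_prod_type,
    Fintype.sum_option] at h2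
  have h3 : ∀ c : T.Y, ∑ i : Fin 4, w ((dartEquiv _ _).symm (Sum.inl (some c, i))) = 0 := by
    intro c
    rw [Fin.sum_univ_four]
    exact hcr c
  have h4 : ∀ p : T.P, ∑ b : Bool, w ((dartEquiv (Option T.Y) _).symm (Sum.inr (p, b))) = 0 := by
    intro p
    rw [Fintype.sum_bool, add_comm]
    exact hpt p
  rw [Finset.sum_congr rfl fun c _ => h3 c, Finset.sum_congr rfl fun p _ => h4 p,
    Finset.sum_const_zero, Finset.sum_const_zero, add_zero, add_zero, Fin.sum_univ_four] at h2
  exact h2.symm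

/-- The weight of a dart in a count with orientation. -/
def sign (b : Bool) : ℤ :=
  if b then 1 else -1

theorem IsTangle.arc_or (hT : T.IsTangle) (c : T.Y) :
    (T.out (.cr (some c) 0) ≠ T.out (.cr (some c) 1) ∧
      T.arc (.cr (some c) 1) = T.arc (.cr (some c) 0) ∧
      T.arc (.cr (some c) 3) = T.arc (.cr (some c) 2)) ∨
    (T.out (.cr (some c) 0) = T.out (.cr (some c) 1) ∧
      T.arc (.cr (some c) 2) = T.arc (.cr (some c) 1) ∧
      T.arc (.cr (some c) 0) = T.arc (.cr (some c) 3)) := by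
  have h1 : T.out (.cr (some c) 2) = !T.out (.cr (some c) 0) := hT.out_cr c 0
  have h2 : T.out (.cr (some c) 3) = !T.out (.cr (some c) 1) := hT.out_cr c 1
  by_cases h : T.out (.cr (some c) 0) = T.out (.cr (some c) 1)
  · right
    refine ⟨h, arc_smooth (i := 1) ?_, arc_smooth (i := 3) ?_⟩
    · change T.out (.cr (some c) 1) ≠ T.out (.cr (some c) 2)
      rw [h1, h]
      simp
    · change T.out (.cr (some c) 3) ≠ T.out (.cr (some c) 0)
      rw [h2, h]
      simp
  · left
    refine ⟨h, arc_smooth (i := 0) h, arc_smooth (i := 2) ?_⟩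
    change T.out (.cr (some c) 2) ≠ T.out (.cr (some c) 3)
    rw [h1, h2]
    simpa using h

open Classical in
/-- Every component of a tangle has as many ends that point in as ends that point out. -/
theorem IsTangle.sum_sign (hT : T.IsTangle) (C : T.Arc) :
    (if T.arc (.cr none 0) = C then sign (T.out (.cr none 0)) else 0) +
    (if T.arc (.cr none 1) = C then sign (T.out (.cr none 1)) else 0) +
    (if T.arc (.cr none 2) = C then sign (T.out (.cr none 2)) else 0) +
    (if T.arc (.cr none 3) = C then sign (T.out (.cr none 3)) else 0) = 0 := by
  have hs : ∀ b, sign (!b) = - sign b := by decide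
  have hs' : ∀ b b', b ≠ b' → sign b' = - sign b := by decide
  refine hT.sum_boundary (fun x => if T.arc x = C then sign (T.out x) else 0) ?_ ?_ ?_
  · intro x
    simp only [arc_edge, hT.out_edge, hs]
    split_ifs <;> simp
  · intro c
    have h1 : T.out (.cr (some c) 2) = !T.out (.cr (some c) 0) := hT.out_cr c 0
    have h2 : T.out (.cr (some c) 3) = !T.out (.cr (some c) 1) := hT.out_cr c 1
    rcases hT.arc_or c with ⟨h, h3, h4⟩ | ⟨h, h3, h4⟩
    · simp only [h1, h2, h3, h4, hs, hs' _ _ h]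
      split_ifs <;> simp
    · simp only [h1, h2, h3, h4, hs, h]
      split_ifs <;> simp
  · intro p
    have h := hT.out_pt p false
    change T.out (.pt p true) = _ at h
    simp only [arc_pt, h, hs]
    split_ifs <;> simp

open Classical in
/-- Seifert arcs do not cross: an arc from `0` to `2` separates the ends `1` and `3`. -/
theorem IsTangle.not_crossing (hT : T.IsTangle) (h02 : T.arc (.cr none 0) = T.arc (.cr none 2))
    (h13 : T.arc (.cr none 1) = T.arc (.cr none 3)) :
    T.arc (.cr none 0) = T.arc (.cr none 1) := by
  by_contra hne
  set C := T.arc (.cr none 0) with hC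
  let Z : Dart (Option T.Y) T.P → ZMod 2 := fun x => if T.arc x = C then 1 else 0
  have hZ : ∀ x y, T.arc x = T.arc y → Z x = Z y := by
    intro x y h
    simp only [Z, h]
  have hZ0 : ∀ x, T.arc x ≠ C → Z x = 0 := fun x hx => if_neg hx
  have hZ1 : ∀ x, T.arc x = C → Z x = 1 := fun x hx => if_pos hx
  have h1 : T.arc (.cr none 1) ≠ C := fun h => hne h.symm
  have h3 : T.arc (.cr none 3) ≠ C := fun h => hne (h13.trans h).symm
  obtain ⟨f, hf1, hf2⟩ := hT.planar Z (fun x => hZ _ _ (arc_edge x)) (fun d => by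
    cases d with
    | none =>
      rw [hZ1 _ hC.symm, hZ0 _ h1, hZ1 _ h02.symm, hZ0 _ h3]
      decide
    | some c =>
      rcases hT.arc_or c with ⟨-, h3, h4⟩ | ⟨-, h3, h4⟩
      · rw [hZ _ _ h3, hZ _ _ h4, CharTwo.add_self_eq_zero, zero_add, CharTwo.add_self_eq_zero]
      · rw [hZ _ _ h3, hZ _ _ h4, add_assoc (Z (.cr _ 3)), CharTwo.add_self_eq_zero, add_zero,
          CharTwo.add_self_eq_zero]) (fun p => by
    rw [hZ _ _ (arc_pt p), CharTwo.add_self_eq_zero])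
  -- Away from `C` one stays on the same side of `C`.
  let k : Dart (Option T.Y) T.P → ZMod 2 := fun x => if T.arc x = C then 0 else f x
  have hk : ∀ x y, T.Step x y → k x = k y := by
    intro x y h
    have hxy : T.arc x = T.arc y := Quot.sound h
    by_cases hx : T.arc x = C
    · have hy : T.arc y = C := hxy.symm.trans hx
      simp only [k, if_pos hx, if_pos hy]
    · have hy : T.arc y ≠ C := fun h => hx (hxy.trans h)
      simp only [k, if_neg hx, if_neg hy]
      cases h with
      | edge => rw [planar_edge hf1 hf2, hZ0 _ hx, add_zero]
      | point p =>
        have := hf2 (.pt p false)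
        change f (.pt p true) = f (.pt p false) + Z (.pt p true) at this
        rw [this, hZ0 _ hy, add_zero]
      | smooth c i h =>
        have := hf2 (.cr (some c) i)
        change f (.cr (some c) (i + 1)) = _ + Z (.cr (some c) (i + 1)) at this
        rw [this, hZ0 _ hy, add_zero]
  have hk' : k (.cr none 1) = k (.cr none 3) := congrArg (Quot.lift k hk) h13
  simp only [k, if_neg h1, if_neg h3] at hk'
  have f2 : f (.cr none 2) = f (.cr none 1) + Z (.cr none 2) := hf2 (.cr none 1)
  have f3 : f (.cr none 3) = f (.cr none 2) + Z (.cr none 3) := hf2 (.cr none 2)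
  rw [f3, f2, hZ1 _ h02.symm, hZ0 _ h3] at hk'
  generalize f (.cr none 1) = a at hk'
  revert a
  decide

/-- Two of the four ends of a tangle point in and two point out. -/
theorem IsTangle.sum_sign_out (hT : T.IsTangle) : sign (T.out (.cr none 0)) +
    sign (T.out (.cr none 1)) + sign (T.out (.cr none 2)) + sign (T.out (.cr none 3)) = 0 := by
  have hs : ∀ b, sign (!b) = - sign b := by decide
  refine hT.sum_boundary (fun x => sign (T.out x)) ?_ ?_ ?_
  · intro x
    simp only [hT.out_edge, hs]
    omega
  · intro c
    have h1 : T.out (.cr (some c) 2) = !T.out (.cr (some c) 0) := hT.out_cr c 0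
    have h2 : T.out (.cr (some c) 3) = !T.out (.cr (some c) 1) := hT.out_cr c 1
    simp only [h1, h2, hs]
    omega
  · intro p
    have h := hT.out_pt p false
    change T.out (.pt p true) = _ at h
    simp only [h, hs]
    omega

theorem IsTangle.exists_partner (hT : T.IsTangle) (i : Fin 4) :
    ∃ j, T.out (.cr none j) ≠ T.out (.cr none i) ∧ T.arc (.cr none j) = T.arc (.cr none i) := by
  classical
  by_contra hno
  push Not at hno
  have hsum := hT.sum_sign (T.arc (.cr none i))
  have key : ∀ j, (if T.arc (.cr none j) = T.arc (.cr none i) then sign (T.out (.cr none j)) else 0)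
      = if T.arc (.cr none j) = T.arc (.cr none i) then sign (T.out (.cr none i)) else 0 := by
    intro j
    by_cases hj : T.arc (.cr none j) = T.arc (.cr none i)
    · have : T.out (.cr none j) = T.out (.cr none i) := by
        by_contra h
        exact hno j h hj
      rw [this]
    · rw [if_neg hj, if_neg hj]
  rw [key 0, key 1, key 2, key 3] at hsum
  have hi : i = 0 ∨ i = 1 ∨ i = 2 ∨ i = 3 := by
    clear hno hsum key
    revert i
    decide
  have hself : (if T.arc (.cr none i) = T.arc (.cr none i) then sign (T.out (.cr none i)) else 0) =
      sign (T.out (.cr none i)) := if_pos rfl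
  have hne : ∀ b, sign b ≠ 0 := by decide
  have hne' := hne (T.out (.cr none i))
  rcases hi with rfl | rfl | rfl | rfl <;> rw [hself] at hsum <;> split_ifs at hsum <;> omega

/-- The components at the ends of a tangle: either `0`, `1` and `2`, `3` are joined, or `0`, `3` and
`1`, `2`. Neighbouring ends with the same orientation force the choice that separates them. -/
theorem IsTangle.arcs (hT : T.IsTangle) :
    ((T.arc (.cr none 0) = T.arc (.cr none 1) ∧ T.arc (.cr none 2) = T.arc (.cr none 3)) ∨
      (T.arc (.cr none 0) = T.arc (.cr none 3) ∧ T.arc (.cr none 1) = T.arc (.cr none 2))) ∧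
    (T.out (.cr none 2) = T.out (.cr none 3) →
      T.arc (.cr none 0) = T.arc (.cr none 3) ∧ T.arc (.cr none 1) = T.arc (.cr none 2)) ∧
    (T.out (.cr none 1) = T.out (.cr none 2) →
      T.arc (.cr none 0) = T.arc (.cr none 1) ∧ T.arc (.cr none 2) = T.arc (.cr none 3)) ∧
    (T.out (.cr none 2) = T.out (.cr none 3) ↔ T.out (.cr none 0) = T.out (.cr none 1)) ∧
    (T.out (.cr none 1) = T.out (.cr none 2) ↔ T.out (.cr none 0) = T.out (.cr none 3)) := by
  have hc := hT.not_crossing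
  have hs := hT.sum_sign_out
  have h0 := hT.exists_partner 0
  have h1 := hT.exists_partner 1
  have h2 := hT.exists_partner 2
  have h3 := hT.exists_partner 3
  have four : ∀ p : Fin 4 → Prop, (∃ j, p j) → p 0 ∨ p 1 ∨ p 2 ∨ p 3 := by
    rintro p ⟨j, hj⟩
    have : j = 0 ∨ j = 1 ∨ j = 2 ∨ j = 3 := by
      clear hj
      revert j
      decide
    rcases this with rfl | rfl | rfl | rfl <;> tauto
  replace h0 := four _ h0
  replace h1 := four _ h1
  replace h2 := four _ h2
  replace h3 := four _ h3
  clear four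
  generalize T.arc (.cr none 0) = a0 at *
  generalize T.arc (.cr none 1) = a1 at *
  generalize T.arc (.cr none 2) = a2 at *
  generalize T.arc (.cr none 3) = a3 at *
  generalize T.out (.cr none 0) = o0 at *
  generalize T.out (.cr none 1) = o1 at *
  generalize T.out (.cr none 2) = o2 at *
  generalize T.out (.cr none 3) = o3 at *
  cases o0 <;> cases o1 <;> cases o2 <;> cases o3 <;> first
    | exact absurd hs (by decide)
    | simp at h0 h1 h2 h3 ⊢
      grind

end

end TangleData

/-! ### The Seifert circles of a composed diagram -/

/-- The sets `X` and `Y`, each with four marked points `t` and `r`, map to `V`, and `V` is obtained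
from their disjoint union by the identifications that make the marked points satisfy the
condition `C`. The universal property is required for maps to `Prop` only; this suffices to
separate the points of the quotient. -/
structure IsPushout {X Y V : Type} (C : ∀ S : Type, (Fin 4 → S) → (Fin 4 → S) → Prop)
    (t : Fin 4 → X) (r : Fin 4 → Y) (a : X → V) (b : Y → V) : Prop where
  compat : C V (a ∘ t) (b ∘ r)
  surj : ∀ v, (∃ x, a x = v) ∨ ∃ y, b y = v
  desc : ∀ (g : X → Prop) (h : Y → Prop), C Prop (g ∘ t) (h ∘ r) →
    ∃ k : V → Prop, (∀ x, k (a x) = g x) ∧ ∀ y, k (b y) = h y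

/-- The values at the sockets, given by those at the ends of the tangle, of the rest, and of the
further crossing. -/
def socketVal {S : Type} (t r p : Fin 4 → S) : Socket → S
  | .tangle k => t k
  | .rest k => r k
  | .pivot k => p k

/-- Values at the ends of a tangle and of the rest can be extended to the composed diagram, where
`piv i` says that the darts `i` and `i + 1` of the further crossing are joined by its smoothing. -/
def WireCompat (wire : Socket → Socket) (piv : Fin 4 → Prop) (S : Type) (t r : Fin 4 → S) : Prop :=
  ∃ p : Fin 4 → S, (∀ s, socketVal t r p (wire s) = socketVal t r p s) ∧
    ∀ i, piv i → p i = p (i + 1)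

namespace TangleData

/-- The components at the ends of a tangle, by position. -/
def tangleEnd (T : TangleData) (k : Fin 4) : T.Arc :=
  T.arc (.cr none (-k))

/-- The components at the ends of the rest, by position. -/
def restEnd (R : TangleData) (k : Fin 4) : R.Arc :=
  R.arc (.cr none k)

end TangleData

section Glue

variable {T R : TangleData} {o : Fin 4 → Bool} {wire : Socket → Socket}

theorem glue_edge_tangleDart (x : Dart (Option T.Y) T.P) :
    (glue T R o wire).edge (tangleDart x) = tangleDart (T.edge x) := by
  rcases x with ⟨_ | c, i⟩ | ⟨p, b⟩
  · change tangleDart (T.edge (.cr none (- -i))) = _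
    rw [neg_neg]
  · rfl
  · rfl

theorem glue_edge_restDart (x : Dart (Option R.Y) R.P) :
    (glue T R o wire).edge (restDart x) = restDart (R.edge x) := by
  rcases x with ⟨_ | c, i⟩ | ⟨p, b⟩ <;> rfl

theorem glue_edge_socketDart (s : Socket) :
    (glue T R o wire).edge (socketDart s) = socketDart (wire s) := by
  cases s <;> rfl

/-- The component of a tangle as part of a Seifert circle of the composed diagram. -/
def tangleCircle (T R : TangleData) (o : Fin 4 → Bool) (wire : Socket → Socket) :
    T.Arc → (glue T R o wire).Circle :=
  Quot.lift (fun x => (glue T R o wire).cl (tangleDart x)) (by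
    rintro x y h
    cases h with
    | edge =>
      rw [← glue_edge_tangleDart (R := R) (o := o) (wire := wire)]
      exact (DiagramData.cl_edge _).symm
    | point p => exact (DiagramData.cl_pt (D := glue T R o wire) (.tangle p) false).symm
    | smooth c i h =>
      exact (DiagramData.cl_smooth (D := glue T R o wire) (c := .tangle c) (i := i) h).symm)

/-- The component of the rest as part of a Seifert circle of the composed diagram. -/
def restCircle (T R : TangleData) (o : Fin 4 → Bool) (wire : Socket → Socket) :
    R.Arc → (glue T R o wire).Circle :=
  Quot.lift (fun x => (glue T R o wire).cl (restDart x)) (by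
    rintro x y h
    cases h with
    | edge =>
      rw [← glue_edge_restDart (T := T) (o := o) (wire := wire)]
      exact (DiagramData.cl_edge _).symm
    | point p => exact (DiagramData.cl_pt (D := glue T R o wire) (.rest p) false).symm
    | smooth c i h =>
      exact (DiagramData.cl_smooth (D := glue T R o wire) (c := .rest c) (i := i) h).symm)

theorem glue_cl_socketDart (s : Socket) : (glue T R o wire).cl (socketDart s) =
    socketVal (tangleCircle T R o wire ∘ T.tangleEnd) (restCircle T R o wire ∘ R.restEnd)
      (fun k => (glue T R o wire).cl (.cr .pivot k)) s := by
  cases s with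
  | tangle k =>
    change _ = (glue T R o wire).cl (.pt (.tangleEnd (- -k)) false)
    rw [neg_neg]
    exact DiagramData.cl_pt (D := glue T R o wire) (.tangleEnd k) false
  | rest k => exact DiagramData.cl_pt (D := glue T R o wire) (.restEnd k) false
  | pivot k => rfl

/-- The smoothing of the further crossing joins its darts `i` and `i + 1`. -/
def pivotJoin (T R : TangleData) (o : Fin 4 → Bool) (wire : Socket → Socket) (i : Fin 4) : Prop :=
  (glue T R o wire).out (.cr .pivot i) ≠ (glue T R o wire).out (.cr .pivot (i + 1))

/-- A function on the composed diagram with given values on the components of the tangle and of the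
rest and at the further crossing. -/
def glueVal {S : Type} (g : T.Arc → S) (h : R.Arc → S) (p : Fin 4 → S) :
    Dart (GlueCrossing T.Y R.Y) (GluePoint T.P R.P) → S
  | .cr (.tangle c) i => g (T.arc (.cr (some c) i))
  | .cr (.rest c) i => h (R.arc (.cr (some c) i))
  | .cr .pivot i => p i
  | .pt (.tangle q) b => g (T.arc (.pt q b))
  | .pt (.rest q) b => h (R.arc (.pt q b))
  | .pt (.tangleEnd k) _ => g (T.tangleEnd k)
  | .pt (.restEnd k) _ => h (R.restEnd k)

theorem glueVal_tangleDart {S : Type} (g : T.Arc → S) (h : R.Arc → S) (p : Fin 4 → S)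
    (x : Dart (Option T.Y) T.P) : glueVal g h p (tangleDart x) = g (T.arc x) := by
  rcases x with ⟨_ | c, i⟩ | ⟨q, b⟩
  · change g (T.arc (.cr none (- -i))) = _
    rw [neg_neg]
  · rfl
  · rfl

theorem glueVal_restDart {S : Type} (g : T.Arc → S) (h : R.Arc → S) (p : Fin 4 → S)
    (x : Dart (Option R.Y) R.P) : glueVal g h p (restDart x) = h (R.arc x) := by
  rcases x with ⟨_ | c, i⟩ | ⟨q, b⟩ <;> rfl

theorem glueVal_socketDart {S : Type} (g : T.Arc → S) (h : R.Arc → S) (p : Fin 4 → S)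
    (s : Socket) : glueVal g h p (socketDart s) =
      socketVal (g ∘ T.tangleEnd) (h ∘ R.restEnd) p s := by
  cases s <;> rfl

theorem glueVal_step {S : Type} {g : T.Arc → S} {h : R.Arc → S} {p : Fin 4 → S}
    (hw : ∀ s, socketVal (g ∘ T.tangleEnd) (h ∘ R.restEnd) p (wire s) =
      socketVal (g ∘ T.tangleEnd) (h ∘ R.restEnd) p s)
    (hp : ∀ i, pivotJoin T R o wire i → p i = p (i + 1))
    {x y : Dart (glue T R o wire).X (glue T R o wire).P} (hxy : (glue T R o wire).Step x y) :
    glueVal g h p x = glueVal g h p y := by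
  have hT : ∀ z, glueVal g h p ((glue T R o wire).edge (tangleDart z)) =
      glueVal g h p (tangleDart z) := by
    intro z
    rw [glue_edge_tangleDart, glueVal_tangleDart, glueVal_tangleDart, TangleData.arc_edge]
  have hR : ∀ z, glueVal g h p ((glue T R o wire).edge (restDart z)) =
      glueVal g h p (restDart z) := by
    intro z
    rw [glue_edge_restDart, glueVal_restDart, glueVal_restDart, TangleData.arc_edge]
  have hS : ∀ s, glueVal g h p ((glue T R o wire).edge (socketDart s)) =
      glueVal g h p (socketDart s) := by
    intro s
    rw [glue_edge_socketDart, glueVal_socketDart, glueVal_socketDart, hw]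
  cases hxy with
  | edge =>
    symm
    rcases x with ⟨c | c | _, i⟩ | ⟨q | q | k | k, b⟩
    · exact hT (.cr (some c) i)
    · exact hR (.cr (some c) i)
    · exact hS (.pivot i)
    · exact hT (.pt q b)
    · exact hR (.pt q b)
    · cases b
      · have := hT (.cr none (-k))
        change glueVal g h p ((glue T R o wire).edge (.pt (.tangleEnd (- -k)) false)) =
          glueVal g h p (.pt (.tangleEnd (- -k)) false) at this
        rwa [neg_neg] at this
      · exact hS (.tangle k)
    · cases b
      · exact hR (.cr none k)
      · exact hS (.rest k)
  | point q =>
    rcases q with q | q | k | k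
    · exact congrArg g (TangleData.arc_pt q).symm
    · exact congrArg h (TangleData.arc_pt q).symm
    · rfl
    · rfl
  | smooth c i hi =>
    rcases c with c | c | _
    · exact congrArg g (TangleData.arc_smooth (T := T) (c := c) (i := i) hi).symm
    · exact congrArg h (TangleData.arc_smooth (T := R) (c := c) (i := i) hi).symm
    · exact hp i hi

/-- The Seifert circles of a composed diagram arise from the components of its two tangles. -/
theorem isPushout_circle (hwire : ∀ k, (∃ l, wire (.pivot k) = .tangle l) ∨
      ∃ l, wire (.pivot k) = .rest l) :
    IsPushout (WireCompat wire (pivotJoin T R o wire)) T.tangleEnd R.restEnd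
      (tangleCircle T R o wire) (restCircle T R o wire) where
  compat := by
    refine ⟨fun k => (glue T R o wire).cl (.cr .pivot k), fun s => ?_, fun i hi => ?_⟩
    · rw [← glue_cl_socketDart, ← glue_cl_socketDart, ← glue_edge_socketDart]
      exact DiagramData.cl_edge _
    · exact (DiagramData.cl_smooth hi).symm
  surj := by
    rintro ⟨x⟩
    have hend : ∀ k b, (glue T R o wire).cl (.pt (.tangleEnd k) b) =
        tangleCircle T R o wire (T.tangleEnd k) := by
      intro k b
      have h := glue_cl_socketDart (T := T) (R := R) (o := o) (wire := wire) (.tangle k)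
      cases b
      · exact (DiagramData.cl_pt (D := glue T R o wire) (.tangleEnd k) false).symm.trans h
      · exact h
    have hend' : ∀ k b, (glue T R o wire).cl (.pt (.restEnd k) b) =
        restCircle T R o wire (R.restEnd k) := by
      intro k b
      have h := glue_cl_socketDart (T := T) (R := R) (o := o) (wire := wire) (.rest k)
      cases b
      · exact (DiagramData.cl_pt (D := glue T R o wire) (.restEnd k) false).symm.trans h
      · exact h
    rcases x with ⟨c | c | _, i⟩ | ⟨q | q | k | k, b⟩
    · exact Or.inl ⟨T.arc (.cr (some c) i), rfl⟩
    · exact Or.inr ⟨R.arc (.cr (some c) i), rfl⟩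
    · have h1 : (glue T R o wire).cl (socketDart (wire (.pivot i))) =
          (glue T R o wire).cl (.cr .pivot i) := by
        rw [← glue_edge_socketDart]
        exact DiagramData.cl_edge _
      rcases hwire i with ⟨l, hl⟩ | ⟨l, hl⟩
      · exact Or.inl ⟨T.tangleEnd l, (hend l true).symm.trans (by rw [hl] at h1; exact h1)⟩
      · exact Or.inr ⟨R.restEnd l, (hend' l true).symm.trans (by rw [hl] at h1; exact h1)⟩
    · exact Or.inl ⟨T.arc (.pt q b), rfl⟩
    · exact Or.inr ⟨R.arc (.pt q b), rfl⟩
    · exact Or.inl ⟨_, (hend k b).symm⟩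
    · exact Or.inr ⟨_, (hend' k b).symm⟩
  desc := by
    rintro g h ⟨p, hw, hp⟩
    refine ⟨Quot.lift (glueVal g h p) fun _ _ hxy => glueVal_step hw hp hxy, ?_, ?_⟩
    · rintro ⟨x⟩
      exact glueVal_tangleDart g h p x
    · rintro ⟨x⟩
      exact glueVal_restDart g h p x

/-- The Seifert circles are determined by the components of the two tangles and by how these are
joined. -/
theorem exists_circle_equiv {V : Type} (hwire : ∀ k, (∃ l, wire (.pivot k) = .tangle l) ∨
      ∃ l, wire (.pivot k) = .rest l) {a : T.Arc → V} {b : R.Arc → V}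
    (h : IsPushout (WireCompat wire (pivotJoin T R o wire)) T.tangleEnd R.restEnd a b) :
    ∃ F : (glue T R o wire).Circle ≃ V, (∀ x, F (tangleCircle T R o wire x) = a x) ∧
      ∀ y, F (restCircle T R o wire y) = b y := by
  obtain ⟨p, hw, hp⟩ := h.compat
  let F : (glue T R o wire).Circle → V :=
    Quot.lift (glueVal a b p) fun _ _ hxy => glueVal_step hw hp hxy
  have hFa : ∀ x, F (tangleCircle T R o wire x) = a x := by
    rintro ⟨x⟩
    exact glueVal_tangleDart a b p x
  have hFb : ∀ y, F (restCircle T R o wire y) = b y := by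
    rintro ⟨x⟩
    exact glueVal_restDart a b p x
  have P := isPushout_circle (T := T) (R := R) (o := o) hwire
  have hinj : Function.Injective F := by
    intro u v huv
    -- The predicate "to be `v`" descends to `V`.
    obtain ⟨q, hqw, hqp⟩ := P.compat
    obtain ⟨k, hka, hkb⟩ := h.desc (fun x => tangleCircle T R o wire x = v)
      (fun y => restCircle T R o wire y = v) (by
        refine ⟨fun i => q i = v, fun s => ?_, fun i hi => ?_⟩
        · have := hqw s
          have hv : ∀ s, socketVal ((fun x => tangleCircle T R o wire x = v) ∘ T.tangleEnd)
              ((fun y => restCircle T R o wire y = v) ∘ R.restEnd) (fun i => q i = v) s =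
              (socketVal (tangleCircle T R o wire ∘ T.tangleEnd)
                (restCircle T R o wire ∘ R.restEnd) q s = v) := by
            intro s
            cases s <;> rfl
          rw [hv, hv, this]
        · change (q i = v) = (q (i + 1) = v)
          rw [hqp i hi])
    have hk : ∀ w, k (F w) = (w = v) := by
      intro w
      rcases P.surj w with ⟨x, rfl⟩ | ⟨y, rfl⟩
      · rw [hFa, hka]
      · rw [hFb, hkb]
    have := hk u
    rw [huv, hk v] at this
    exact this.mp rfl
  have hsurj : Function.Surjective F := by
    intro v
    rcases h.surj v with ⟨x, rfl⟩ | ⟨y, rfl⟩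
    · exact ⟨_, hFa x⟩
    · exact ⟨_, hFb y⟩
  exact ⟨Equiv.ofBijective F ⟨hinj, hsurj⟩, hFa, hFb⟩

end Glue

/-! ### Turning a tangle -/

section Turn

variable {T : TangleData}

theorem halfTurn_halfTurn {Y P : Type} (x : Dart (Option Y) P) : halfTurn (halfTurn x) = x := by
  rcases x with ⟨_ | c, i⟩ | ⟨p, b⟩
  · change Dart.cr none (-1 - (-1 - i)) = _
    rw [sub_sub_cancel]
  · change Dart.cr (some c) (- -i) = _
    rw [neg_neg]
  · rfl

/-- A half turn maps smoothing steps to smoothing steps, possibly in the other direction. -/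
theorem arc_halfTurn {x y : Dart (Option T.turn.Y) T.turn.P} (h : T.turn.Step x y) :
    T.arc (halfTurn (Y := T.Y) (P := T.P) x) = T.arc (halfTurn (Y := T.Y) (P := T.P) y) := by
  cases h with
  | edge =>
    change _ = T.arc (halfTurn (halfTurn (T.edge (halfTurn (Y := T.Y) (P := T.P) x))))
    rw [halfTurn_halfTurn, TangleData.arc_edge]
  | point p => exact (TangleData.arc_pt (T := T) p).symm
  | smooth c i h =>
    change T.out (.cr (some c) (-i)) ≠ T.out (.cr (some c) (-(i + 1))) at h
    have e : -i = -(i + 1) + 1 := by clear h; revert i; decide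
    change T.arc (.cr (some c) (-i)) = T.arc (.cr (some c) (-(i + 1)))
    rw [e] at h ⊢
    exact TangleData.arc_smooth h.symm

theorem turn_arc_halfTurn {x y : Dart (Option T.Y) T.P} (h : T.Step x y) :
    T.turn.arc (halfTurn x) = T.turn.arc (halfTurn y) := by
  cases h with
  | edge =>
    have := TangleData.arc_edge (T := T.turn) (halfTurn x)
    change T.turn.arc (halfTurn (T.edge (halfTurn (halfTurn x)))) = _ at this
    rw [halfTurn_halfTurn] at this
    exact this.symm
  | point p => exact (TangleData.arc_pt (T := T.turn) p).symm
  | smooth c i h =>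
    have e : -i = -(i + 1) + 1 := by clear h; revert i; decide
    have key : ∀ j : Fin 4, j = -(i + 1) → T.turn.arc (.cr (some c) (j + 1)) =
        T.turn.arc (.cr (some c) j) := by
      intro j hj
      refine TangleData.arc_smooth ?_
      change T.out (.cr (some c) (-j)) ≠ T.out (.cr (some c) (-(j + 1)))
      have e1 : -j = i + 1 := by rw [hj, neg_neg]
      have e2 : -(j + 1) = i := by rw [hj, ← e, neg_neg]
      rw [e1, e2]
      exact h.symm
    have := key _ rfl
    rw [← e] at this
    exact this

/-- The components of a turned tangle. -/
def turnArc (T : TangleData) : T.turn.Arc → T.Arc :=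
  Quot.lift (fun x => T.arc (halfTurn (Y := T.Y) (P := T.P) x)) fun _ _ h => arc_halfTurn h

theorem turnArc_bijective (T : TangleData) : Function.Bijective (turnArc T) := by
  let inv : T.Arc → T.turn.Arc :=
    Quot.lift (fun x => T.turn.arc (halfTurn x)) fun _ _ h => turn_arc_halfTurn h
  refine Function.bijective_iff_has_inverse.2 ⟨inv, ?_, ?_⟩
  · rintro ⟨x⟩
    exact congrArg T.turn.arc (halfTurn_halfTurn (Y := T.Y) (P := T.P) x)
  · rintro ⟨x⟩
    exact congrArg T.arc (halfTurn_halfTurn x)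

theorem turnArc_tangleEnd (k : Fin 4) : turnArc T (T.turn.tangleEnd k) = T.tangleEnd (1 - k) := by
  change T.arc (.cr none (-1 - -k)) = T.arc (.cr none (-(1 - k)))
  have e : -1 - -k = -(1 - k) := by revert k; decide
  rw [e]

theorem turnArc_arcEnds (c : T.Y) : (T.turn.arcEnds c).map (turnArc T) = T.arcEnds c :=
  rfl

end Turn

/-! ### The further crossing to the right and to the left of the tangle -/

theorem Fin.forall_four {p : Fin 4 → Prop} : (∀ i, p i) ↔ p 0 ∧ p 1 ∧ p 2 ∧ p 3 := by
  simp only [Fin.forall_fin_succ, IsEmpty.forall_iff, and_true]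
  rfl

theorem Socket.forall_socket {p : Socket → Prop} : (∀ s, p s) ↔
    (∀ k, p (.tangle k)) ∧ (∀ k, p (.rest k)) ∧ ∀ k, p (.pivot k) := by
  refine ⟨fun h => ⟨fun k => h _, fun k => h _, fun k => h _⟩, ?_⟩
  rintro ⟨h1, h2, h3⟩ (k | k | k)
  exacts [h1 k, h2 k, h3 k]

/-- How the ends `t` of the tangle and `r` of the rest are joined when the crossing is to the right
of the tangle. The smoothing of the crossing consists of two horizontal arcs if `hor` holds, and of
two vertical arcs otherwise. -/
def RightCompat (hor : Prop) (S : Type) (t r : Fin 4 → S) : Prop :=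
  t 0 = r 0 ∧ t 1 = r 1 ∧ (hor → t 2 = r 2 ∧ t 3 = r 3) ∧ (¬ hor → t 2 = t 3 ∧ r 2 = r 3)

/-- How the ends are joined after the flype. The values `t` refer to the ends of the tangle before
it is turned. -/
def LeftCompat (hor : Prop) (S : Type) (t r : Fin 4 → S) : Prop :=
  t 3 = r 2 ∧ t 2 = r 3 ∧ (hor → t 1 = r 0 ∧ t 0 = r 1) ∧ (¬ hor → t 0 = t 1 ∧ r 0 = r 1)

theorem wireCompat_right_iff {piv : Fin 4 → Prop} {hor : Prop} (h0 : piv 0 ↔ ¬ hor)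
    (h1 : piv 1 ↔ hor) (h2 : piv 2 ↔ ¬ hor) (h3 : piv 3 ↔ hor) {S : Type} {t r : Fin 4 → S} :
    WireCompat wireRight piv S t r ↔ RightCompat hor S t r := by
  unfold WireCompat RightCompat
  simp only [Socket.forall_socket, Fin.forall_four, h0, h1, h2, h3, wireRight, socketVal,
    Fin.isValue, Fin.reduceAdd]
  constructor
  · rintro ⟨p, hp⟩
    grind
  · intro h
    refine ⟨![t 3, t 2, r 2, r 3], ?_⟩
    simp
    grind

theorem wireCompat_left_iff {piv : Fin 4 → Prop} {hor : Prop} (h0 : piv 0 ↔ ¬ hor)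
    (h1 : piv 1 ↔ hor) (h2 : piv 2 ↔ ¬ hor) (h3 : piv 3 ↔ hor) {S : Type} {t r : Fin 4 → S} :
    WireCompat wireLeft piv S (fun k => t (1 - k)) r ↔ LeftCompat hor S t r := by
  unfold WireCompat LeftCompat
  simp only [Socket.forall_socket, Fin.forall_four, h0, h1, h2, h3, wireLeft, socketVal,
    Fin.isValue, Fin.reduceAdd, Fin.reduceSub]
  constructor
  · rintro ⟨p, hp⟩
    grind
  · intro h
    refine ⟨![r 0, r 1, t 0, t 1], ?_⟩
    simp
    grind

theorem IsPushout.congr {X Y V : Type} {C C' : ∀ S : Type, (Fin 4 → S) → (Fin 4 → S) → Prop}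
    (h : ∀ (S : Type) (t r : Fin 4 → S), C S t r ↔ C' S t r) {t : Fin 4 → X} {r : Fin 4 → Y}
    {a : X → V} {b : Y → V} (hp : IsPushout C t r a b) : IsPushout C' t r a b where
  compat := (h _ _ _).1 hp.compat
  surj := hp.surj
  desc g h' hg := hp.desc g h' ((h _ _ _).2 hg)

theorem IsPushout.comp_equiv {X Y V W : Type} {C : ∀ S : Type, (Fin 4 → S) → (Fin 4 → S) → Prop}
    {t : Fin 4 → X} {r : Fin 4 → Y} {a : X → V} {b : Y → V} (hp : IsPushout C t r a b)
    (f : W ≃ V) (hC : C W (f.symm ∘ a ∘ t) (f.symm ∘ b ∘ r)) :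
    IsPushout C t r (f.symm ∘ a) (f.symm ∘ b) where
  compat := hC
  surj w := by
    rcases hp.surj (f w) with ⟨x, hx⟩ | ⟨y, hy⟩
    · exact Or.inl ⟨x, by simp [hx]⟩
    · exact Or.inr ⟨y, by simp [hy]⟩
  desc g h hg := by
    obtain ⟨k, hk1, hk2⟩ := hp.desc g h hg
    exact ⟨k ∘ f, by simpa using hk1, by simpa using hk2⟩

theorem IsPushout.turn {T : TangleData} {Y V : Type} {piv : Fin 4 → Prop} {hor : Prop}
    (h0 : piv 0 ↔ ¬ hor) (h1 : piv 1 ↔ hor) (h2 : piv 2 ↔ ¬ hor) (h3 : piv 3 ↔ hor)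
    {r : Fin 4 → Y} {a : T.Arc → V} {b : Y → V}
    (hp : IsPushout (LeftCompat hor) T.tangleEnd r a b) :
    IsPushout (WireCompat wireLeft piv) T.turn.tangleEnd r (a ∘ turnArc T) b where
  compat := by
    have := (wireCompat_left_iff h0 h1 h2 h3).2 hp.compat
    convert this using 1
    funext k
    exact congrArg a (turnArc_tangleEnd k)
  surj v := by
    rcases hp.surj v with ⟨x, hx⟩ | hy
    · obtain ⟨x, rfl⟩ := (turnArc_bijective T).2 x
      exact Or.inl ⟨x, hx⟩
    · exact Or.inr hy
  desc g h hg := by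
    let e := Equiv.ofBijective _ (turnArc_bijective T)
    obtain ⟨k, hk1, hk2⟩ := hp.desc (g ∘ e.symm) h ((wireCompat_left_iff h0 h1 h2 h3).1 (by
      convert hg using 1
      funext k
      change g (e.symm (T.tangleEnd (1 - k))) = g (T.turn.tangleEnd k)
      rw [← turnArc_tangleEnd]
      exact congrArg g (e.symm_apply_apply (T.turn.tangleEnd k))))
    refine ⟨k, fun x => ?_, hk2⟩
    rw [Function.comp_apply, hk1]
    exact congrArg g (e.symm_apply_apply x)

section

variable {T R : TangleData} {o : Fin 4 → Bool}

/-- The orientations of the ends in a diagram whose further crossing is to the right. -/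
theorem out_of_isDiagram_right (hD : (glue T R o wireRight).IsDiagram) :
    R.out (.cr none 2) = (!T.out (.cr none 1)) ∧ R.out (.cr none 3) = (!T.out (.cr none 2)) ∧
    R.out (.cr none 0) = (!T.out (.cr none 0)) ∧ R.out (.cr none 1) = (!T.out (.cr none 3)) := by
  have e0 := hD.out_cr .pivot 0
  have e1 := hD.out_cr .pivot 1
  have e2 := hD.out_edge (.pt (.tangleEnd 0) true)
  have e3 := hD.out_edge (.pt (.tangleEnd 1) true)
  change R.out (.cr none 2) = (!T.out (.cr none 1)) at e0
  change R.out (.cr none 3) = (!T.out (.cr none 2)) at e1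
  change (!R.out (.cr none 0)) = (!!T.out (.cr none 0)) at e2
  change (!R.out (.cr none 1)) = (!!T.out (.cr none 3)) at e3
  refine ⟨e0, e1, ?_, ?_⟩
  · simpa using e2
  · simpa using e3

theorem pivotJoin_right (hD : (glue T R o wireRight).IsDiagram) :
    (pivotJoin T R o wireRight 0 ↔ ¬ T.out (.cr none 1) = T.out (.cr none 2)) ∧
    (pivotJoin T R o wireRight 1 ↔ T.out (.cr none 1) = T.out (.cr none 2)) ∧
    (pivotJoin T R o wireRight 2 ↔ ¬ T.out (.cr none 1) = T.out (.cr none 2)) ∧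
    (pivotJoin T R o wireRight 3 ↔ T.out (.cr none 1) = T.out (.cr none 2)) := by
  obtain ⟨e2, e3, -, -⟩ := out_of_isDiagram_right hD
  have p0 : pivotJoin T R o wireRight 0 ↔ T.out (.cr none 1) ≠ T.out (.cr none 2) := Iff.rfl
  have p1 : pivotJoin T R o wireRight 1 ↔ T.out (.cr none 2) ≠ R.out (.cr none 2) := Iff.rfl
  have p2 : pivotJoin T R o wireRight 2 ↔ R.out (.cr none 2) ≠ R.out (.cr none 3) := Iff.rfl
  have p3 : pivotJoin T R o wireRight 3 ↔ R.out (.cr none 3) ≠ T.out (.cr none 1) := Iff.rfl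
  rw [p0, p1, p2, p3, e2, e3]
  generalize T.out (.cr none 1) = x
  generalize T.out (.cr none 2) = y
  revert x y
  decide

theorem pivotJoin_left (hT : T.IsTangle) (hD : (glue T R o wireRight).IsDiagram) :
    (pivotJoin T.turn R o wireLeft 0 ↔ ¬ T.out (.cr none 1) = T.out (.cr none 2)) ∧
    (pivotJoin T.turn R o wireLeft 1 ↔ T.out (.cr none 1) = T.out (.cr none 2)) ∧
    (pivotJoin T.turn R o wireLeft 2 ↔ ¬ T.out (.cr none 1) = T.out (.cr none 2)) ∧
    (pivotJoin T.turn R o wireLeft 3 ↔ T.out (.cr none 1) = T.out (.cr none 2)) := by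
  obtain ⟨-, -, e0, e1⟩ := out_of_isDiagram_right hD
  have p0 : pivotJoin T.turn R o wireLeft 0 ↔ R.out (.cr none 0) ≠ R.out (.cr none 1) := Iff.rfl
  have p1 : pivotJoin T.turn R o wireLeft 1 ↔ R.out (.cr none 1) ≠ T.out (.cr none 0) := Iff.rfl
  have p2 : pivotJoin T.turn R o wireLeft 2 ↔ T.out (.cr none 0) ≠ T.out (.cr none 3) := Iff.rfl
  have p3 : pivotJoin T.turn R o wireLeft 3 ↔ T.out (.cr none 3) ≠ R.out (.cr none 0) := Iff.rfl
  rw [p0, p1, p2, p3, e0, e1, hT.arcs.2.2.2.2]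
  generalize T.out (.cr none 0) = x
  generalize T.out (.cr none 3) = y
  revert x y
  decide

/-- The Seifert graph of the diagram with the further crossing to the right of the tangle is
composed of two pieces, coming from the tangle and the rest, and the edge of the further
crossing. -/
theorem exists_pushout_of_presents {V E : Type} {ends : E → Sym2 V}
    (hD : (glue T R o wireRight).IsDiagram)
    {f : V ≃ (glue T R o wireRight).Circle} {g : E ≃ GlueCrossing T.Y R.Y}
    (h : ∀ e, (glue T R o wireRight).circleEnds (g e) = (ends e).map f) :
    ∃ (a : T.Arc → V) (b : R.Arc → V),
      IsPushout (RightCompat (T.out (.cr none 1) = T.out (.cr none 2))) T.tangleEnd R.restEnd a b ∧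
      (∀ c, ends (g.symm (.tangle c)) = (T.arcEnds c).map a) ∧
      (∀ c, ends (g.symm (.rest c)) = (R.arcEnds c).map b) ∧
      ends (g.symm .pivot) = s(a (T.tangleEnd 3), b (R.restEnd 2)) := by
  obtain ⟨h0, h1, h2, h3⟩ := pivotJoin_right hD
  have P := isPushout_circle (T := T) (R := R) (o := o) (wire := wireRight) (by
    rw [Fin.forall_four]
    exact ⟨Or.inl ⟨_, rfl⟩, Or.inl ⟨_, rfl⟩, Or.inr ⟨_, rfl⟩, Or.inr ⟨_, rfl⟩⟩)
  have P' := P.congr fun S t r => wireCompat_right_iff h0 h1 h2 h3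
  have hends : ∀ c : GlueCrossing T.Y R.Y,
      ends (g.symm c) = ((glue T R o wireRight).circleEnds c).map f.symm := by
    intro c
    obtain ⟨e, rfl⟩ := g.surjective c
    rw [Equiv.symm_apply_apply]
    refine Eq.trans ?_ (congrArg (Sym2.map f.symm) (h e).symm)
    rw [Sym2.map_map, Equiv.symm_comp_self, Sym2.map_id]
    rfl
  have hp0 : (glue T R o wireRight).cl (.cr .pivot 0) =
      tangleCircle T R o wireRight (T.tangleEnd 3) := by
    have e := glue_cl_socketDart (T := T) (R := R) (o := o) (wire := wireRight) (.tangle 3)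
    refine Eq.trans ?_ e
    exact (DiagramData.cl_edge (D := glue T R o wireRight) (.cr .pivot 0)).symm
  have hp2 : (glue T R o wireRight).cl (.cr .pivot 2) =
      restCircle T R o wireRight (R.restEnd 2) := by
    have e := glue_cl_socketDart (T := T) (R := R) (o := o) (wire := wireRight) (.rest 2)
    refine Eq.trans ?_ e
    exact (DiagramData.cl_edge (D := glue T R o wireRight) (.cr .pivot 2)).symm
  refine ⟨f.symm ∘ tangleCircle T R o wireRight, f.symm ∘ restCircle T R o wireRight,
    ?_, ?_, ?_, ?_⟩
  · refine P'.comp_equiv f ?_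
    have := P'.compat
    unfold RightCompat at this ⊢
    simpa using this
  · intro c
    rw [hends]
    rfl
  · intro c
    rw [hends]
    rfl
  · rw [hends]
    exact congrArg (Sym2.map f.symm) (congrArg₂ (fun x y => s(x, y)) hp0 hp2)

/-- A graph that is composed in the way that belongs to the diagram after the flype is the Seifert
graph of that diagram. -/
theorem presents_left_of_pushout {V E : Type} {ends : E → Sym2 V} (hT : T.IsTangle)
    (hD : (glue T R o wireRight).IsDiagram)
    (g : E ≃ GlueCrossing T.Y R.Y) {a : T.Arc → V} {b : R.Arc → V}
    (hp : IsPushout (LeftCompat (T.out (.cr none 1) = T.out (.cr none 2)))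
      T.tangleEnd R.restEnd a b)
    (h1 : ∀ c, ends (g.symm (.tangle c)) = (T.arcEnds c).map a)
    (h2 : ∀ c, ends (g.symm (.rest c)) = (R.arcEnds c).map b)
    (h3 : ends (g.symm .pivot) = s(b (R.restEnd 0), a (T.tangleEnd 0))) :
    DiagramData.Presents ends (glue T.turn R o wireLeft) := by
  obtain ⟨p0, p1, p2, p3⟩ := pivotJoin_left hT hD
  obtain ⟨F, hFa, hFb⟩ := exists_circle_equiv (T := T.turn) (R := R) (o := o) (wire := wireLeft) (by
    rw [Fin.forall_four]
    exact ⟨Or.inr ⟨_, rfl⟩, Or.inr ⟨_, rfl⟩, Or.inl ⟨_, rfl⟩, Or.inl ⟨_, rfl⟩⟩)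
    (hp.turn p0 p1 p2 p3)
  have hFa' : ∀ x, F.symm (a (turnArc T x)) = tangleCircle T.turn R o wireLeft x := fun x => by
    rw [Equiv.symm_apply_eq, hFa]
    rfl
  have hFb' : ∀ x, F.symm (b x) = restCircle T.turn R o wireLeft x := fun x => by
    rw [Equiv.symm_apply_eq, hFb]
  have hp0 : (glue T.turn R o wireLeft).cl (.cr .pivot 0) =
      restCircle T.turn R o wireLeft (R.restEnd 0) := by
    have e := glue_cl_socketDart (T := T.turn) (R := R) (o := o) (wire := wireLeft) (.rest 0)
    refine Eq.trans ?_ e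
    exact (DiagramData.cl_edge (D := glue T.turn R o wireLeft) (.cr .pivot 0)).symm
  have hp2 : (glue T.turn R o wireLeft).cl (.cr .pivot 2) =
      tangleCircle T.turn R o wireLeft (T.turn.tangleEnd 1) := by
    have e := glue_cl_socketDart (T := T.turn) (R := R) (o := o) (wire := wireLeft) (.tangle 1)
    refine Eq.trans ?_ e
    exact (DiagramData.cl_edge (D := glue T.turn R o wireLeft) (.cr .pivot 2)).symm
  refine ⟨F.symm, g, fun e => ?_⟩
  obtain ⟨c, rfl⟩ := g.symm.surjective e
  refine Eq.trans (congrArg (glue T.turn R o wireLeft).circleEnds (g.apply_symm_apply c)) ?_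
  rcases c with c | c | _
  · rw [h1, ← turnArc_arcEnds, Sym2.map_map, Sym2.map_map]
    exact congrArg (fun φ => Sym2.map φ (T.turn.arcEnds c)) (funext hFa').symm
  · rw [h2, Sym2.map_map]
    exact congrArg (fun φ => Sym2.map φ (R.arcEnds c)) (funext hFb').symm
  · rw [h3, Sym2.map_mk, hFb']
    refine congrArg₂ (fun x y => s(x, y)) hp0 (hp2.trans ?_)
    rw [← hFa', turnArc_tangleEnd]
    rfl

end

/-! ### The effect of a flype on the Seifert graph -/

/-- The edges of a graph, apart from one called `pivot`, come from two pieces with vertices `X` and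
`Y` and edges `K` and `L`, which are mapped to the graph by `a` and `b`. -/
structure IsComposed {V E X Y K L : Type} (ends : E → Sym2 V) (g : E ≃ GlueCrossing K L)
    (dX : K → Sym2 X) (dY : L → Sym2 Y) (a : X → V) (b : Y → V) : Prop where
  tangle : ∀ c, ends (g.symm (.tangle c)) = (dX c).map a
  rest : ∀ c, ends (g.symm (.rest c)) = (dY c).map b

theorem LeftCompat.map {hor : Prop} {S S' : Type} {t r : Fin 4 → S} (h : LeftCompat hor S t r)
    (f : S → S') : LeftCompat hor S' (f ∘ t) (f ∘ r) := by
  obtain ⟨h1, h2, h3, h4⟩ := h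
  refine ⟨congrArg f h1, congrArg f h2, fun h => ?_, fun h => ?_⟩
  · exact ⟨congrArg f (h3 h).1, congrArg f (h3 h).2⟩
  · exact ⟨congrArg f (h4 h).1, congrArg f (h4 h).2⟩

section

variable {V E X Y K L : Type} {ends : E → Sym2 V} {g : E ≃ GlueCrossing K L}
  {dX : K → Sym2 X} {dY : L → Sym2 Y} {a : X → V} {b : Y → V} {t : Fin 4 → X} {r : Fin 4 → Y}
  {hor : Prop}

theorem IsComposed.exists_left (hc : IsComposed ends g dX dY a b) {c : K} {x y : V}
    (h : ends (g.symm (.tangle c)) = s(x, y)) : ∃ x', a x' = x := by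
  rw [hc.tangle] at h
  have hx : x ∈ (dX c).map a := by
    rw [h]
    exact Sym2.mem_mk_left x y
  obtain ⟨x', -, h⟩ := Sym2.mem_map.1 hx
  exact ⟨x', h⟩

theorem IsComposed.exists_right (hc : IsComposed ends g dX dY a b) {c : L} {x y : V}
    (h : ends (g.symm (.rest c)) = s(x, y)) : ∃ x', b x' = x := by
  rw [hc.rest] at h
  have hx : x ∈ (dY c).map b := by
    rw [h]
    exact Sym2.mem_mk_left x y
  obtain ⟨x', -, h⟩ := Sym2.mem_map.1 hx
  exact ⟨x', h⟩

/-- The two pieces meet in marked points only. -/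
theorem IsPushout.exists_marked_left (hp : IsPushout (RightCompat hor) t r a b) {x : X} {y : Y}
    (h : a x = b y) : ∃ i, a x = a (t i) := by
  by_contra hno
  push Not at hno
  obtain ⟨k, hk1, hk2⟩ := hp.desc (fun x' => a x = a x') (fun _ => False) (by
    simp only [RightCompat, Function.comp_apply, hno, implies_true, and_self])
  have h1 := hk1 x
  rw [h, hk2] at h1
  simp at h1

theorem IsPushout.exists_marked_right (hp : IsPushout (RightCompat hor) t r a b) {x : X} {y : Y}
    (h : a x = b y) : ∃ i, b y = b (r i) := by
  by_contra hno
  push Not at hno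
  obtain ⟨k, hk1, hk2⟩ := hp.desc (fun _ => False) (fun y' => b y = b y') (by
    simp only [RightCompat, Function.comp_apply, hno, implies_true, and_self])
  have h1 := hk2 y
  rw [← h, hk1] at h1
  simp at h1

open Classical in
/-- If the pieces meet in `U` and `W` only, which are joined by the pivot, then exchanging `U` and
`W` in one of the pieces is a sequence of flips. -/
theorem exists_flips_of_swap [Finite V] (hl : Graph.NoLoops ends)
    (hconn : ∀ x y, Relation.ReflTransGen (Graph.ofEnds ends).Adj x y)
    (hp : IsPushout (RightCompat hor) t r a b) (hc : IsComposed ends g dX dY a b) {U W : V}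
    (hU : a (t 0) = U) (hpiv : ends (g.symm .pivot) = s(U, W))
    (hint : ∀ x y, a x = b y → a x = U ∨ a x = W)
    (hpush : IsPushout (LeftCompat hor) t r (Equiv.swap U W ∘ a) b) :
    ∃ (ends' : E → Sym2 V) (a' : X → V) (b' : Y → V),
      Relation.ReflTransGen Graph.WhitneyFlip (Graph.ofEnds ends) (Graph.ofEnds ends') ∧
      IsPushout (LeftCompat hor) t r a' b' ∧ IsComposed ends' g dX dY a' b' ∧
      ends' (g.symm .pivot) = s(b' (r 0), a' (t 0)) := by
  have hUW : U ≠ W := by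
    rintro rfl
    exact hl _ _ hpiv
  have hbr : b (r 0) = U := hp.compat.1.symm.trans hU
  let KT : Set V := {v | (∃ x, a x = v) ∧ v ≠ U ∧ v ≠ W}
  let KR : Set V := {v | (∃ y, b y = v) ∧ v ≠ U ∧ v ≠ W}
  have hdisj : ∀ v, v ∈ KT → (∃ y, b y = v) → False := by
    rintro v ⟨⟨x, rfl⟩, h1, h2⟩ ⟨y, hy⟩
    rcases hint x y hy.symm with h | h
    exacts [h1 h, h2 h]
  have hcases : ∀ e : E, (∃ c, e = g.symm (.tangle c)) ∨ (∃ c, e = g.symm (.rest c)) ∨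
      e = g.symm .pivot := by
    intro e
    obtain ⟨c, rfl⟩ := g.symm.surjective e
    rcases c with c | c | _
    exacts [Or.inl ⟨c, rfl⟩, Or.inr (Or.inl ⟨c, rfl⟩), Or.inr (Or.inr rfl)]
  have hpiv' : ∀ x y, ends (g.symm .pivot) = s(x, y) → x = U ∨ x = W := by
    intro x y h
    rw [hpiv, Sym2.eq_iff] at h
    rcases h with ⟨rfl, rfl⟩ | ⟨rfl, rfl⟩
    exacts [Or.inl rfl, Or.inr rfl]
  obtain ⟨ends', hflips, hends'⟩ := Graph.flips_swapOn (K := KT) (K' := KR) hl hconn hUW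
    ⟨_, (by rw [Graph.ofEnds]; exact hpiv)⟩ (fun h => h.2.1 rfl) (fun h => h.2.2 rfl)
    (fun h => h.2.1 rfl) (fun h => h.2.2 rfl)
    (by
      intro e x y he hx
      rcases hcases e with ⟨c, rfl⟩ | ⟨c, rfl⟩ | rfl
      · by_cases hy : y = U ∨ y = W
        · exact Or.inr hy
        · push Not at hy
          exact Or.inl ⟨hc.exists_left (he.trans Sym2.eq_swap), hy⟩
      · exact (hdisj x hx (hc.exists_right he)).elim
      · rcases hpiv' x y he with h | h
        exacts [(hx.2.1 h).elim, (hx.2.2 h).elim])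
    (by
      intro e x y he hx
      rcases hcases e with ⟨c, rfl⟩ | ⟨c, rfl⟩ | rfl
      · exact (hdisj x ⟨hc.exists_left he, hx.2⟩ hx.1).elim
      · by_cases hy : y = U ∨ y = W
        · exact Or.inr hy
        · push Not at hy
          exact Or.inl ⟨hc.exists_right (he.trans Sym2.eq_swap), hy⟩
      · rcases hpiv' x y he with h | h
        exacts [(hx.2.1 h).elim, (hx.2.2 h).elim])
    (by
      intro v
      by_cases hU : v = U
      · exact Or.inr (Or.inr (Or.inl hU))
      by_cases hW : v = W
      · exact Or.inr (Or.inr (Or.inr hW))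
      rcases hp.surj v with h | h
      exacts [Or.inl ⟨h, hU, hW⟩, Or.inr (Or.inl ⟨h, hU, hW⟩)])
    (Set.disjoint_left.2 fun v h1 h2 => hdisj v h1 h2.1)
  -- The flips exchange `U` and `W` at the edges of the first piece, except at those which join `U`
  -- and `W`, where this makes no difference.
  have hswap : IsComposed (Graph.swapOn (Graph.touch ends KT) U W ends) g dX dY
      (Equiv.swap U W ∘ a) b := by
    constructor
    · intro c
      rw [← Sym2.map_map, ← hc.tangle]
      by_cases hmem : g.symm (.tangle c) ∈ Graph.touch ends KT
      · rw [Graph.swapOn_of_mem hmem]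
      · rw [Graph.swapOn_of_notMem hmem]
        obtain ⟨x, y, he⟩ := Graph.exists_ends ends (g.symm (.tangle c))
        rw [Graph.mem_touch_iff he] at hmem
        push Not at hmem
        have hx : x = U ∨ x = W := by
          by_contra h
          push Not at h
          exact hmem.1 ⟨hc.exists_left he, h⟩
        have hy : y = U ∨ y = W := by
          by_contra h
          push Not at h
          exact hmem.2 ⟨hc.exists_left (he.trans Sym2.eq_swap), h⟩
        have hxy : x ≠ y := by
          rintro rfl
          exact hl _ _ he
        rw [he, Sym2.map_mk]
        rcases hx with rfl | rfl <;> rcases hy with rfl | rfl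
        · exact (hxy rfl).elim
        · rw [Equiv.swap_apply_left, Equiv.swap_apply_right, Sym2.eq_swap]
        · rw [Equiv.swap_apply_left, Equiv.swap_apply_right, Sym2.eq_swap]
        · exact (hxy rfl).elim
    · intro c
      rw [Graph.swapOn_of_notMem, hc.rest]
      intro hmem
      obtain ⟨x, y, he⟩ := Graph.exists_ends ends (g.symm (.rest c))
      rcases (Graph.mem_touch_iff he).1 hmem with h | h
      · exact hdisj x h (hc.exists_right he)
      · exact hdisj y h (hc.exists_right (he.trans Sym2.eq_swap))
  have hswap' : Graph.swapOn (Graph.touch ends KT) U W ends (g.symm .pivot) =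
      s(b (r 0), (Equiv.swap U W ∘ a) (t 0)) := by
    rw [Graph.swapOn_of_notMem, hpiv, Function.comp_apply, hU, hbr, Equiv.swap_apply_left]
    intro hmem
    rcases (Graph.mem_touch_iff hpiv).1 hmem with h | h
    exacts [h.2.1 rfl, h.2.2 rfl]
  rcases hends' with rfl | rfl
  · exact ⟨_, _, _, hflips, hpush, hswap, hswap'⟩
  · refine ⟨_, Equiv.swap U W ∘ Equiv.swap U W ∘ a, Equiv.swap U W ∘ b, hflips, ?_, ?_, ?_⟩
    · exact hpush.comp_equiv (Equiv.swap U W) (hpush.compat.map (Equiv.swap U W))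
    · constructor
      · intro c
        rw [hswap.tangle, Sym2.map_map]
      · intro c
        rw [hswap.rest, Sym2.map_map]
    · rw [hswap']
      rfl

open Classical in
/-- If all arcs are vertical, then the two pieces share only the Seifert circle `A` through the
ends `0` and `1`, and the pivot joins the circle `B` through the ends `2` and `3` of the tangle to
the circle `C` through those of the rest. After the flype `B` and `C` are one circle, which keeps
the name `C`, while the circle `A` of the tangle is a circle of its own, which is named `B`. This is
a Type C flip. -/
theorem exists_flips_of_rotate (hl : Graph.NoLoops ends)
    (hconn : ∀ x y, Relation.ReflTransGen ((Graph.ofEnds ends).deleteEdges {g.symm .pivot}).Adj x y)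
    (hp : IsPushout (RightCompat hor) t r a b) (hc : IsComposed ends g dX dY a b)
    (hpiv : ends (g.symm .pivot) = s(a (t 3), b (r 2))) (hver : ¬ hor)
    (ht01 : t 0 = t 1) (ht23 : t 2 = t 3) (hr01 : r 0 = r 1) (hr23 : r 2 = r 3)
    (ht02 : t 0 ≠ t 2) (hr02 : r 0 ≠ r 2) :
    ∃ (ends' : E → Sym2 V) (a' : X → V) (b' : Y → V),
      Relation.ReflTransGen Graph.WhitneyFlip (Graph.ofEnds ends) (Graph.ofEnds ends') ∧
      IsPushout (LeftCompat hor) t r a' b' ∧ IsComposed ends' g dX dY a' b' ∧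
      ends' (g.symm .pivot) = s(b' (r 0), a' (t 0)) := by
  obtain ⟨A, hA⟩ : ∃ A, A = a (t 0) := ⟨_, rfl⟩
  obtain ⟨B, hB⟩ : ∃ B, B = a (t 2) := ⟨_, rfl⟩
  obtain ⟨C, hC⟩ : ∃ C, C = b (r 2) := ⟨_, rfl⟩
  have hA' : A = b (r 0) := hA.trans hp.compat.1
  -- Being the marked point `t 0` or `r 0` descends to the whole graph, hence the preimages of `A`
  -- are only these two points.
  have kerA : ∀ x, a x = A → x = t 0 := by
    obtain ⟨k, hk1, hk2⟩ := hp.desc (fun x => x = t 0) (fun y => y = r 0) (by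
      refine ⟨by simp, by simp [ht01, hr01], fun h => (hver h).elim, fun _ => ⟨?_, ?_⟩⟩
      · simp only [Function.comp_apply, ht23]
      · simp only [Function.comp_apply, hr23])
    intro x hx
    rw [← hk1, hx, hA, hk1]
  have kerA' : ∀ y, b y = A → y = r 0 := by
    obtain ⟨k, hk1, hk2⟩ := hp.desc (fun x => x = t 0) (fun y => y = r 0) (by
      refine ⟨by simp, by simp [ht01, hr01], fun h => (hver h).elim, fun _ => ⟨?_, ?_⟩⟩
      · simp only [Function.comp_apply, ht23]
      · simp only [Function.comp_apply, hr23])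
    intro x hx
    rw [← hk2, hx, hA', hk2]
  obtain ⟨k, hk1, hk2⟩ := hp.desc (fun x => x = t 2) (fun _ => False) (by
    refine ⟨by simp [ht02], by simp [← ht01, ht02], fun h => (hver h).elim, fun _ => ⟨?_, rfl⟩⟩
    simp only [Function.comp_apply, ht23])
  have kerB : ∀ x, a x = B → x = t 2 := by
    intro x hx
    rw [← hk1, hx, hB, hk1]
  have kerB' : ∀ y, b y ≠ B := by
    intro y hy
    rw [← hk2 y, hy, hB, hk1]
  have hint : ∀ x y, a x = b y → a x = A := by
    intro x y hxy
    obtain ⟨i, hi⟩ := hp.exists_marked_left hxy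
    have h4 : ∀ i, t i = t 0 ∨ t i = t 2 := by
      rw [Fin.forall_four]
      exact ⟨Or.inl rfl, Or.inl ht01.symm, Or.inr rfl, Or.inr ht23.symm⟩
    rcases h4 i with h | h
    · rw [hi, h, hA]
    · rw [h, ← hB, hxy] at hi
      exact (kerB' y hi).elim
  have hAB : A ≠ B := fun h => ht02 (kerB _ (hA.symm.trans h))
  have hAC : A ≠ C := fun h => hr02 (kerA' _ (hC.symm.trans h.symm)).symm
  have hBC : B ≠ C := fun h => kerB' _ (hC.symm.trans h.symm)
  let τ : V → V := fun x => if x = B then C else if x = A then B else x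
  have τB : τ B = C := if_pos rfl
  have τA : τ A = B := (if_neg hAB).trans (if_pos rfl)
  have τn : ∀ x, x ≠ B → x ≠ A → τ x = x := fun x h1 h2 => (if_neg h1).trans (if_neg h2)
  let KT : Set V := {v | (∃ x, a x = v) ∧ v ≠ A ∧ v ≠ B}
  have hKT : ∀ v, v ∈ insert B KT ↔ (∃ x, a x = v) ∧ v ≠ A := by
    intro v
    constructor
    · rintro (rfl | h)
      · exact ⟨⟨_, hB.symm⟩, hAB.symm⟩
      · exact ⟨h.1, h.2.1⟩
    · rintro ⟨h1, h2⟩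
      by_cases h : v = B
      · exact Or.inl h
      · exact Or.inr ⟨h1, h2, h⟩
  have hdisj : ∀ v, v ∈ insert B KT → (∃ y, b y = v) → False := by
    rintro v hv ⟨y, rfl⟩
    obtain ⟨⟨x, hx⟩, h⟩ := (hKT _).1 hv
    exact h (hx.symm.trans (hint x y hx))
  let ends' : E → Sym2 V := fun e => match g e with
    | .tangle c => (dX c).map (τ ∘ a)
    | .rest c => (dY c).map b
    | .pivot => s(B, A)
  have hT : ∀ c, ends' (g.symm (.tangle c)) = (dX c).map (τ ∘ a) := by
    intro c
    simp only [ends', Equiv.apply_symm_apply]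
  have hR : ∀ c, ends' (g.symm (.rest c)) = (dY c).map b := by
    intro c
    simp only [ends', Equiv.apply_symm_apply]
  have hP : ends' (g.symm .pivot) = s(B, A) := by
    simp only [ends', Equiv.apply_symm_apply]
  have hcases : ∀ e : E, e ≠ g.symm .pivot → (∃ c, e = g.symm (.tangle c)) ∨
      ∃ c, e = g.symm (.rest c) := by
    intro e he
    obtain ⟨c, rfl⟩ := g.symm.surjective e
    rcases c with c | c | _
    exacts [Or.inl ⟨c, rfl⟩, Or.inr ⟨c, rfl⟩, (he rfl).elim]
  have hflip : (Graph.ofEnds ends).FlipC (Graph.ofEnds ends') := by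
    refine Graph.flipC_of_not_bridge (K := KT) (e₀ := g.symm .pivot) hl hconn hAB hAC hBC
      (fun h => h.2.1 rfl) (fun h => ?_) ?_ ?_ ?_ hP ?_
    · exact hdisj C (Or.inr h) ⟨_, hC.symm⟩
    · rw [hpiv, ← ht23, ← hB, ← hC]
    · intro e x y he hxy hx
      rcases hcases e he with ⟨c, rfl⟩ | ⟨c, rfl⟩
      · by_cases hy : y = A
        · exact Or.inr hy
        · exact Or.inl ((hKT y).2 ⟨hc.exists_left (hxy.trans Sym2.eq_swap), hy⟩)
      · exact (hdisj x hx (hc.exists_right hxy)).elim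
    · intro e he hmem
      rcases hcases e he with ⟨c, rfl⟩ | ⟨c, rfl⟩
      · rw [hT, hc.tangle, Sym2.map_map]
      · obtain ⟨x, y, hxy⟩ := Graph.exists_ends ends (g.symm (.rest c))
        rcases (Graph.mem_touch_iff hxy).1 hmem with h | h
        · exact (hdisj x h (hc.exists_right hxy)).elim
        · exact (hdisj y h (hc.exists_right (hxy.trans Sym2.eq_swap))).elim
    · intro e he hmem
      rcases hcases e he with ⟨c, rfl⟩ | ⟨c, rfl⟩
      · -- Such an edge would be a loop at `A`.
        obtain ⟨x, y, hxy⟩ := Graph.exists_ends ends (g.symm (.tangle c))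
        rw [Graph.mem_touch_iff hxy, hKT, hKT] at hmem
        have hx : x = A := by
          by_contra h
          exact hmem (Or.inl ⟨hc.exists_left hxy, h⟩)
        have hy : y = A := by
          by_contra h
          exact hmem (Or.inr ⟨hc.exists_left (hxy.trans Sym2.eq_swap), h⟩)
        rw [hx, hy] at hxy
        exact (hl _ _ hxy).elim
      · rw [hR, hc.rest]
  refine ⟨ends', τ ∘ a, b, Relation.ReflTransGen.single (Or.inr (Or.inr hflip)), ⟨?_, ?_, ?_⟩,
    ⟨hT, hR⟩, ?_⟩
  · have h : τ (a (t 2)) = b (r 2) := by rw [← hB, τB, hC]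
    refine ⟨?_, ?_, fun h => (hver h).elim, fun _ => ⟨?_, ?_⟩⟩
    · simpa only [Function.comp_apply, ← ht23] using h
    · simpa only [Function.comp_apply, ← hr23] using h
    · simp only [Function.comp_apply, ← ht01]
    · simp only [Function.comp_apply, ← hr01]
  · intro v
    rcases hp.surj v with ⟨x, rfl⟩ | h
    · by_cases h1 : a x = B
      · exact Or.inl ⟨t 0, by rw [Function.comp_apply, ← hA, τA, h1]⟩
      by_cases h2 : a x = A
      · exact Or.inr ⟨r 0, by rw [h2, hA']⟩
      · exact Or.inl ⟨x, τn _ h1 h2⟩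
    · exact Or.inr h
  · rintro γ η ⟨h1, h2, -, h3⟩
    obtain ⟨h3, h4⟩ := h3 hver
    simp only [Function.comp_apply] at h1 h2 h3 h4
    obtain ⟨k, hk1, hk2⟩ := hp.desc
      (fun x => if x = t 0 then η (r 0) else if x = t 2 then γ (t 0) else γ x) η (by
        refine ⟨by simp, by simp [← ht01, hr01], fun h => (hver h).elim, fun _ => ⟨?_, ?_⟩⟩
        · simp only [Function.comp_apply, ht23]
        · simp only [Function.comp_apply, hr23])
    refine ⟨k, fun x => ?_, hk2⟩
    rw [Function.comp_apply]
    by_cases hxB : a x = B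
    · rw [hxB, τB, hC, hk2, kerB x hxB, ← h1, ht23]
    by_cases hxA : a x = A
    · rw [hxA, τA, hB, hk1, if_neg ht02.symm, if_pos rfl, kerA x hxA]
    · rw [τn _ hxB hxA, hk1, if_neg, if_neg]
      · rintro rfl
        exact hxB hB.symm
      · rintro rfl
        exact hxA hA.symm
  · rw [hP, ← hA', Function.comp_apply, ← hA, τA, Sym2.eq_swap]

open Classical in
/-- A flype changes the Seifert graph by Whitney flips. The hypotheses `ht` and `hr` say that the
Seifert arcs of the tangle, and those of the rest, are either two horizontal or two vertical arcs;
`hconn` says that the further crossing is not a bridge of the Seifert graph. -/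
theorem exists_flips [Finite V] (hl : Graph.NoLoops ends)
    (hconn : ∀ x y, Relation.ReflTransGen ((Graph.ofEnds ends).deleteEdges {g.symm .pivot}).Adj x y)
    (hp : IsPushout (RightCompat hor) t r a b) (hc : IsComposed ends g dX dY a b)
    (hpiv : ends (g.symm .pivot) = s(a (t 3), b (r 2)))
    (hht : hor → t 0 = t 3 ∧ t 1 = t 2) (hhr : hor → r 0 = r 3 ∧ r 1 = r 2)
    (ht : (t 0 = t 3 ∧ t 1 = t 2) ∨ (t 0 = t 1 ∧ t 2 = t 3))
    (hr : (r 0 = r 3 ∧ r 1 = r 2) ∨ (r 0 = r 1 ∧ r 2 = r 3)) :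
    ∃ (ends' : E → Sym2 V) (a' : X → V) (b' : Y → V),
      Relation.ReflTransGen Graph.WhitneyFlip (Graph.ofEnds ends) (Graph.ofEnds ends') ∧
      IsPushout (LeftCompat hor) t r a' b' ∧ IsComposed ends' g dX dY a' b' ∧
      ends' (g.symm .pivot) = s(b' (r 0), a' (t 0)) := by
  have hconn' : ∀ x y, Relation.ReflTransGen (Graph.ofEnds ends).Adj x y := fun x y =>
    Relation.ReflTransGen.mono (r := ((Graph.ofEnds ends).deleteEdges {g.symm .pivot}).Adj)
      (p := (Graph.ofEnds ends).Adj) (fun _ _ ⟨e, he⟩ => ⟨e, he.1⟩) x y (hconn x y)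
  obtain ⟨c0, c1, c2, c3⟩ := hp.compat
  simp only [Function.comp_apply] at c0 c1 c2 c3
  have hne : a (t 3) ≠ b (r 2) := fun h => hl _ _ (hpiv.trans (by rw [h]))
  by_cases hhor : hor
  · -- The ends `0`, `3` lie on the Seifert circle `a (t 0)`, the ends `1`, `2` on `a (t 1)`, for
    -- the tangle and for the rest.
    obtain ⟨ht03, ht12⟩ := hht hhor
    obtain ⟨hr03, hr12⟩ := hhr hhor
    obtain ⟨c2, c3'⟩ := c2 hhor
    have hUW : a (t 0) ≠ a (t 1) := by rwa [ht03, ht12, c2]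
    have hr01 : b (r 0) ≠ b (r 1) := by rwa [← c0, ← c1]
    have ker0 : ∀ x, a x = a (t 0) → x = t 0 := by
      obtain ⟨k, hk1, hk2⟩ := hp.desc (fun x => x = t 0) (fun y => y = r 0) (by
        have e1 : ¬ t 1 = t 0 := fun h => hUW (by rw [h])
        have e2 : ¬ r 1 = r 0 := fun h => hr01 (by rw [h])
        refine ⟨by simp, by simp [e1, e2], fun _ => ⟨?_, ?_⟩, fun h => (h hhor).elim⟩
        · simp [← ht12, ← hr12, e1, e2]
        · simp [← ht03, ← hr03])
      intro x hx
      rw [← hk1, hx, hk1]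
    have ker1 : ∀ x, a x = a (t 1) → x = t 1 := by
      obtain ⟨k, hk1, hk2⟩ := hp.desc (fun x => x = t 1) (fun y => y = r 1) (by
        have e1 : ¬ t 0 = t 1 := fun h => hUW (by rw [h])
        have e2 : ¬ r 0 = r 1 := fun h => hr01 (by rw [h])
        refine ⟨by simp [e1, e2], by simp, fun _ => ⟨?_, ?_⟩, fun h => (h hhor).elim⟩
        · simp [← ht12, ← hr12]
        · simp [← ht03, ← hr03, e1, e2])
      intro x hx
      rw [← hk1, hx, hk1]
    refine exists_flips_of_swap (W := a (t 1)) hl hconn' hp hc rfl ?_ ?_ ⟨?_, ?_, ?_⟩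
    · rw [hpiv, ← ht03, ← hr12, c1]
    · intro x y hxy
      obtain ⟨i, hi⟩ := hp.exists_marked_left hxy
      have h4 : ∀ i, a (t i) = a (t 0) ∨ a (t i) = a (t 1) := by
        rw [Fin.forall_four]
        exact ⟨Or.inl rfl, Or.inr rfl, Or.inr (by rw [ht12]), Or.inl (by rw [ht03])⟩
      rcases h4 i with h | h
      exacts [Or.inl (hi.trans h), Or.inr (hi.trans h)]
    · refine ⟨?_, ?_, fun _ => ⟨?_, ?_⟩, fun h => (h hhor).elim⟩
      · simp [← ht03, ← hr12, c1]
      · simp [← ht12, ← hr03, c0]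
      · simp [c0]
      · simp [c1]
    · intro v
      rcases hp.surj v with ⟨x, rfl⟩ | h
      · by_cases h0 : a x = a (t 0)
        · exact Or.inr ⟨r 0, by rw [h0, c0]⟩
        by_cases h1 : a x = a (t 1)
        · exact Or.inr ⟨r 1, by rw [h1, c1]⟩
        exact Or.inl ⟨x, Equiv.swap_apply_of_ne_of_ne h0 h1⟩
      · exact Or.inr h
    · -- Functions that fit together after the flype fit together before it, once the values at the
      -- two circles through the ends of the tangle are exchanged.
      rintro γ η ⟨-, -, h3, -⟩
      obtain ⟨h3, h4⟩ := h3 hhor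
      simp only [Function.comp_apply] at h3 h4
      obtain ⟨k, hk1, hk2⟩ := hp.desc
        (fun x => if x = t 0 then η (r 0) else if x = t 1 then η (r 1) else γ x) η (by
          have e1 : ¬ t 1 = t 0 := fun h => hUW (by rw [h])
          refine ⟨by simp, by simp [e1], fun _ => ⟨?_, ?_⟩, fun h => (h hhor).elim⟩
          · simp [← ht12, ← hr12, e1]
          · simp [← ht03, ← hr03])
      refine ⟨k, fun x => ?_, hk2⟩
      rw [Function.comp_apply]
      by_cases h0 : a x = a (t 0)
      · rw [h0, Equiv.swap_apply_left, c1, hk2, ker0 x h0, h4]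
      by_cases h1 : a x = a (t 1)
      · rw [h1, Equiv.swap_apply_right, c0, hk2, ker1 x h1, h3]
      · rw [Equiv.swap_apply_of_ne_of_ne h0 h1, hk1, if_neg, if_neg]
        · rintro rfl
          exact h1 rfl
        · rintro rfl
          exact h0 rfl
  obtain ⟨c2, c3⟩ := c3 hhor
  by_cases hT : t 0 = t 3 ∧ t 1 = t 2
  · -- All ends of the tangle lie on the Seifert circle `a (t 0)`.
    obtain ⟨ht03, ht12⟩ := hT
    have e1 : a (t 1) = a (t 0) := by rw [ht12, c2, ht03]
    have e2 : a (t 2) = a (t 0) := by rw [c2, ht03]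
    have e3 : a (t 3) = a (t 0) := by rw [ht03]
    have hUW : a (t 0) ≠ b (r 2) := by rwa [ht03]
    have hint : ∀ x y, a x = b y → a x = a (t 0) := by
      intro x y hxy
      obtain ⟨i, hi⟩ := hp.exists_marked_left hxy
      have h4 : ∀ i, a (t i) = a (t 0) := by
        rw [Fin.forall_four]
        exact ⟨rfl, e1, e2, e3⟩
      exact hi.trans (h4 i)
    have ker : ∀ x, a x = a (t 0) → x = t 0 ∨ x = t 1 := by
      obtain ⟨k, hk1, hk2⟩ := hp.desc (fun x => x = t 0 ∨ x = t 1) (fun y => b y = a (t 0)) (by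
        refine ⟨by simp [c0], by simp [← c1, e1], fun h => (hhor h).elim, fun _ => ⟨?_, ?_⟩⟩
        · simp [← ht03, ← ht12]
        · simp [c3])
      intro x hx
      rw [← hk1, hx, hk1]
      exact Or.inl rfl
    refine exists_flips_of_swap (W := b (r 2)) hl hconn' hp hc rfl ?_ ?_ ⟨?_, ?_, ?_⟩
    · rw [hpiv, ← ht03]
    · exact fun x y hxy => Or.inl (hint x y hxy)
    · refine ⟨?_, ?_, fun h => (hhor h).elim, fun _ => ⟨?_, ?_⟩⟩
      · simp [e3]
      · simp [e2, c3]
      · simp [e1]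
      · simp [← c0, ← c1, e1]
    · intro v
      rcases hp.surj v with ⟨x, rfl⟩ | h
      · by_cases h0 : a x = a (t 0)
        · exact Or.inr ⟨r 0, by rw [h0, c0]⟩
        by_cases h1 : a x = b (r 2)
        · exact Or.inr ⟨r 2, h1.symm⟩
        exact Or.inl ⟨x, Equiv.swap_apply_of_ne_of_ne h0 h1⟩
      · exact Or.inr h
    · rintro γ η ⟨h1, h2, -, h3⟩
      obtain ⟨h3, h4⟩ := h3 hhor
      simp only [Function.comp_apply] at h1 h2 h3 h4
      have h23 : η (r 2) = η (r 3) := by rw [← h1, ← h2, ← ht03, ← ht12, h3]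
      obtain ⟨k, hk1, hk2⟩ := hp.desc (fun x => if x = t 0 ∨ x = t 1 then η (r 0) else γ x) η (by
        refine ⟨by simp, by simp [h4], fun h => (hhor h).elim, fun _ => ⟨?_, ?_⟩⟩
        · simp [← ht03, ← ht12]
        · simp [h23])
      refine ⟨k, fun x => ?_, hk2⟩
      rw [Function.comp_apply]
      by_cases h0 : a x = a (t 0)
      · rw [h0, Equiv.swap_apply_left, hk2, ← h1, ← ht03]
        rcases ker x h0 with rfl | rfl
        · rfl
        · exact h3
      by_cases h1 : a x = b (r 2)
      · exact (h0 (hint _ _ h1)).elim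
      · rw [Equiv.swap_apply_of_ne_of_ne h0 h1, hk1, if_neg]
        rintro (rfl | rfl)
        exacts [h0 rfl, h0 e1]
  by_cases hR : r 0 = r 3 ∧ r 1 = r 2
  · -- All ends of the rest lie on the Seifert circle `b (r 0)`.
    obtain ⟨hr03, hr12⟩ := hR
    have e1 : b (r 1) = b (r 0) := by rw [hr12, c3, hr03]
    have e2 : b (r 2) = b (r 0) := by rw [c3, hr03]
    have e3 : b (r 3) = b (r 0) := by rw [hr03]
    have hUW : a (t 0) ≠ a (t 2) := by rw [c0, c2, ← e2]; exact hne.symm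
    have f1 : a (t 1) = a (t 0) := by rw [c1, c0, e1]
    have hint : ∀ x y, a x = b y → b y = a (t 0) := by
      intro x y hxy
      obtain ⟨i, hi⟩ := hp.exists_marked_right hxy
      have h4 : ∀ i, b (r i) = a (t 0) := by
        rw [Fin.forall_four, c0]
        exact ⟨rfl, e1, e2, e3⟩
      exact hi.trans (h4 i)
    have ker : ∀ y, b y = a (t 0) → y = r 0 ∨ y = r 1 := by
      obtain ⟨k, hk1, hk2⟩ := hp.desc (fun x => a x = a (t 0)) (fun y => y = r 0 ∨ y = r 1) (by
        refine ⟨by simp, by simp [f1], fun h => (hhor h).elim, fun _ => ⟨?_, ?_⟩⟩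
        · simp [c2]
        · simp [← hr03, ← hr12])
      intro x hx
      rw [← hk2, hx, hk1]
    refine exists_flips_of_swap (W := a (t 2)) hl hconn' hp hc rfl ?_ ?_ ⟨?_, ?_, ?_⟩
    · rw [hpiv, e2, ← c0, ← c2, Sym2.eq_swap]
    · exact fun x y hxy => Or.inl (hxy.trans (hint x y hxy))
    · refine ⟨?_, ?_, fun h => (hhor h).elim, fun _ => ⟨?_, ?_⟩⟩
      · simp [← c2, c0, e2]
      · simp [c0, e3]
      · simp [f1]
      · simp [e1]
    · intro v
      rcases hp.surj v with ⟨x, rfl⟩ | h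
      · by_cases h0 : a x = a (t 0)
        · exact Or.inr ⟨r 0, by rw [h0, c0]⟩
        by_cases h1 : a x = a (t 2)
        · exact Or.inl ⟨t 0, by simp [h1]⟩
        exact Or.inl ⟨x, Equiv.swap_apply_of_ne_of_ne h0 h1⟩
      · exact Or.inr h
    · rintro γ η ⟨h1, h2, -, h3⟩
      obtain ⟨h3, h4⟩ := h3 hhor
      simp only [Function.comp_apply] at h1 h2 h3 h4
      have h23 : γ (t 2) = γ (t 3) := by rw [h1, h2, ← hr03, ← hr12, h4]
      obtain ⟨k, hk1, hk2⟩ := hp.desc γ (fun y => if y = r 0 ∨ y = r 1 then γ (t 0) else η y) (by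
        refine ⟨by simp, by simp [h3], fun h => (hhor h).elim, fun _ => ⟨?_, ?_⟩⟩
        · simp [h23]
        · simp [← hr03, ← hr12])
      refine ⟨k ∘ Equiv.swap (a (t 0)) (a (t 2)), fun x => ?_, fun y => ?_⟩
      · simp [hk1]
      rw [Function.comp_apply]
      by_cases h0 : b y = a (t 0)
      · rw [h0, Equiv.swap_apply_left, hk1, h2, ← hr03]
        rcases ker y h0 with rfl | rfl
        · rfl
        · exact h4
      by_cases h1 : b y = a (t 2)
      · exact (h0 (hint _ _ h1.symm)).elim
      · rw [Equiv.swap_apply_of_ne_of_ne h0 h1, hk2, if_neg]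
        rintro (rfl | rfl)
        exacts [h0 c0.symm, h0 (e1.trans c0.symm)]
  · obtain ⟨ht01, ht23⟩ := ht.resolve_left hT
    obtain ⟨hr01, hr23⟩ := hr.resolve_left hR
    refine exists_flips_of_rotate hl hconn hp hc hpiv hhor ht01 ht23 hr01 hr23 ?_ ?_
    · exact fun h => hT ⟨h.trans ht23, ht01.symm.trans h⟩
    · exact fun h => hR ⟨h.trans hr23, hr01.symm.trans h⟩

end

section

variable {T R : TangleData} {o : Fin 4 → Bool}

/-- If the diagram with the further crossing to the right of the tangle is reduced, then a sequence
of Whitney flips leads from its Seifert graph to that of the diagram after the flype. -/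
theorem exists_flips_presents_left {V E : Type} {ends : E → Sym2 V} (hT : T.IsTangle)
    (hR : R.IsTangle) (hD : (glue T R o wireRight).IsDiagram)
    (hred : (glue T R o wireRight).IsReduced)
    (h : DiagramData.Presents ends (glue T R o wireRight)) :
    ∃ ends' : E → Sym2 V,
      Relation.ReflTransGen Graph.WhitneyFlip (Graph.ofEnds ends) (Graph.ofEnds ends') ∧
      DiagramData.Presents ends' (glue T.turn R o wireLeft) := by
  have := h.finite hD
  have hl := h.noLoops hD
  obtain ⟨f, g, h⟩ := h
  have hconn := DiagramData.joined_deleteEdges h hD (e₀ := g.symm .pivot) (hred _)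
  obtain ⟨a, b, hp, h1, h2, h3⟩ := exists_pushout_of_presents (g := g) hD h
  obtain ⟨e2, e3, -, -⟩ := out_of_isDiagram_right hD
  obtain ⟨t1, -, t3, -, -⟩ := hT.arcs
  obtain ⟨r1, r2, -, -, -⟩ := hR.arcs
  obtain ⟨ends', a', b', hflips, hp', hc', hpiv'⟩ :=
    exists_flips (dX := T.arcEnds) (dY := R.arcEnds) (g := g) hl hconn hp ⟨h1, h2⟩ h3
      (fun hor => ⟨(t3 hor).1, (t3 hor).2.symm⟩)
      (fun hor => r2 (by rw [e2, e3, hor]))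
      (t1.imp (fun h => ⟨h.1, h.2.symm⟩) (fun h => ⟨h.1, h.2.symm⟩))
      (r1.symm)
  exact ⟨ends', hflips, presents_left_of_pushout hT hD g hp' hc'.tangle hc'.rest hpiv'⟩

end

/-! ### Flypes and nugatory crossings -/

/-- A two-colouring of the darts of a tangle that is constant along edges, at points, and at each
crossing outside of `S`. Its values at the ends of the tangle are arbitrary. -/
structure TangleData.IsColouring (T : TangleData) (S : Set T.Y)
    (φ : Dart (Option T.Y) T.P → ZMod 2) : Prop where
  edge : ∀ x, φ (T.edge x) = φ x
  crossing : ∀ c ∉ S, ∀ i, φ (.cr (some c) i) = φ (.cr (some c) 0)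
  point : ∀ p, φ (.pt p true) = φ (.pt p false)

section

variable {T R : TangleData} {o : Fin 4 → Bool} {wire : Socket → Socket}

/-- If a two-colouring is constant at all crossings, then it takes both values at an even number of
ends. -/
theorem TangleData.IsColouring.sum_ends {φ : Dart (Option T.Y) T.P → ZMod 2}
    (h : T.IsColouring ∅ φ) (hT : T.IsTangle) :
    φ (.cr none 0) + φ (.cr none 1) + φ (.cr none 2) + φ (.cr none 3) = 0 := by
  refine hT.sum_boundary φ (fun x => ?_) (fun c => ?_) (fun p => ?_)
  · rw [h.edge, CharTwo.add_self_eq_zero]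
  · rw [h.crossing c (Set.notMem_empty c) 1, h.crossing c (Set.notMem_empty c) 2,
      h.crossing c (Set.notMem_empty c) 3, CharTwo.add_self_eq_zero, zero_add,
      CharTwo.add_self_eq_zero]
  · rw [h.point, CharTwo.add_self_eq_zero]

theorem TangleData.IsColouring.of_turn {S : Set T.Y}
    {φ : Dart (Option T.turn.Y) T.turn.P → ZMod 2} (h : T.turn.IsColouring S φ) :
    T.IsColouring S fun x => φ (halfTurn (Y := T.Y) (P := T.P) x) where
  edge x := by
    have := h.edge (halfTurn (Y := T.Y) (P := T.P) x)
    change φ (halfTurn (T.edge (halfTurn (halfTurn x)))) = _ at this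
    rwa [halfTurn_halfTurn] at this
  crossing c hc i := (h.crossing c hc (-i)).trans (h.crossing c hc (-0)).symm
  point p := h.point p

theorem TangleData.IsColouring.add_const {S : Set T.Y}
    {φ : Dart (Option T.Y) T.P → ZMod 2} (h : T.IsColouring S φ) (z : ZMod 2) :
    T.IsColouring S fun x => φ x + z where
  edge x := by rw [h.edge]
  crossing c hc i := by rw [h.crossing c hc]
  point p := by rw [h.point]

/-- A nugatory crossing of a composed diagram gives two-colourings of its parts which fit together
and are not constant altogether. -/
theorem exists_colouring_of_isNugatory (hD : (glue T R o wire).IsDiagram)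
    {c : GlueCrossing T.Y R.Y} (hc : (glue T R o wire).IsNugatory c) :
    ∃ (φ : Dart (Option T.Y) T.P → ZMod 2) (ψ : Dart (Option R.Y) R.P → ZMod 2)
      (p : Fin 4 → ZMod 2), T.IsColouring {d | .tangle d = c} φ ∧
      R.IsColouring {d | .rest d = c} ψ ∧
      (∀ s, socketVal (fun k => φ (.cr none (-k))) (fun k => ψ (.cr none k)) p (wire s) =
        socketVal (fun k => φ (.cr none (-k))) (fun k => ψ (.cr none k)) p s) ∧
      (c ≠ .pivot → ∀ i, p i = p 0) ∧
      ¬ ∃ z, (∀ x, φ x = z) ∧ (∀ y, ψ y = z) ∧ ∀ i, p i = z := by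
  classical
  obtain ⟨A, ⟨x₀, hx₀⟩, hAuniv, hAe, hAc, hAp⟩ := hc
  let f : Dart (glue T R o wire).X (glue T R o wire).P → ZMod 2 := fun x => if x ∈ A then 1 else 0
  have hf : ∀ x y, (x ∈ A ↔ y ∈ A) → f x = f y := by
    intro x y h
    simp only [f, h]
  have fe : ∀ x, f ((glue T R o wire).edge x) = f x := fun x =>
    hf _ _ ⟨fun h => by simpa only [hD.edge_edge] using hAe _ h, hAe x⟩
  have fc : ∀ d : GlueCrossing T.Y R.Y, d ≠ c → ∀ i, f (.cr d i) = f (.cr d 0) := by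
    intro d hd
    have h0 := hAc d 0 hd
    have h1 := hAc d 1 hd
    have h2 := hAc d 2 hd
    have h3 := hAc d 3 hd
    rw [Fin.forall_four]
    exact ⟨rfl, hf _ _ ⟨fun h => h3 (h2 (h1 h)), h0⟩,
      hf _ _ ⟨fun h => h3 (h2 h), fun h => h1 (h0 h)⟩,
      hf _ _ ⟨fun h => h3 h, fun h => h2 (h1 (h0 h))⟩⟩
  have fp : ∀ q : GluePoint T.P R.P, ∀ b, f (.pt q b) = f (.pt q false) := by
    rintro q (_ | _)
    · rfl
    · exact hf _ _ ⟨hAp q true, hAp q false⟩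
  have hs : ∀ s, socketVal (fun k => f (tangleDart (.cr none (-k))))
      (fun k => f (restDart (.cr none k))) (fun i => f (.cr .pivot i)) s = f (socketDart s) := by
    rintro (k | k | k)
    · change f (.pt (.tangleEnd (- -k)) false) = _
      rw [neg_neg]
      exact (fp _ true).symm
    · exact (fp _ true).symm
    · rfl
  refine ⟨fun x => f (tangleDart x), fun x => f (restDart x), fun i => f (.cr .pivot i),
    ⟨?_, ?_, ?_⟩, ⟨?_, ?_, ?_⟩, ?_, ?_, ?_⟩
  · intro x
    rw [← fe (tangleDart x), glue_edge_tangleDart]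
  · exact fun d hd => fc (.tangle d) hd
  · exact fun q => fp (.tangle q) true
  · intro x
    rw [← fe (restDart x), glue_edge_restDart]
  · exact fun d hd => fc (.rest d) hd
  · exact fun q => fp (.rest q) true
  · intro s
    rw [hs, hs, ← glue_edge_socketDart (T := T) (R := R) (o := o)]
    exact fe _
  · exact fun h => fc .pivot h.symm
  · rintro ⟨z, h1, h2, h3⟩
    have hall : ∀ x : Dart (GlueCrossing T.Y R.Y) (GluePoint T.P R.P), f x = z := by
      rintro (⟨d | d | _, i⟩ | ⟨q | q | k | k, b⟩)
      · exact h1 (.cr (some d) i)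
      · exact h2 (.cr (some d) i)
      · exact h3 i
      · exact h1 (.pt q b)
      · exact h2 (.pt q b)
      · refine (fp (.tangleEnd k) b).trans ?_
        have := h1 (.cr none (-k))
        change f (.pt (.tangleEnd (- -k)) false) = z at this
        rwa [neg_neg] at this
      · exact (fp (.restEnd k) b).trans (h2 (.cr none k))
    refine hAuniv (Set.eq_univ_of_forall fun x => ?_)
    have h : f x = f x₀ := (hall x).trans (hall x₀).symm
    by_contra hx
    simp [f, hx, hx₀] at h

theorem isNugatory_of_colouring {c : GlueCrossing T.Y R.Y}
    {φ : Dart (Option T.Y) T.P → ZMod 2} {ψ : Dart (Option R.Y) R.P → ZMod 2}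
    {p : Fin 4 → ZMod 2} (hφ : T.IsColouring {d | .tangle d = c} φ)
    (hψ : R.IsColouring {d | .rest d = c} ψ)
    (hw : ∀ s, socketVal (fun k => φ (.cr none (-k))) (fun k => ψ (.cr none k)) p (wire s) =
      socketVal (fun k => φ (.cr none (-k))) (fun k => ψ (.cr none k)) p s)
    (hp : c ≠ .pivot → ∀ i, p i = p 0)
    (hne : ¬ ∃ z, (∀ x, φ x = z) ∧ (∀ y, ψ y = z) ∧ ∀ i, p i = z) :
    (glue T R o wire).IsNugatory c := by
  let f : Dart (GlueCrossing T.Y R.Y) (GluePoint T.P R.P) → ZMod 2 := fun x => match x with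
    | .cr (.tangle d) i => φ (.cr (some d) i)
    | .cr (.rest d) i => ψ (.cr (some d) i)
    | .cr .pivot i => p i
    | .pt (.tangle q) b => φ (.pt q b)
    | .pt (.rest q) b => ψ (.pt q b)
    | .pt (.tangleEnd k) _ => φ (.cr none (-k))
    | .pt (.restEnd k) _ => ψ (.cr none k)
  have ft : ∀ x, f (tangleDart x) = φ x := by
    rintro (⟨_ | d, i⟩ | ⟨q, b⟩)
    · change φ (.cr none (- -i)) = _
      rw [neg_neg]
    · rfl
    · rfl
  have fr : ∀ x, f (restDart x) = ψ x := by
    rintro (⟨_ | d, i⟩ | ⟨q, b⟩) <;> rfl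
  have fs : ∀ s, f (socketDart s) =
      socketVal (fun k => φ (.cr none (-k))) (fun k => ψ (.cr none k)) p s := by
    rintro (k | k | k) <;> rfl
  have fe : ∀ x, f ((glue T R o wire).edge x) = f x := by
    have hT : ∀ x, f (tangleDart (T.edge x)) = φ x := fun x => by rw [ft, hφ.edge]
    have hR : ∀ x, f (restDart (R.edge x)) = ψ x := fun x => by rw [fr, hψ.edge]
    have hS : ∀ s, f (socketDart (wire s)) = f (socketDart s) := fun s => by rw [fs, fs, hw]
    rintro (⟨d | d | _, i⟩ | ⟨q | q | k | k, b⟩)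
    · exact hT (.cr (some d) i)
    · exact hR (.cr (some d) i)
    · exact hS (.pivot i)
    · exact hT (.pt q b)
    · exact hR (.pt q b)
    · cases b
      · exact hT (.cr none (-k))
      · exact hS (.tangle k)
    · cases b
      · exact hR (.cr none k)
      · exact hS (.rest k)
  have fc : ∀ d, d ≠ c → ∀ i, f (.cr d i) = f (.cr d 0) := by
    rintro (d | d | _) hd i
    · exact hφ.crossing d hd i
    · exact hψ.crossing d hd i
    · exact hp hd.symm i
  have fp : ∀ q b, f (.pt q b) = f (.pt q false) := by
    rintro (q | q | k | k) (_ | _)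
    all_goals first | rfl | exact hφ.point q | exact hψ.point q
  obtain ⟨x, y, hxy⟩ : ∃ x y, f x ≠ f y := by
    by_contra hno
    push Not at hno
    have fi : ∀ i, f (.cr .pivot i) = p i := fun _ => rfl
    refine hne ⟨p 0, fun x => ?_, fun y => ?_, fun i => ?_⟩
    · rw [← ft, ← fi, hno (tangleDart x) (.cr .pivot 0)]
    · rw [← fr, ← fi, hno (restDart y) (.cr .pivot 0)]
    · rw [← fi, ← fi, hno (.cr .pivot i) (.cr .pivot 0)]
  refine ⟨{z | f z = f x}, ⟨x, rfl⟩, fun h => ?_, fun z hz => (fe z).trans hz, ?_, ?_⟩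
  · exact hxy ((h ▸ Set.mem_univ y : y ∈ {z | f z = f x}) : f y = f x).symm
  · intro d i hd hz
    exact ((fc d hd (i + 1)).trans (fc d hd i).symm).trans hz
  · intro q b hz
    exact ((fp q (!b)).trans (fp q b).symm).trans hz

/-- A flype does not create nugatory crossings: two-colourings of the parts which fit together after
the flype fit together before the flype, if necessary after exchanging the colours in the tangle. -/
theorem DiagramData.IsReduced.of_flype (hT : T.IsTangle) (hR : R.IsTangle)
    (hD : (glue T.turn R o wireLeft).IsDiagram) (h : (glue T R o wireRight).IsReduced) :
    (glue T.turn R o wireLeft).IsReduced := by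
  intro c hc
  obtain ⟨φ', ψ, p, hφ', hψ, hw, hp, hne⟩ := exists_colouring_of_isNugatory hD hc
  obtain ⟨φ, hφdef⟩ : ∃ φ : Dart (Option T.Y) T.P → ZMod 2,
      φ = fun x => φ' (halfTurn (Y := T.Y) (P := T.P) x) := ⟨_, rfl⟩
  have hφ : T.IsColouring {d | .tangle d = c} φ := hφdef ▸ hφ'.of_turn
  have hφφ' : ∀ x : Dart (Option T.Y) T.P, φ' x = φ (halfTurn x) := by
    intro x
    rw [hφdef]
    exact congrArg φ' (halfTurn_halfTurn x).symm
  have w0 : φ (.cr none 3) = p 3 := (hφφ' (.cr none 0)).symm.trans (hw (.tangle 0)).symm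
  have w1 : φ (.cr none 0) = p 2 := (hφφ' (.cr none 3)).symm.trans (hw (.tangle 1)).symm
  have w2 : φ (.cr none 1) = ψ (.cr none 2) := (hφφ' (.cr none 2)).symm.trans (hw (.tangle 2)).symm
  have w3 : φ (.cr none 2) = ψ (.cr none 3) := (hφφ' (.cr none 1)).symm.trans (hw (.tangle 3)).symm
  have w4 : ψ (.cr none 0) = p 0 := (hw (.rest 0)).symm
  have w5 : ψ (.cr none 1) = p 1 := (hw (.rest 1)).symm
  have hne' : ¬ ∃ z, (∀ x, φ x = z) ∧ (∀ y, ψ y = z) ∧ ∀ i, p i = z := by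
    rintro ⟨z, h1, h2⟩
    exact hne ⟨z, fun x => (hφφ' x).trans (h1 _), h2⟩
  by_cases hcp : c = .pivot
  · subst hcp
    have hTe : {d : T.Y | (.tangle d : GlueCrossing T.Y R.Y) = .pivot} = ∅ := by
      ext d
      simp
    have hRe : {d : R.Y | (.rest d : GlueCrossing T.Y R.Y) = .pivot} = ∅ := by
      ext d
      simp
    have sT := (hTe ▸ hφ).sum_ends hT
    have sR := (hRe ▸ hψ).sum_ends hR
    -- As the number of ends of each colour is even, the colourings of the tangle and of the rest
    -- fit together at the two ends on the left, after exchanging the colours in the tangle if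
    -- `z = 1`. The values at the two ends on the right are irrelevant, since the pivot is exempt.
    obtain ⟨z, hz0, hz1⟩ : ∃ z, φ (.cr none 0) + z = ψ (.cr none 0) ∧
        φ (.cr none 3) + z = ψ (.cr none 1) := by
      rw [w2, w3] at sT
      clear hne hne' w0 w1 w2 w3 w4 w5
      generalize φ (.cr none 0) = x0 at *
      generalize φ (.cr none 3) = x3 at *
      generalize ψ (.cr none 0) = y0 at *
      generalize ψ (.cr none 1) = y1 at *
      generalize ψ (.cr none 2) = y2 at *
      generalize ψ (.cr none 3) = y3 at *
      clear * - sT sR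
      revert x0 x3 y0 y1 y2 y3
      decide
    refine h .pivot (isNugatory_of_colouring (p := ![φ (.cr none 1) + z, φ (.cr none 2) + z,
      ψ (.cr none 2), ψ (.cr none 3)]) (hφ.add_const z) hψ ?_ (fun h => (h rfl).elim) ?_)
    · rw [Socket.forall_socket, Fin.forall_four, Fin.forall_four, Fin.forall_four]
      exact ⟨⟨hz0.symm, hz1.symm, rfl, rfl⟩, ⟨hz0, hz1, rfl, rfl⟩, rfl, rfl, rfl, rfl⟩
    · rintro ⟨y, h1, h2, -⟩
      have hz : z = 0 := by
        have := h1 (.cr none 1)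
        rw [w2, h2] at this
        simpa using this
      subst hz
      simp only [add_zero] at h1
      refine hne' ⟨y, h1, h2, ?_⟩
      rw [Fin.forall_four, ← w0, ← w1, ← w4, ← w5]
      exact ⟨h2 _, h2 _, h1 _, h1 _⟩
  · have hp' := hp hcp
    -- One of the two parts contains only crossings at which the colouring is constant.
    have h23 : ψ (.cr none 2) = ψ (.cr none 3) := by
      have aux : ∀ a x y : ZMod 2, (a + x + y + a = 0 → x = y) ∧ (a + a + x + y = 0 → x = y) := by
        decide
      rcases c with c | c | _
      · have hRe : {d : R.Y | (.rest d : GlueCrossing T.Y R.Y) = .tangle c} = ∅ := by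
          ext d
          simp
        have s := (hRe ▸ hψ).sum_ends hR
        rw [w4, w5, hp' 1] at s
        exact (aux _ _ _).2 s
      · have hTe : {d : T.Y | (.tangle d : GlueCrossing T.Y R.Y) = .rest c} = ∅ := by
          ext d
          simp
        have s := (hTe ▸ hφ).sum_ends hT
        rw [w0, w1, hp' 2, hp' 3, w2, w3] at s
        exact (aux _ _ _).1 s
      · exact (hcp rfl).elim
    refine h c (isNugatory_of_colouring (p := fun _ => ψ (.cr none 2)) hφ hψ ?_ (fun _ _ => rfl) ?_)
    · have e0 : ψ (.cr none 0) = φ (.cr none 0) := by rw [w4, w1, hp' 2]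
      have e1 : ψ (.cr none 1) = φ (.cr none 3) := by rw [w5, w0, hp' 1, hp' 3]
      rw [Socket.forall_socket, Fin.forall_four, Fin.forall_four, Fin.forall_four]
      exact ⟨⟨e0, e1, h23.trans w3.symm, w2.symm⟩, ⟨e0.symm, e1.symm, rfl, h23⟩, w2,
        w3.trans h23.symm, rfl, h23.symm⟩
    · rintro ⟨y, h1, h2, -⟩
      refine hne' ⟨y, h1, h2, fun i => ?_⟩
      rw [hp' i, ← w4, h2]

end

/-! ### Sequences of flypes -/

/-- If a reduced link diagram `D₁` and a link diagram `D₂` are related by a sequence of flypes, then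
their Seifert graphs are related by a sequence of Whitney flips of Types A, B or C. -/
theorem theorem1 (D₁ D₂ : LinkDiagram) (hred : D₁.IsReduced) (h : D₁.FlypeRelated D₂) :
    D₁.seifertGraph.FlipEquivalent D₂.seifertGraph := by
  -- Along the sequence of flypes the Seifert graphs are realized on the fixed vertex set and edge
  -- set of the first one. All diagrams in the sequence are reduced.
  have key : ∃ ends : D₁.X → Sym2 D₁.SeifertCircle,
      Relation.ReflTransGen Graph.WhitneyFlip D₁.seifertGraph (Graph.ofEnds ends) ∧
      DiagramData.Presents ends D₂.toDiagramData ∧ D₂.toDiagramData.IsReduced := by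
    induction h with
    | refl =>
      refine ⟨_, ?_, D₁.presents, hred⟩
      rw [← LinkDiagram.seifertGraph_eq]
    | @tail D E _ hDE ih =>
      obtain ⟨ends, hflips, hpres, hDred⟩ := ih
      rcases hDE with ⟨T, R, o, hT, hR, ⟨Φ⟩, ⟨Ψ⟩⟩ | hDE | hDE
      · have hD := Φ.isDiagram D.isDiagram
        have hE := Ψ.isDiagram E.isDiagram
        obtain ⟨ends', hflips', hpres'⟩ := exists_flips_presents_left hT hR hD (hDred.of_iso Φ)
          (hpres.of_iso D.isDiagram Φ)
        exact ⟨ends', hflips.trans hflips', hpres'.of_iso hE Ψ.symm,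
          (DiagramData.IsReduced.of_flype hT hR hE (hDred.of_iso Φ)).of_iso Ψ.symm⟩
      · exact ⟨ends, hflips, (hDE.presents_iff).1 hpres, (hDE.isReduced_iff).1 hDred⟩
      · exact ⟨ends, hflips, (hDE.presents_iff).2 hpres, (hDE.isReduced_iff).2 hDred⟩
  obtain ⟨ends, hflips, hpres, -⟩ := key
  exact ⟨_, hflips, LinkDiagram.isomorphic_of_presents hpres⟩
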